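/- There are a deterministic algorithm $A$ and constants $C$ and $c$ such that the following holds for every finite simple graph $G$ with $n\ge 1$ vertices and maximum degree at most $3$, and for every integer $k\ge 0$. On input $(G,k)$, the algorithm $A$ decides correctly whether $G$ has a spanning tree with at least $k$ internal vertices, where a vertex is internal in a tree $T$ if its degree in $T$ is at least $2$ (so if $G$ is disconnected, the answer is "no"), and $A$ halts in time at most $C\cdot 2.7321^{k}\cdot n^{c}$. Here $A$ is one program for a random access machine whose cells hold natural numbers, with constant assignment, copying, addition, truncated subtraction, indirect load and store, branching and looping on tests for zero; time is the logarithmic cost (every operation costs one plus the number of binary digits of the numbers and addresses that it handles); the input consists of $n$, $k$ and the adjacency matrix of $G$. -/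

import Mathlib

namespace MIST

/-! ## Graphs, spanning trees and internal vertices -/

section Graphs

variable {V : Type*} [Fintype V]

open Classical in
/-- A graph is subcubic if every vertex has degree at most three. -/
def IsSubcubic (G : SimpleGraph V) : Prop :=
  ∀ v, G.degree v ≤ 3

open Classical in
/-- The internal vertices of a tree `T`: those which are not leaves, that is, which have at least
two neighbours in `T`. -/
noncomputable def internalVertices (T : SimpleGraph V) : Finset V :=
  {v | 2 ≤ T.degree v}

/-- `T` is a spanning tree of `G`: a tree on all the vertices of `G` that uses only edges
of `G`. -/
def IsSpanningTree (T G : SimpleGraph V) : Prop :=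
  T ≤ G ∧ T.IsTree

/-- The decision problem: `G` has a spanning tree with at least `k` internal vertices. -/
def HasInternalSpanningTree (G : SimpleGraph V) (k : ℕ) : Prop :=
  ∃ T : SimpleGraph V, IsSpanningTree T G ∧ k ≤ (internalVertices T).card

end Graphs

/-! ## Random access machines with logarithmic cost

A machine has registers, which are named by the program, and an unbounded memory, which is
accessed through addresses held in registers.  All cells hold natural numbers.  Programs are
structured (sequencing, tests for zero, loops).  The cost of an operation is one plus the number
of binary digits of all the numbers it handles, addresses included. -/

/-- The contents of the registers and of the memory. -/
@[ext]
structure State where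
  reg : ℕ → ℕ
  mem : ℕ → ℕ

/-- The elementary instructions; `x`, `y`, `z` are names of registers. -/
inductive Instr where
  /-- `x := c` -/
  | const (x c : ℕ)
  /-- `x := y` -/
  | copy (x y : ℕ)
  /-- `x := y + z` -/
  | add (x y z : ℕ)
  /-- `x := max (y - z) 0` -/
  | sub (x y z : ℕ)
  /-- `x := mem[y]` -/
  | load (x y : ℕ)
  /-- `mem[x] := y` -/
  | store (x y : ℕ)

/-- The effect of an instruction. -/
def Instr.run : Instr → State → State
  | .const x c, s => { s with reg := Function.update s.reg x c }
  | .copy x y, s => { s with reg := Function.update s.reg x (s.reg y) }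
  | .add x y z, s => { s with reg := Function.update s.reg x (s.reg y + s.reg z) }
  | .sub x y z, s => { s with reg := Function.update s.reg x (s.reg y - s.reg z) }
  | .load x y, s => { s with reg := Function.update s.reg x (s.mem (s.reg y)) }
  | .store x y, s => { s with mem := Function.update s.mem (s.reg x) (s.reg y) }

/-- The logarithmic cost of an instruction; `Nat.size a` is the number of binary digits
of `a`. -/
def Instr.cost : Instr → State → ℕ
  | .const _ c, _ => 1 + c.size
  | .copy _ y, s => 1 + (s.reg y).size
  | .add _ y z, s => 1 + (s.reg y).size + (s.reg z).size
  | .sub _ y z, s => 1 + (s.reg y).size + (s.reg z).size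
  | .load _ y, s => 1 + (s.reg y).size + (s.mem (s.reg y)).size
  | .store x y, s => 1 + (s.reg x).size + (s.reg y).size

/-- Programs. -/
inductive Prog where
  | skip
  | instr (i : Instr)
  | seq (p q : Prog)
  /-- if register `x` is nonzero then `p` else `q` -/
  | ite (x : ℕ) (p q : Prog)
  /-- while register `x` is nonzero do `p` -/
  | loop (x : ℕ) (p : Prog)

/-- `Exec p s t s'`: started in the state `s`, the program `p` halts in the state `s'`, and the
total cost of the run is `t`. -/
inductive Exec : Prog → State → ℕ → State → Prop
  | skip (s : State) : Exec .skip s 1 s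
  | instr (i : Instr) (s : State) : Exec (.instr i) s (i.cost s) (i.run s)
  | seq {p q : Prog} {s s₁ s₂ : State} {t₁ t₂ : ℕ} :
      Exec p s t₁ s₁ → Exec q s₁ t₂ s₂ → Exec (.seq p q) s (t₁ + t₂) s₂
  | ite_true {x : ℕ} {p q : Prog} {s s₁ : State} {t : ℕ} :
      s.reg x ≠ 0 → Exec p s t s₁ → Exec (.ite x p q) s (1 + (s.reg x).size + t) s₁
  | ite_false {x : ℕ} {p q : Prog} {s s₁ : State} {t : ℕ} :
      s.reg x = 0 → Exec q s t s₁ → Exec (.ite x p q) s (1 + (s.reg x).size + t) s₁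
  | loop_true {x : ℕ} {p : Prog} {s s₁ s₂ : State} {t₁ t₂ : ℕ} :
      s.reg x ≠ 0 → Exec p s t₁ s₁ → Exec (.loop x p) s₁ t₂ s₂ →
        Exec (.loop x p) s (1 + (s.reg x).size + t₁ + t₂) s₂
  | loop_false {x : ℕ} {p : Prog} {s : State} :
      s.reg x = 0 → Exec (.loop x p) s (1 + (s.reg x).size) s

/-- The machine is deterministic: the cost and the final state of a run depend only on the program
and on the initial state. -/
theorem Exec.deterministic {p : Prog} {s s₁ s₂ : State} {t₁ t₂ : ℕ}
    (h₁ : Exec p s t₁ s₁) (h₂ : Exec p s t₂ s₂) : t₁ = t₂ ∧ s₁ = s₂ := by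
  induction h₁ generalizing t₂ s₂ with
  | skip => cases h₂; exact ⟨rfl, rfl⟩
  | instr => cases h₂; exact ⟨rfl, rfl⟩
  | seq _ _ ih₁ ih₂ =>
    cases h₂ with
    | seq a b =>
      obtain ⟨rfl, rfl⟩ := ih₁ a
      obtain ⟨rfl, rfl⟩ := ih₂ b
      exact ⟨rfl, rfl⟩
  | ite_true hx _ ih =>
    cases h₂ with
    | ite_true _ a => obtain ⟨rfl, rfl⟩ := ih a; exact ⟨rfl, rfl⟩
    | ite_false h _ => exact absurd h hx
  | ite_false hx _ ih =>
    cases h₂ with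
    | ite_true h _ => exact absurd hx h
    | ite_false _ a => obtain ⟨rfl, rfl⟩ := ih a; exact ⟨rfl, rfl⟩
  | loop_true hx _ _ ih₁ ih₂ =>
    cases h₂ with
    | loop_true _ a b =>
      obtain ⟨rfl, rfl⟩ := ih₁ a
      obtain ⟨rfl, rfl⟩ := ih₂ b
      exact ⟨rfl, rfl⟩
    | loop_false h => exact absurd h hx
  | loop_false hx =>
    cases h₂ with
    | loop_true h _ _ => exact absurd hx h
    | loop_false _ => exact ⟨rfl, rfl⟩

open Classical in
/-- The initial state for the instance `(G, k)`: register `0` holds the number `n` of vertices,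
register `1` holds `k`, the memory holds the adjacency matrix of `G` row by row (the entry for
`(i, j)` at address `n * i + j`), and everything else is `0`. -/
noncomputable def inputState {n : ℕ} (G : SimpleGraph (Fin n)) (k : ℕ) : State where
  reg x := if x = 0 then n else if x = 1 then k else 0
  mem a := if ∃ i j : Fin n, a = n * (i : ℕ) + (j : ℕ) ∧ G.Adj i j then 1 else 0

open Classical in
/-- Started on the instance `(G, k)`, the program halts with total cost `t`, and register `0`
then holds `1` if `G` has a spanning tree with at least `k` internal vertices, and `0`
otherwise. -/
def AnswersInTime (p : Prog) {n : ℕ} (G : SimpleGraph (Fin n)) (k t : ℕ) : Prop :=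
  ∃ s : State, Exec p (inputState G k) t s ∧
    s.reg 0 = if HasInternalSpanningTree G k then 1 else 0

end MIST

namespace MIST

/-! ### Partial trees and the exchange argument -/

section PartialTrees

open Classical SimpleGraph

variable {V : Type*}

/-! The algorithm grows a subtree from an edge at vertex `0`. A status function codes it: `0` is
outside, `1` is open (currently a leaf), `2` is closed (internal, and receiving no further edge to
the outside). Expanding an open vertex `v` means closing it and attaching a nonempty set of its
outside neighbours. This is complete by an exchange (`Extendable.exists_adj`): if `v` stays a leaf
in the target spanning tree, an outside neighbour `u` is reattached to `v` in place of the first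
vertex `w` on its way to `v`; then `v` becomes internal, and only `w` may cease to be so. Hence any
open vertex with outside neighbours may be chosen for expansion (`Extendable.exists_grow`). In a
subcubic graph it has at most two of them, so there are three descendants, or just one if it has a
single outside neighbour; call it free then.

The search is pruned by a greedy completion, which always attaches all outside neighbours. If it
fails to span, the partial tree is not extendable (`GreedyRun.outSet_eq_empty`). If it spans with at
least `k` closed vertices, the answer is yes. Otherwise the partial tree is `Live`; as every
expansion attaches at most two vertices, at most `2 * (k - c) - 2` vertices are then outside, where
`c` vertices are closed.

The size of the search tree is controlled by a measure: 6 for every closed vertex still missing,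
minus 1 for every low vertex (outside, with at most two neighbours that are not closed), minus 5 if
there is a free vertex. Liveness makes it nonnegative (`Live.measure_nonneg`). Expanding a free
vertex does not raise it, since the 6 gained pays for losing the free vertex and one low vertex. At
a branching, an omitted neighbour becomes low, or can never be reached if it had no other neighbour
that is not closed; an attached neighbour with exactly two such neighbours yields a free vertex. In
all nine cases the weights `ratio ^ measure` of the descendants sum to at most that of the parent
(`weight_branch`). As `ratio ^ 6 ≤ 2.7321` and the measure is at most `6 * k`, a polynomial multiple
of `2.7321 ^ k` partial trees are visited.

For the machine, a small language of bounded loops is given a denotational semantics and compiled.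
One induction (`Cmd.exec_compile`) gives polynomial time, because truncated additions make numbers
grow only additively. The search keeps an explicit stack, and every step lowers the sum of the
potentials on it by at least 1 (`body_spec`, `loop_spec`). -/

theorem adj_of_le_of_reachable {T T' : SimpleGraph V} (hT' : T'.IsAcyclic) (hle : T ≤ T') {a b : V}
    (hr : T.Reachable a b) (hab : T'.Adj a b) : T.Adj a b := by
  by_contra hn
  -- If `T` lacked the edge, a walk in `T` would join its ends without it, so it would not be a
  -- bridge of `T'`.
  refine isAcyclic_iff_forall_adj_isBridge.1 hT' hab ?_
  refine hr.mono fun x y hxy => ?_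
  rw [deleteEdges_adj]
  refine ⟨hle hxy, fun h => ?_⟩
  rw [Set.mem_singleton_iff, Sym2.eq_iff] at h
  rcases h with ⟨rfl, rfl⟩ | ⟨rfl, rfl⟩
  · exact hn hxy
  · exact hn hxy.symm

/-- Attaching the vertex `u` of a tree to another vertex `v` in place of some neighbour `w`. -/
theorem exists_isTree_reattach {T : SimpleGraph V} (hT : T.IsTree) {u v : V} (huv : u ≠ v)
    (hn : ¬ T.Adj u v) :
    ∃ w, T.Adj u w ∧ w ≠ v ∧ (T.deleteEdges {s(u, w)} ⊔ edge v u).IsTree := by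
  obtain ⟨p⟩ := hT.connected.preconnected u v
  obtain ⟨p, hp⟩ := p.toPath
  cases p with
  | nil => exact absurd rfl huv
  | @cons _ w _ h p =>
    rw [Walk.cons_isPath_iff] at hp
    have hwv : w ≠ v := by rintro rfl; exact hn h
    set D := T.deleteEdges {s(u, w)} with hD
    -- The rest of the path does not return to `u`, so it survives the deletion: `w` stays on the
    -- side of `v`, and the edge `vu` rejoins the two sides.
    have hwvr : D.Reachable w v := by
      rw [hD, reachable_deleteEdges_iff_exists_walk]
      exact ⟨p, fun hh => hp.2 (p.fst_mem_support_of_mem_edges hh)⟩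
    have hbr : ¬ D.Reachable u w := isAcyclic_iff_forall_adj_isBridge.1 hT.isAcyclic h
    have hac : (D ⊔ edge v u).IsAcyclic :=
      (hT.isAcyclic.anti (deleteEdges_le _)).sup_edge_of_not_reachable
        fun hh => hbr (hwvr.trans hh).symm
    have huw : (D ⊔ edge v u).Reachable u w := by
      have h1 : (D ⊔ edge v u).Adj u v := Or.inr (by rw [edge_adj]; exact ⟨Or.inr ⟨rfl, rfl⟩, huv⟩)
      exact h1.reachable.trans (hwvr.symm.mono le_sup_left)
    have hadj : ∀ a b, T.Adj a b → (D ⊔ edge v u).Reachable a b := by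
      intro a b hab
      by_cases he : s(a, b) = s(u, w)
      · rcases Sym2.eq_iff.1 he with ⟨rfl, rfl⟩ | ⟨rfl, rfl⟩
        · exact huw
        · exact huw.symm
      · refine Adj.reachable (Or.inl ?_)
        rw [hD, deleteEdges_adj]
        exact ⟨hab, he⟩
    have hpre : (D ⊔ edge v u).Preconnected := by
      intro a b
      obtain ⟨q⟩ := hT.connected.preconnected a b
      induction q with
      | nil => exact Reachable.refl _
      | cons h' _ ih => exact (hadj _ _ h').trans ih
    have : Nonempty V := ⟨u⟩
    exact ⟨w, h, hwv, ⟨⟨hpre⟩, hac⟩⟩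

/-- The star with centre `v` and set of leaves `S`. -/
def star (v : V) (S : Finset V) : SimpleGraph V where
  Adj a b := a ≠ b ∧ (a = v ∧ b ∈ S ∨ b = v ∧ a ∈ S)
  symm := ⟨fun _ _ h => ⟨h.1.symm, h.2.symm⟩⟩
  loopless := ⟨fun _ h => h.1 rfl⟩

theorem star_adj {v a b : V} {S : Finset V} :
    (star v S).Adj a b ↔ a ≠ b ∧ (a = v ∧ b ∈ S ∨ b = v ∧ a ∈ S) := Iff.rfl

theorem star_insert (v u : V) (S : Finset V) : star v (insert u S) = star v S ⊔ edge v u := by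
  ext a b
  simp only [star_adj, sup_adj, edge_adj, Finset.mem_insert]
  grind

/-- The leaves are added one at a time; each is still isolated when its edge arrives, so no cycle is
closed. -/
theorem isAcyclic_sup_star {T : SimpleGraph V} (hT : T.IsAcyclic) {v : V} (S : Finset V)
    (hv : v ∉ S) (hS : ∀ u ∈ S, ∀ w, ¬ T.Adj u w) : (T ⊔ star v S).IsAcyclic := by
  induction S using Finset.induction_on with
  | empty =>
    have : star v ∅ = (⊥ : SimpleGraph V) := by ext; simp [star_adj]
    simpa [this] using hT
  | insert u S hu ih =>
    rw [star_insert, ← sup_assoc]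
    have hvu : v ≠ u := fun h => hv (by simp [h])
    refine (ih (fun h => hv (Finset.mem_insert_of_mem h))
      (fun x hx => hS x (Finset.mem_insert_of_mem hx))).sup_edge_of_not_reachable ?_
    intro hr
    refine not_reachable_of_neighborSet_right_eq_empty hvu ?_ hr
    ext w
    simp only [mem_neighborSet, sup_adj, star_adj, Set.mem_empty_iff_false, iff_false]
    rintro (h | ⟨-, ⟨h, -⟩ | ⟨-, h⟩⟩)
    · exact hS u (by simp) w h
    · exact hvu h.symm
    · exact hu h

/-- Close `v` and attach to it the vertices of `S`. -/
noncomputable def grow (σ : V → ℕ) (v : V) (S : Finset V) : V → ℕ :=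
  fun w => if w = v then 2 else if w ∈ S then 1 else σ w

/-- `T` is a tree on the vertices `v` with `σ v ≠ 0`; the vertices with `σ v = 1` are leaves
of `T`, those with `σ v = 2` are internal. -/
structure PartialTree (G : SimpleGraph V) (σ : V → ℕ) (T : SimpleGraph V) : Prop where
  le : T ≤ G
  acyclic : T.IsAcyclic
  support : ∀ {a b}, T.Adj a b → σ a ≠ 0
  reachable : ∀ {a b}, σ a ≠ 0 → σ b ≠ 0 → T.Reachable a b
  leaf : ∀ {v}, σ v = 1 → ∃ w, T.Adj v w ∧ ∀ w', T.Adj v w' → w' = w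
  internal : ∀ {v}, σ v = 2 → ∃ a b, a ≠ b ∧ T.Adj v a ∧ T.Adj v b
  le_two : ∀ v, σ v ≤ 2
  nonempty : ∃ v, σ v ≠ 0

variable [Fintype V]

theorem mem_internalVertices {T : SimpleGraph V} {v : V} :
    v ∈ internalVertices T ↔ ∃ a b, a ≠ b ∧ T.Adj v a ∧ T.Adj v b := by
  rw [internalVertices, Finset.mem_filter, ← card_neighborFinset_eq_degree,
    Nat.succ_le_iff, Finset.one_lt_card]
  simp only [Finset.mem_univ, true_and, mem_neighborFinset]
  exact ⟨fun ⟨a, ha, b, hb, h⟩ => ⟨a, b, h, ha, hb⟩, fun ⟨a, b, h, ha, hb⟩ => ⟨a, ha, b, hb, h⟩⟩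

/-- The neighbours of `v` that lie outside the partial tree. -/
noncomputable def outN (G : SimpleGraph V) (σ : V → ℕ) (v : V) : Finset V :=
  {u | G.Adj v u ∧ σ u = 0}

theorem mem_outN {G : SimpleGraph V} {σ : V → ℕ} {v u : V} :
    u ∈ outN G σ v ↔ G.Adj v u ∧ σ u = 0 := by simp [outN]

/-- The vertices of `S` are isolated in `T`, so they become leaves. The vertex `v` keeps its old
neighbour and gains one from `S`; nonemptiness is what makes it internal. -/
theorem PartialTree.grow {G T : SimpleGraph V} {σ : V → ℕ} (h : PartialTree G σ T) {v : V}
    (hv : σ v = 1) {S : Finset V} (hS : S ⊆ outN G σ v) (hne : S.Nonempty) :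
    PartialTree G (grow σ v S) (T ⊔ star v S) := by
  have hS0 : ∀ u ∈ S, σ u = 0 := fun u hu => (mem_outN.1 (hS hu)).2
  have hvS : v ∉ S := fun hvS => by simp [hS0 v hvS] at hv
  have hST : ∀ u ∈ S, ∀ w, ¬ T.Adj u w := fun u hu w hw => h.support hw (hS0 u hu)
  have hg : ∀ w, MIST.grow σ v S w ≠ 0 ↔ σ w ≠ 0 ∨ w ∈ S := by
    intro w
    unfold MIST.grow
    split_ifs with h1 h2
    · subst h1; simp [hv]
    · simp [h2]
    · simp [h2]
  have hr : ∀ w, MIST.grow σ v S w ≠ 0 → (T ⊔ star v S).Reachable w v := by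
    intro w hw
    rcases (hg w).1 hw with h1 | h1
    · exact (h.reachable h1 (by omega)).mono le_sup_left
    · refine Adj.reachable (Or.inr ⟨fun h2 => hvS (h2 ▸ h1), Or.inr ⟨rfl, h1⟩⟩)
  refine ⟨?_, isAcyclic_sup_star h.acyclic S hvS hST, ?_, ?_, ?_, ?_, ?_, ?_⟩
  · refine sup_le h.le ?_
    rintro a b ⟨-, ⟨rfl, hb⟩ | ⟨rfl, hb⟩⟩
    · exact (mem_outN.1 (hS hb)).1
    · exact (mem_outN.1 (hS hb)).1.symm
  · rintro a b (hab | ⟨-, ⟨rfl, hb⟩ | ⟨rfl, hb⟩⟩)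
    · exact (hg a).2 (Or.inl (h.support hab))
    · exact (hg a).2 (Or.inl (by omega))
    · exact (hg a).2 (Or.inr hb)
  · intro a b ha hb
    exact (hr a ha).trans (hr b hb).symm
  · intro w hw
    have hwv : w ≠ v := by rintro rfl; simp [MIST.grow] at hw
    by_cases hwS : w ∈ S
    · refine ⟨v, Or.inr ⟨hwv, Or.inr ⟨rfl, hwS⟩⟩, ?_⟩
      rintro w' (h1 | ⟨-, ⟨h1, -⟩ | ⟨h1, -⟩⟩)
      · exact absurd h1 (hST w hwS w')
      · exact absurd h1 hwv
      · exact h1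
    · obtain ⟨a, ha, ha'⟩ := h.leaf (v := w) (by simpa [MIST.grow, hwv, hwS] using hw)
      refine ⟨a, Or.inl ha, ?_⟩
      rintro w' (h1 | ⟨-, ⟨h1, -⟩ | ⟨-, h1⟩⟩)
      · exact ha' w' h1
      · exact absurd h1 hwv
      · exact absurd h1 hwS
  · intro w hw
    by_cases hwv : w = v
    · subst hwv
      obtain ⟨a, ha, -⟩ := h.leaf hv
      obtain ⟨u, hu⟩ := hne
      refine ⟨a, u, ?_, Or.inl ha, Or.inr ⟨fun h2 => hvS (h2 ▸ hu), Or.inl ⟨rfl, hu⟩⟩⟩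
      rintro rfl
      exact hST a hu _ ha.symm
    · have hwS : w ∉ S := fun h1 => by simp [MIST.grow, hwv, h1] at hw
      obtain ⟨a, b, hab, ha, hb⟩ := h.internal (v := w) (by simpa [MIST.grow, hwv, hwS] using hw)
      exact ⟨a, b, hab, Or.inl ha, Or.inl hb⟩
  · intro w
    have := h.le_two w
    unfold MIST.grow
    split_ifs <;> omega
  · exact ⟨v, (hg v).2 (Or.inl (by omega))⟩

/-- The partial tree `σ` extends to a spanning tree with at least `k` internal vertices, without
edges between closed and outside vertices. -/
def Extendable (G : SimpleGraph V) (k : ℕ) (σ : V → ℕ) : Prop :=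
  ∃ T T', PartialTree G σ T ∧ T ≤ T' ∧ IsSpanningTree T' G ∧ k ≤ (internalVertices T').card ∧
    ∀ a b, σ a = 2 → σ b = 0 → ¬ T'.Adj a b

/-- The exchange argument: an open vertex with outside neighbours may be assumed to be joined to one
of them in the target tree. -/
theorem Extendable.exists_adj {G : SimpleGraph V} {k : ℕ} {σ : V → ℕ} (h : Extendable G k σ)
    {v : V} (hv : σ v = 1) (hne : (outN G σ v).Nonempty) :
    ∃ T T', PartialTree G σ T ∧ T ≤ T' ∧ IsSpanningTree T' G ∧ k ≤ (internalVertices T').card ∧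
    (∀ a b, σ a = 2 → σ b = 0 → ¬ T'.Adj a b) ∧ ∃ u, σ u = 0 ∧ T'.Adj v u := by
  obtain ⟨T, T', hT, hle, hs, hk, hf⟩ := h
  by_cases hu : ∃ u, σ u = 0 ∧ T'.Adj v u
  · exact ⟨T, T', hT, hle, hs, hk, hf, hu⟩
  push Not at hu
  obtain ⟨u, hu'⟩ := hne
  obtain ⟨hvu, hu0⟩ := mem_outN.1 hu'
  obtain ⟨w, huw, hwv, htree⟩ := exists_isTree_reattach hs.2 hvu.ne.symm
    (fun h => hu u hu0 h.symm)
  have hedge : (T'.deleteEdges {s(u, w)} ⊔ edge v u).Adj v u :=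
    Or.inr (by rw [edge_adj]; exact ⟨Or.inl ⟨rfl, rfl⟩, hvu.ne⟩)
  have hdel : ∀ {a b}, T'.Adj a b → a ≠ u → b ≠ u →
      (T'.deleteEdges {s(u, w)} ⊔ edge v u).Adj a b := by
    intro a b hab ha hb
    refine Or.inl ?_
    rw [deleteEdges_adj]
    refine ⟨hab, fun h => ?_⟩
    rw [Set.mem_singleton_iff, Sym2.eq_iff] at h
    rcases h with ⟨h, -⟩ | ⟨-, h⟩
    · exact ha h
    · exact hb h
  have hTu : ∀ {a b}, T.Adj a b → a ≠ u := fun hab h => hT.support hab (h ▸ hu0)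
  refine ⟨T, _, hT, fun a b hab => hdel (hle hab) (hTu hab) (hTu hab.symm), ⟨?_, htree⟩, ?_, ?_,
    u, hu0, hedge⟩
  · refine sup_le ((deleteEdges_le _).trans hs.1) ?_
    rw [edge_le_iff]
    exact Or.inr hvu
  · refine hk.trans ?_
    -- All `T'`-edges at `v` lead into the partial tree, hence are edges of `T`, where `v` is a
    -- leaf. So `v` is newly internal after the exchange and compensates for a possible loss at `w`.
    have hvI : v ∉ internalVertices T' := by
      rw [mem_internalVertices]
      rintro ⟨a, b, hab, ha, hb⟩
      have key : ∀ c, T'.Adj v c → T.Adj v c := by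
        intro c hc
        refine adj_of_le_of_reachable hs.2.isAcyclic hle
          (hT.reachable (by omega) fun h0 => hu c h0 hc) hc
      obtain ⟨x, -, hx⟩ := hT.leaf hv
      exact hab ((hx a (key a ha)).trans (hx b (key b hb)).symm)
    have hsub : insert v ((internalVertices T').erase w) ⊆
        internalVertices (T'.deleteEdges {s(u, w)} ⊔ edge v u) := by
      intro x hx
      rw [mem_internalVertices]
      rw [Finset.mem_insert, Finset.mem_erase] at hx
      rcases hx with rfl | ⟨hxw, hx⟩
      · obtain ⟨y, hy, -⟩ := hT.leaf hv
        exact ⟨y, u, hTu hy.symm, hdel (hle hy) (hTu hy) (hTu hy.symm), hedge⟩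
      · obtain ⟨a, b, hab, ha, hb⟩ := mem_internalVertices.1 hx
        -- At `u` itself the neighbour `w` is merely replaced by `v`, which was not a neighbour
        -- before.
        by_cases hxu : x = u
        · subst hxu
          have hxv : ∀ {c}, T'.Adj x c → c ≠ v := fun hc h => hu x hu0 (h ▸ hc.symm)
          have hcw : ∀ {c}, T'.Adj x c → c ≠ w →
              (T'.deleteEdges {s(x, w)} ⊔ edge v x).Adj x c := by
            intro c hc hcw
            refine Or.inl ?_
            rw [deleteEdges_adj]
            refine ⟨hc, fun h => ?_⟩
            rw [Set.mem_singleton_iff, Sym2.eq_iff] at h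
            rcases h with ⟨-, h⟩ | ⟨h, -⟩
            · exact hcw h
            · exact hxw h
          by_cases haw : a = w
          · exact ⟨v, b, (hxv hb).symm, hedge.symm, hcw hb (fun h => hab (haw.trans h.symm))⟩
          · exact ⟨v, a, (hxv ha).symm, hedge.symm, hcw ha haw⟩
        · have hxc : ∀ {c}, T'.Adj x c → (T'.deleteEdges {s(u, w)} ⊔ edge v u).Adj x c := by
            intro c hc
            refine Or.inl ?_
            rw [deleteEdges_adj]
            refine ⟨hc, fun h => ?_⟩
            rw [Set.mem_singleton_iff, Sym2.eq_iff] at h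
            rcases h with ⟨h, -⟩ | ⟨h, -⟩
            · exact hxu h
            · exact hxw h
          exact ⟨a, b, hab, hxc ha, hxc hb⟩
    refine le_trans ?_ (Finset.card_le_card hsub)
    rw [Finset.card_insert_of_notMem fun h => hvI (Finset.mem_of_mem_erase h)]
    have := Finset.pred_card_le_card_erase (s := internalVertices T') (a := w)
    omega
  · rintro a b ha hb (h | h)
    · exact hf a b ha hb (deleteEdges_le _ h)
    · rw [edge_adj] at h
      rcases h.1 with ⟨rfl, -⟩ | ⟨rfl, -⟩ <;> omega

/-- The right `S` consists of all outside vertices joined to `v` in the exchanged tree; so no edge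
from the closed `v` to the outside is left over. -/
theorem Extendable.exists_grow {G : SimpleGraph V} {k : ℕ} {σ : V → ℕ} (h : Extendable G k σ)
    {v : V} (hv : σ v = 1) (hne : (outN G σ v).Nonempty) :
    ∃ S ⊆ outN G σ v, S.Nonempty ∧ Extendable G k (grow σ v S) := by
  obtain ⟨T, T', hT, hle, hs, hk, hf, u, hu0, hvu⟩ := h.exists_adj hv hne
  have hS : outN T' σ v ⊆ outN G σ v := fun x hx =>
    mem_outN.2 ⟨hs.1 (mem_outN.1 hx).1, (mem_outN.1 hx).2⟩
  have hSne : (outN T' σ v).Nonempty := ⟨u, mem_outN.2 ⟨hvu, hu0⟩⟩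
  refine ⟨outN T' σ v, hS, hSne, _, T', hT.grow hv hS hSne, sup_le hle ?_, hs, hk, ?_⟩
  · rintro a b ⟨-, ⟨rfl, hb⟩ | ⟨rfl, hb⟩⟩
    · exact (mem_outN.1 hb).1
    · exact (mem_outN.1 hb).1.symm
  · intro a b ha hb hab
    have hbv : b ≠ v := by rintro rfl; simp [grow] at hb
    have hbS : b ∉ outN T' σ v := fun h1 => by simp [grow, hbv, h1] at hb
    have hb0 : σ b = 0 := by simpa [grow, hbv, hbS] using hb
    by_cases hav : a = v
    · subst hav
      exact hbS (mem_outN.2 ⟨hab, hb0⟩)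
    · refine hf a b ?_ hb0 hab
      by_cases haS : a ∈ outN T' σ v
      · simp [grow, hav, haS] at ha
      · simpa [grow, hav, haS] using ha

/-- The closed vertices. -/
noncomputable def closedSet (σ : V → ℕ) : Finset V := {v | σ v = 2}

/-- The outside vertices. -/
noncomputable def outSet (σ : V → ℕ) : Finset V := {v | σ v = 0}

theorem PartialTree.hasInternalSpanningTree {G T : SimpleGraph V} {σ : V → ℕ} {k : ℕ}
    (h : PartialTree G σ T) (h0 : outSet σ = ∅) (hk : k ≤ (closedSet σ).card) :
    HasInternalSpanningTree G k := by
  have hne : ∀ v, σ v ≠ 0 := fun v hv => by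
    have : v ∈ outSet σ := by simp [outSet, hv]
    simp [h0] at this
  obtain ⟨v, -⟩ := h.nonempty
  have : Nonempty V := ⟨v⟩
  refine ⟨T, ⟨h.le, ⟨⟨fun a b => h.reachable (hne a) (hne b)⟩, h.acyclic⟩⟩, hk.trans ?_⟩
  refine Finset.card_le_card fun v hv => ?_
  rw [mem_internalVertices]
  exact h.internal (by simpa [closedSet] using hv)

/-- With nothing outside, `T` already connects all vertices, so every edge of `T'` is in `T`, and an
internal vertex of `T'` cannot be open. -/
theorem Extendable.le_card_closedSet {G : SimpleGraph V} {σ : V → ℕ} {k : ℕ}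
    (h : Extendable G k σ) (h0 : outSet σ = ∅) : k ≤ (closedSet σ).card := by
  obtain ⟨T, T', hT, hle, hs, hk, -⟩ := h
  have hne : ∀ v, σ v ≠ 0 := fun v hv => by
    have : v ∈ outSet σ := by simp [outSet, hv]
    simp [h0] at this
  refine hk.trans (Finset.card_le_card fun v hv => ?_)
  obtain ⟨a, b, hab, ha, hb⟩ := mem_internalVertices.1 hv
  have key : ∀ c, T'.Adj v c → T.Adj v c := fun c hc =>
    adj_of_le_of_reachable hs.2.isAcyclic hle (hT.reachable (hne _) (hne _)) hc
  have h2 := hT.le_two v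
  have h3 := hne v
  have : σ v ≠ 1 := fun h1 => by
    obtain ⟨x, -, hx⟩ := hT.leaf h1
    exact hab ((hx a (key a ha)).trans (hx b (key b hb)).symm)
  simp only [closedSet, Finset.mem_filter, Finset.mem_univ, true_and]
  omega

end PartialTrees

end MIST

namespace MIST

/-! ### Greedy completion, the measure and the branching recurrences -/

section Measure

open Classical SimpleGraph

variable {V : Type*}

theorem grow_eq_zero {σ : V → ℕ} {v w : V} {S : Finset V} :
    grow σ v S w = 0 ↔ w ≠ v ∧ w ∉ S ∧ σ w = 0 := by
  unfold grow; split_ifs <;> simp_all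

theorem grow_eq_two {σ : V → ℕ} {v w : V} {S : Finset V} (hS : ∀ u ∈ S, σ u = 0) :
    grow σ v S w = 2 ↔ w = v ∨ σ w = 2 := by
  unfold grow; split_ifs with h1 h2
  · simp [h1]
  · simp [h1, hS w h2]
  · simp [h1]

variable [Fintype V] {G : SimpleGraph V}

theorem outN_grow {σ : V → ℕ} {v : V} {S : Finset V} (hv : σ v = 1) (w : V) :
    outN G (grow σ v S) w = outN G σ w \ S := by
  ext u
  rw [Finset.mem_sdiff, mem_outN, mem_outN, grow_eq_zero]
  constructor
  · rintro ⟨h1, h2, h3, h4⟩; exact ⟨⟨h1, h4⟩, h3⟩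
  · rintro ⟨⟨h1, h4⟩, h3⟩; exact ⟨h1, by rintro rfl; omega, h3, h4⟩

theorem mem_closedSet {σ : V → ℕ} {v : V} : v ∈ closedSet σ ↔ σ v = 2 := by simp [closedSet]

theorem mem_outSet {σ : V → ℕ} {v : V} : v ∈ outSet σ ↔ σ v = 0 := by simp [outSet]

theorem card_closedSet_grow {σ : V → ℕ} {v : V} {S : Finset V} (hv : σ v = 1)
    (hS : ∀ u ∈ S, σ u = 0) : (closedSet (grow σ v S)).card = (closedSet σ).card + 1 := by
  rw [← Finset.card_insert_of_notMem (s := closedSet σ) (a := v) (by rw [mem_closedSet]; omega)]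
  congr 1
  ext w
  rw [mem_closedSet, grow_eq_two hS, Finset.mem_insert, mem_closedSet]

theorem card_outSet_grow {σ : V → ℕ} {v : V} {S : Finset V} (hv : σ v = 1)
    (hS : ∀ u ∈ S, σ u = 0) : (outSet (grow σ v S)).card + S.card = (outSet σ).card := by
  have h : outSet (grow σ v S) = outSet σ \ S := by
    ext w
    rw [mem_outSet, grow_eq_zero, Finset.mem_sdiff, mem_outSet]
    constructor
    · rintro ⟨-, h1, h2⟩; exact ⟨h2, h1⟩
    · rintro ⟨h2, h1⟩; exact ⟨by rintro rfl; omega, h1, h2⟩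
  rw [h]
  exact Finset.card_sdiff_add_card_eq_card fun u hu => mem_outSet.2 (hS u hu)

/-- One of the at most three edges at `v` is used by its neighbour in the partial tree. -/
theorem PartialTree.card_outN_le {σ : V → ℕ} {T : SimpleGraph V} (h : PartialTree G σ T)
    (hG : IsSubcubic G) {v : V} (hv : σ v = 1) : (outN G σ v).card ≤ 2 := by
  obtain ⟨y, hy, -⟩ := h.leaf hv
  have hn : y ∉ outN G σ v := fun hh => h.support hy.symm (mem_outN.1 hh).2
  have hsub : insert y (outN G σ v) ⊆ G.neighborFinset v := by
    intro u hu
    rw [mem_neighborFinset]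
    rcases Finset.mem_insert.1 hu with rfl | hu
    · exact h.le hy
    · exact (mem_outN.1 hu).1
  have h1 := Finset.card_le_card hsub
  rw [Finset.card_insert_of_notMem hn, card_neighborFinset_eq_degree] at h1
  have := hG v
  omega

/-- One step of the greedy completion: some open vertex is closed and all its outside neighbours
are attached to it; if no open vertex has outside neighbours, nothing happens. -/
def GreedyStep (G : SimpleGraph V) (σ τ : V → ℕ) : Prop :=
  (∃ v, σ v = 1 ∧ (outN G σ v).Nonempty ∧ τ = grow σ v (outN G σ v)) ∨
    ((∀ v, σ v = 1 → outN G σ v = ∅) ∧ τ = σ)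

/-- Several greedy steps in succession. -/
inductive GreedyRun (G : SimpleGraph V) : ℕ → (V → ℕ) → (V → ℕ) → Prop
  | zero (σ : V → ℕ) : GreedyRun G 0 σ σ
  | succ {m : ℕ} {σ τ τ' : V → ℕ} : GreedyRun G m σ τ → GreedyStep G τ τ' →
      GreedyRun G (m + 1) σ τ'

theorem outN_eq_zero {σ : V → ℕ} {v : V} : ∀ u ∈ outN G σ v, σ u = 0 :=
  fun _ hu => (mem_outN.1 hu).2

theorem GreedyRun.exists_partialTree {m : ℕ} {σ τ : V → ℕ} (hr : GreedyRun G m σ τ)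
    (h : ∃ T, PartialTree G σ T) : ∃ T, PartialTree G τ T := by
  induction hr with
  | zero => exact h
  | succ _ hs ih =>
    obtain ⟨T, hT⟩ := ih h
    rcases hs with ⟨v, hv, hne, rfl⟩ | ⟨-, rfl⟩
    · exact ⟨_, hT.grow hv subset_rfl hne⟩
    · exact ⟨T, hT⟩

/-- An expansion closes one vertex and brings at most two inside. -/
theorem GreedyRun.card_le {m : ℕ} {σ τ : V → ℕ} (hr : GreedyRun G m σ τ) (hG : IsSubcubic G)
    (h : ∃ T, PartialTree G σ T) :
    (outSet σ).card + 2 * (closedSet σ).card ≤ (outSet τ).card + 2 * (closedSet τ).card := by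
  induction hr with
  | zero => exact le_rfl
  | succ hr hs ih =>
    refine (ih h).trans ?_
    rcases hs with ⟨v, hv, hne, rfl⟩ | ⟨-, rfl⟩
    · obtain ⟨T, hT⟩ := hr.exists_partialTree h
      have h1 := card_closedSet_grow hv (outN_eq_zero (G := G) (v := v))
      have h2 := card_outSet_grow hv (outN_eq_zero (G := G) (v := v))
      have h3 := hT.card_outN_le hG hv
      omega
    · exact le_rfl

/-- Only open vertices attach anything, so a vertex surrounded by closed ones is never reached. -/
theorem GreedyRun.isolated {m : ℕ} {σ τ : V → ℕ} (hr : GreedyRun G m σ τ) {u : V} (hu : σ u = 0)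
    (h : ∀ w, G.Adj u w → σ w = 2) : τ u = 0 ∧ ∀ w, G.Adj u w → τ w = 2 := by
  induction hr with
  | zero => exact ⟨hu, h⟩
  | succ _ hs ih =>
    obtain ⟨h1, h2⟩ := ih hu h
    rcases hs with ⟨v, hv, -, rfl⟩ | ⟨-, rfl⟩
    · refine ⟨grow_eq_zero.2 ⟨by rintro rfl; omega, fun hm => ?_, h1⟩, fun w hw =>
        (grow_eq_two outN_eq_zero).2 (Or.inr (h2 w hw))⟩
      have := h2 v (mem_outN.1 hm).1.symm
      omega
    · exact ⟨h1, h2⟩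

/-- Every step that is not idle closes a vertex, and a stuck partial tree stays stuck. -/
theorem GreedyRun.stuck_or_le {m : ℕ} {σ τ : V → ℕ} (hr : GreedyRun G m σ τ) :
    (∀ v, τ v = 1 → outN G τ v = ∅) ∨ m ≤ (closedSet τ).card := by
  induction hr with
  | zero => exact Or.inr (Nat.zero_le _)
  | succ _ hs ih =>
    rcases hs with ⟨v, hv, hne, rfl⟩ | ⟨h, rfl⟩
    · right
      rw [card_closedSet_grow hv outN_eq_zero]
      rcases ih with h | h
      · rw [h v hv] at hne; exact absurd hne (by simp)
      · omega
    · exact Or.inl h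

/-- A greedy step leaves no outside neighbour of the vertex that it closes. -/
theorem GreedyRun.not_adj {m : ℕ} {σ τ : V → ℕ} (hr : GreedyRun G m σ τ) {T : SimpleGraph V}
    (hT : T ≤ G) (hf : ∀ a b, σ a = 2 → σ b = 0 → ¬ T.Adj a b) :
    ∀ a b, τ a = 2 → τ b = 0 → ¬ T.Adj a b := by
  induction hr with
  | zero => exact hf
  | succ _ hst ih =>
    rcases hst with ⟨v, hv, hne, rfl⟩ | ⟨-, rfl⟩
    · intro a b ha hb hab
      rw [grow_eq_two outN_eq_zero] at ha
      obtain ⟨-, hb2, hb3⟩ := grow_eq_zero.1 hb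
      rcases ha with rfl | ha
      · exact hb2 (mem_outN.2 ⟨hT hab, hb3⟩)
      · exact ih hf a b ha hb3 hab
    · exact ih hf

/-- The soundness of pruning: its contrapositive discards a partial tree whose greedy completion
does not span, whatever order the greedy choices took. -/
theorem GreedyRun.outSet_eq_empty {σ τ : V → ℕ} {k : ℕ} (hr : GreedyRun G (Fintype.card V) σ τ)
    (h : Extendable G k σ) : outSet τ = ∅ := by
  obtain ⟨T, T', hT, -, hs, -, hf⟩ := h
  obtain ⟨T₁, hT₁⟩ := hr.exists_partialTree ⟨T, hT⟩
  have hf' := hr.not_adj hs.1 hf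
  rcases hr.stuck_or_le with hst | hst
  · by_contra hne
    obtain ⟨b, hb⟩ := Finset.nonempty_iff_ne_empty.2 hne
    rw [mem_outSet] at hb
    obtain ⟨a, ha⟩ := hT₁.nonempty
    -- A path of `T'` leaving the partial tree has a crossing edge. It starts at an open vertex,
    -- contrary to being stuck, or at a closed one, contrary to `hf'`.
    obtain ⟨p⟩ := hs.2.connected.preconnected a b
    obtain ⟨d, -, hd1, hd2⟩ := p.exists_boundary_dart {x | τ x ≠ 0} ha (by simpa using hb)
    have hd2' : τ d.snd = 0 := by simpa using hd2
    have hd1' : τ d.fst ≠ 0 := hd1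
    have h2 := hT₁.le_two d.fst
    rcases (by omega : τ d.fst = 1 ∨ τ d.fst = 2) with h1 | h1
    · have := hst _ h1
      have hm : d.snd ∈ outN G τ d.fst := mem_outN.2 ⟨hs.1 d.adj, hd2'⟩
      simp [this] at hm
    · exact hf' _ _ h1 hd2' d.adj
  · have h1 : closedSet τ = Finset.univ :=
      Finset.eq_univ_of_card _ (le_antisymm (Finset.card_le_univ _) hst)
    ext u
    have : u ∈ closedSet τ := by simp [h1]
    rw [mem_closedSet] at this
    simp [mem_outSet, this]

/-- The neighbours of `u` that are not closed. -/
noncomputable def act (G : SimpleGraph V) (σ : V → ℕ) (u : V) : Finset V :=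
  {w | G.Adj u w ∧ σ w ≠ 2}

theorem mem_act {σ : V → ℕ} {u w : V} : w ∈ act G σ u ↔ G.Adj u w ∧ σ w ≠ 2 := by simp [act]

theorem card_act_le (hG : IsSubcubic G) (σ : V → ℕ) (u : V) : (act G σ u).card ≤ 3 := by
  refine le_trans (Finset.card_le_card ?_) ((card_neighborFinset_eq_degree G u).le.trans (hG u))
  intro w hw
  rw [mem_neighborFinset]
  exact (mem_act.1 hw).1

/-- The outside vertices with at most two neighbours that are not closed. -/
noncomputable def lowSet (G : SimpleGraph V) (σ : V → ℕ) : Finset V :=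
  {u | σ u = 0 ∧ (act G σ u).card ≤ 2}

theorem mem_lowSet {σ : V → ℕ} {u : V} : u ∈ lowSet G σ ↔ σ u = 0 ∧ (act G σ u).card ≤ 2 := by
  simp [lowSet]

/-- Some open vertex has exactly one outside neighbour. -/
def HasFree (G : SimpleGraph V) (σ : V → ℕ) : Prop :=
  ∃ v, σ v = 1 ∧ (outN G σ v).card = 1

/-- The measure of a partial tree. -/
noncomputable def measure (G : SimpleGraph V) (k : ℕ) (σ : V → ℕ) : ℤ :=
  6 * ((k : ℤ) - (closedSet σ).card) - (lowSet G σ).card - if HasFree G σ then 5 else 0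

/-- The greedy completion spans the graph, but has too few internal vertices. -/
def Live (G : SimpleGraph V) (k : ℕ) (σ : V → ℕ) : Prop :=
  ∃ τ, GreedyRun G (Fintype.card V) σ τ ∧ outSet τ = ∅ ∧ (closedSet τ).card < k

/-- By `GreedyRun.card_le`, with `d` closed vertices missing there are at most `2 * d - 2` outside
vertices, and `d ≥ 1`; so the measure is at least `6 * d - (2 * d - 2) - 5 > 0`. -/
theorem Live.measure_nonneg {k : ℕ} {σ : V → ℕ} (h : Live G k σ) (hG : IsSubcubic G)
    (hT : ∃ T, PartialTree G σ T) : 0 ≤ measure G k σ := by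
  obtain ⟨τ, hr, h0, hk⟩ := h
  have h1 := hr.card_le hG hT
  rw [h0, Finset.card_empty] at h1
  have h2 : (lowSet G σ).card ≤ (outSet σ).card := Finset.card_le_card fun u hu =>
    mem_outSet.2 (mem_lowSet.1 hu).1
  unfold measure
  split_ifs <;> omega

theorem Live.act_nonempty {k : ℕ} {σ : V → ℕ} (h : Live G k σ) {u : V} (hu : σ u = 0) :
    (act G σ u).Nonempty := by
  by_contra hne
  rw [Finset.not_nonempty_iff_eq_empty] at hne
  obtain ⟨τ, hr, h0, -⟩ := h
  have h1 := (hr.isolated hu fun w hw => by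
    by_contra h2
    have : w ∈ act G σ u := mem_act.2 ⟨hw, h2⟩
    simp [hne] at this).1
  rw [← mem_outSet, h0] at h1
  simp at h1

theorem act_grow {σ : V → ℕ} {v : V} {S : Finset V} (hS : ∀ u ∈ S, σ u = 0) (u : V) :
    act G (grow σ v S) u = (act G σ u).erase v := by
  ext w
  rw [mem_act, Finset.mem_erase, mem_act, Ne, grow_eq_two hS]
  tauto

theorem lowSet_sdiff_subset {σ : V → ℕ} {v : V} {S : Finset V} (hv : σ v = 1)
    (hS : ∀ u ∈ S, σ u = 0) : lowSet G σ \ S ⊆ lowSet G (grow σ v S) := by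
  intro u hu
  obtain ⟨h1, h2⟩ := Finset.mem_sdiff.1 hu
  obtain ⟨h3, h4⟩ := mem_lowSet.1 h1
  refine mem_lowSet.2 ⟨grow_eq_zero.2 ⟨by rintro rfl; omega, h2, h3⟩, ?_⟩
  rw [act_grow hS]
  exact (Finset.card_erase_le).trans h4

/-- A neighbour left out at the expansion of `v` loses `v` from its at most three neighbours that
are not closed. -/
theorem mem_lowSet_grow (hG : IsSubcubic G) {σ : V → ℕ} {v u : V} {S : Finset V} (hv : σ v = 1)
    (hS : ∀ u ∈ S, σ u = 0) (hu : u ∈ outN G σ v) (huS : u ∉ S) : u ∈ lowSet G (grow σ v S) := by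
  obtain ⟨h1, h2⟩ := mem_outN.1 hu
  refine mem_lowSet.2 ⟨grow_eq_zero.2 ⟨by rintro rfl; omega, huS, h2⟩, ?_⟩
  rw [act_grow hS, Finset.card_erase_of_mem (mem_act.2 ⟨h1.symm, by omega⟩)]
  have := card_act_le hG σ u
  omega

/-- The ratio that governs the number of partial trees visited by the search. -/
noncomputable def ratio : ℝ := 10000 / 8458

theorem one_lt_ratio : 1 < ratio := by unfold ratio; norm_num

theorem ratio_pow_six_le : ratio ^ 6 ≤ 2.7321 := by unfold ratio; norm_num

/-- A bound for the number of partial trees visited below `σ`. -/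
noncomputable def potential (G : SimpleGraph V) (k : ℕ) (σ : V → ℕ) : ℝ :=
  if Live G k σ then 4 * (Fintype.card V + 1 - (closedSet σ).card) * ratio ^ measure G k σ else 1

/-- The weight of a partial tree. -/
noncomputable def weight (G : SimpleGraph V) (k : ℕ) (σ : V → ℕ) : ℝ :=
  if Live G k σ then ratio ^ measure G k σ else 0

theorem card_closedSet_le (σ : V → ℕ) : ((closedSet σ).card : ℝ) ≤ Fintype.card V := by
  exact_mod_cast Finset.card_le_univ _

theorem potential_le (k : ℕ) (σ : V → ℕ) : potential G k σ ≤
    1 + 4 * (Fintype.card V + 1 - (closedSet σ).card) * weight G k σ := by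
  unfold potential weight
  split_ifs
  · linarith
  · simp

theorem one_le_potential {k : ℕ} {σ : V → ℕ} (hG : IsSubcubic G) (hT : ∃ T, PartialTree G σ T) :
    1 ≤ potential G k σ := by
  unfold potential
  split_ifs with h
  · have h1 : 1 ≤ ratio ^ measure G k σ := one_le_zpow₀ one_lt_ratio.le (h.measure_nonneg hG hT)
    have h2 := card_closedSet_le σ
    nlinarith
  · exact le_rfl

/-- Turns a drop of the measure by `d` into a factor; partial trees that are not live have weight
`0` and satisfy it trivially. -/
theorem weight_le {k : ℕ} {σ τ : V → ℕ} (d : ℕ) (h : measure G k τ + d ≤ measure G k σ) :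
    weight G k τ ≤ ratio ^ measure G k σ * (ratio⁻¹) ^ d := by
  have hr : 0 < ratio := by linarith [one_lt_ratio]
  have h1 : ratio ^ measure G k τ ≤ ratio ^ measure G k σ * (ratio⁻¹) ^ d := by
    rw [inv_pow, ← zpow_natCast, ← zpow_neg, ← zpow_add₀ hr.ne']
    exact zpow_le_zpow_right₀ one_lt_ratio.le (by linarith)
  unfold weight
  split_ifs
  · exact h1
  · exact (zpow_pos hr _).le.trans h1

theorem weight_eq_zero {k : ℕ} {τ : V → ℕ} (h : ¬ Live G k τ) : weight G k τ = 0 := if_neg h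

/-- The gain of 6 for closing `v` covers the 5 lost if no free vertex remains and the 1 lost if `u`
was low. -/
theorem measure_grow_free {k : ℕ} {σ : V → ℕ} {v u : V} (hv : σ v = 1)
    (hu : outN G σ v = {u}) : measure G k (grow σ v {u}) ≤ measure G k σ := by
  have hS : ∀ x ∈ ({u} : Finset V), σ x = 0 := hu ▸ outN_eq_zero
  have h1 := card_closedSet_grow hv hS
  have h2 := Finset.card_le_card (lowSet_sdiff_subset (G := G) hv hS)
  have h3 := Finset.pred_card_le_card_erase (s := lowSet G σ) (a := u)
  rw [Finset.sdiff_singleton_eq_erase] at h2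
  have hF : HasFree G σ := ⟨v, hv, by rw [hu]; simp⟩
  unfold measure
  rw [if_pos hF]
  split_ifs <;> omega

/-- The exponential part need not drop here; the linear factor drops by 1 instead, and a live
partial tree has `ratio ^ measure ≥ 1`. -/
theorem potential_grow_free {k : ℕ} {σ : V → ℕ} (hG : IsSubcubic G)
    (hT : ∃ T, PartialTree G σ T) (hL : Live G k σ) {v u : V} (hv : σ v = 1)
    (hu : outN G σ v = {u}) : potential G k (grow σ v {u}) + 1 ≤ potential G k σ := by
  have hS : ∀ x ∈ ({u} : Finset V), σ x = 0 := hu ▸ outN_eq_zero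
  have h1 := potential_le (G := G) k (grow σ v {u})
  have h2 := weight_le (G := G) (k := k) 0 (by simpa using measure_grow_free hv hu)
  have h3 : 1 ≤ ratio ^ measure G k σ := one_le_zpow₀ one_lt_ratio.le (hL.measure_nonneg hG hT)
  have h4 := card_closedSet_le (grow σ v {u})
  have h5 : ((closedSet (grow σ v {u})).card : ℝ) = (closedSet σ).card + 1 := by
    exact_mod_cast card_closedSet_grow hv hS
  rw [h5] at h1 h4
  unfold potential at h1 ⊢
  rw [if_pos hL]
  rw [pow_zero, mul_one] at h2
  have h6 := mul_le_mul_of_nonneg_left h2 (by linarith :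
    (0 : ℝ) ≤ 4 * (Fintype.card V + 1 - ((closedSet σ).card + 1)))
  linarith

section Branch

variable {k : ℕ} {σ : V → ℕ} {v u₁ u₂ : V}

/-- Closing gains 6, each low vertex attached costs 1; a free vertex that may appear only helps and
is ignored. -/
theorem measure_grow_pair (hv : σ v = 1) (hu : outN G σ v = {u₁, u₂}) (hF : ¬ HasFree G σ) :
    measure G k (grow σ v {u₁, u₂}) + 6 ≤ measure G k σ +
      (if (act G σ u₁).card ≤ 2 then 1 else 0) + (if (act G σ u₂).card ≤ 2 then 1 else 0) := by
  have hS : ∀ x ∈ ({u₁, u₂} : Finset V), σ x = 0 := hu ▸ outN_eq_zero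
  have h1 := card_closedSet_grow hv hS
  have h2 := Finset.card_le_card (lowSet_sdiff_subset (G := G) hv hS)
  have h3 : (lowSet G σ).card ≤ (lowSet G σ \ {u₁, u₂}).card +
      (if (act G σ u₁).card ≤ 2 then 1 else 0) + (if (act G σ u₂).card ≤ 2 then 1 else 0) := by
    have h4 : lowSet G σ \ {u₁, u₂} = ((lowSet G σ).erase u₁).erase u₂ := by
      ext x; simp; tauto
    rw [h4]
    have e : ∀ (A : Finset V) (u : V), A ⊆ lowSet G σ →
        A.card ≤ (A.erase u).card + (if (act G σ u).card ≤ 2 then 1 else 0) := by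
      intro A u hA
      split_ifs with h
      · have := Finset.pred_card_le_card_erase (s := A) (a := u); omega
      · rw [Finset.erase_eq_of_notMem fun hu => h (mem_lowSet.1 (hA hu)).2, add_zero]
    have e1 := e _ u₁ subset_rfl
    have e2 := e _ u₂ (Finset.erase_subset u₁ (lowSet G σ))
    omega
  unfold measure
  rw [if_neg hF]
  split_ifs at h3 ⊢ <;> omega

/-- Besides `v`, exactly one neighbour `z` of `u₁` is not closed. If `z` is outside, `u₁` becomes
free. If `z` is open, it had two outside neighbours, as it was not free, and loses `u₁`, so `z`
becomes free. -/
theorem hasFree_grow_left {T : SimpleGraph V} (hT : PartialTree G σ T) (hG : IsSubcubic G)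
    (hv : σ v = 1) (hu : outN G σ v = {u₁, u₂}) (hF : ¬ HasFree G σ)
    (hd : (act G σ u₁).card = 2) : HasFree G (grow σ v {u₁}) := by
  have hm : u₁ ∈ outN G σ v := by rw [hu]; simp
  obtain ⟨hvu, hu0⟩ := mem_outN.1 hm
  have hva : v ∈ act G σ u₁ := mem_act.2 ⟨hvu.symm, by omega⟩
  have hc : ((act G σ u₁).erase v).card = 1 := by rw [Finset.card_erase_of_mem hva, hd]
  obtain ⟨z, hz⟩ := Finset.card_eq_one.1 hc
  have hz' : z ∈ (act G σ u₁).erase v := by rw [hz]; simp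
  obtain ⟨hzv, hza⟩ := Finset.mem_erase.1 hz'
  obtain ⟨huz, hz2⟩ := mem_act.1 hza
  have h2 := hT.le_two z
  have hu₁v : u₁ ≠ v := hvu.ne.symm
  rcases (by omega : σ z = 0 ∨ σ z = 1) with h0 | h0
  · refine ⟨u₁, by simp [grow, hu₁v], ?_⟩
    rw [Finset.card_eq_one]
    refine ⟨z, ?_⟩
    ext w
    rw [mem_outN, grow_eq_zero, Finset.mem_singleton, Finset.mem_singleton]
    constructor
    · rintro ⟨h3, h4, -, h6⟩
      have : w ∈ (act G σ u₁).erase v := Finset.mem_erase.2 ⟨h4, mem_act.2 ⟨h3, by omega⟩⟩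
      simpa [hz] using this
    · rintro rfl
      exact ⟨huz, hzv, huz.ne.symm, h0⟩
  · refine ⟨z, by simp [grow, hzv, huz.ne.symm, h0], ?_⟩
    have h3 : u₁ ∈ outN G σ z := mem_outN.2 ⟨huz.symm, hu0⟩
    rw [outN_grow hv, Finset.sdiff_singleton_eq_erase, Finset.card_erase_of_mem h3]
    have h4 := hT.card_outN_le hG h0
    have h5 : (outN G σ z).card ≠ 1 := fun h5 => hF ⟨z, h0, h5⟩
    have h6 := Finset.card_pos.2 ⟨_, h3⟩
    omega

/-- Attaching only `u₁` gains the 6 for closing, 5 if a free vertex arises by `hasFree_grow_left`,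
and 1 if the omitted `u₂` becomes low without having been so; it costs 1 if `u₁` was low. -/
theorem measure_grow_left {T : SimpleGraph V} (hT : PartialTree G σ T) (hG : IsSubcubic G)
    (hv : σ v = 1) (hu : outN G σ v = {u₁, u₂}) (hne : u₁ ≠ u₂) (hF : ¬ HasFree G σ) :
    measure G k (grow σ v {u₁}) + 6 + (if (act G σ u₁).card = 2 then 5 else 0) +
      (if (act G σ u₂).card = 3 then 1 else 0) ≤ measure G k σ +
      (if (act G σ u₁).card ≤ 2 then 1 else 0) := by
  have hS : ∀ x ∈ ({u₁} : Finset V), σ x = 0 := by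
    intro x hx
    refine outN_eq_zero (G := G) (v := v) x ?_
    rw [hu]
    simp only [Finset.mem_singleton] at hx
    simp [hx]
  have h1 := card_closedSet_grow hv hS
  have h2 := lowSet_sdiff_subset (G := G) hv hS
  rw [Finset.sdiff_singleton_eq_erase] at h2
  have h3 : u₂ ∈ lowSet G (grow σ v {u₁}) :=
    mem_lowSet_grow hG hv hS (by rw [hu]; simp) (by simpa using hne.symm)
  have h4 : (lowSet G σ).card ≤ ((lowSet G σ).erase u₁).card +
      (if (act G σ u₁).card ≤ 2 then 1 else 0) := by
    split_ifs with h
    · have := Finset.pred_card_le_card_erase (s := lowSet G σ) (a := u₁); omega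
    · rw [Finset.erase_eq_of_notMem fun hu => h (mem_lowSet.1 hu).2, add_zero]
  have h5 : ((lowSet G σ).erase u₁).card + (if (act G σ u₂).card = 3 then 1 else 0) ≤
      (lowSet G (grow σ v {u₁})).card := by
    split_ifs with h
    · rw [← Finset.card_insert_of_notMem (a := u₂)]
      · exact Finset.card_le_card (Finset.insert_subset h3 h2)
      · intro hm
        have := (mem_lowSet.1 (Finset.mem_of_mem_erase hm)).2
        omega
    · exact Finset.card_le_card h2
  have h6 := hasFree_grow_left hT hG hv hu hF
  unfold measure
  rw [if_neg hF]
  by_cases hd : (act G σ u₁).card = 2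
  · rw [if_pos (h6 hd), if_pos hd]
    split_ifs at h4 h5 ⊢ <;> omega
  · rw [if_neg hd]
    split_ifs at h4 h5 ⊢ <;> omega

/-- If `v` is the only neighbour of `u₂` that is not closed, omitting `u₂` cuts it off for good. -/
theorem not_live_grow_left (hv : σ v = 1) (hu : outN G σ v = {u₁, u₂}) (hne : u₁ ≠ u₂)
    (hd : (act G σ u₂).card = 1) : ¬ Live G k (grow σ v {u₁}) := by
  intro hL
  have hS : ∀ x ∈ ({u₁} : Finset V), σ x = 0 := by
    intro x hx
    refine outN_eq_zero (G := G) (v := v) x ?_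
    rw [hu]
    simp only [Finset.mem_singleton] at hx
    simp [hx]
  have hm : u₂ ∈ outN G σ v := by rw [hu]; simp
  obtain ⟨hvu, hu0⟩ := mem_outN.1 hm
  have := hL.act_nonempty (u := u₂)
    (grow_eq_zero.2 ⟨hvu.ne.symm, by simpa using hne.symm, hu0⟩)
  rw [act_grow hS, ← Finset.card_pos,
    Finset.card_erase_of_mem (mem_act.2 ⟨hvu.symm, by omega⟩), hd] at this
  omega

theorem weight_branch {T : SimpleGraph V} (hT : PartialTree G σ T) (hG : IsSubcubic G)
    (hv : σ v = 1) (hu : outN G σ v = {u₁, u₂}) (hne : u₁ ≠ u₂) (hF : ¬ HasFree G σ) :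
    weight G k (grow σ v {u₁, u₂}) + weight G k (grow σ v {u₁}) + weight G k (grow σ v {u₂}) ≤
      ratio ^ measure G k σ := by
  have hu' : outN G σ v = {u₂, u₁} := by rw [hu, Finset.pair_comm]
  have hC := measure_grow_pair (k := k) hv hu hF
  have hA := measure_grow_left (k := k) hT hG hv hu hne hF
  have hB := measure_grow_left (k := k) hT hG hv hu' hne.symm hF
  have hA' := fun hd => weight_eq_zero (not_live_grow_left (k := k) hv hu hne hd)
  have hB' := fun hd => weight_eq_zero (not_live_grow_left (k := k) hv hu' hne.symm hd)
  have hpos : 0 < ratio ^ measure G k σ := zpow_pos (by linarith [one_lt_ratio]) _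
  have hd : ∀ u ∈ outN G σ v, 1 ≤ (act G σ u).card ∧ (act G σ u).card ≤ 3 := by
    intro u hu
    obtain ⟨hvu, hu0⟩ := mem_outN.1 hu
    exact ⟨Finset.card_pos.2 ⟨v, mem_act.2 ⟨hvu.symm, by omega⟩⟩, card_act_le hG σ u⟩
  obtain ⟨hd1, hd1'⟩ := hd u₁ (by rw [hu]; simp)
  obtain ⟨hd2, hd2'⟩ := hd u₂ (by rw [hu]; simp)
  have fin : ∀ {x y z a b c : ℝ}, x ≤ ratio ^ measure G k σ * a → y ≤ ratio ^ measure G k σ * b →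
      z ≤ ratio ^ measure G k σ * c → a + b + c ≤ 1 → x + y + z ≤ ratio ^ measure G k σ := by
    intro x y z a b c h1 h2 h3 h4
    nlinarith
  have zero : ∀ {x : ℝ}, x = 0 → x ≤ ratio ^ measure G k σ * 0 := fun h => by simp [h]
  have hr : ratio⁻¹ = 0.8458 := by unfold ratio; norm_num
  -- Nine cases, by the numbers of neighbours of `u₁` and `u₂` that are not closed. The arguments of
  -- `fin` concern the descendants by `{u₁, u₂}`, `{u₁}` and `{u₂}` in this order; `zero` marks one
  -- that is not live. The tightest inequality is the last, with drops 6, 7, 7.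
  interval_cases h1 : (act G σ u₁).card <;> interval_cases h2 : (act G σ u₂).card <;>
    norm_num at hA hB hC hA' hB'
  · exact fin (weight_le 4 (by push_cast; linarith)) (zero hA') (zero hB') (by rw [hr]; norm_num)
  · exact fin (weight_le 4 (by push_cast; linarith)) (weight_le 5 (by push_cast; linarith))
      (zero hB') (by rw [hr]; norm_num)
  · exact fin (weight_le 5 (by push_cast; linarith)) (weight_le 6 (by push_cast; linarith))
      (zero hB') (by rw [hr]; norm_num)
  · exact fin (weight_le 4 (by push_cast; linarith)) (zero hA')
      (weight_le 5 (by push_cast; linarith)) (by rw [hr]; norm_num)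
  · exact fin (weight_le 4 (by push_cast; linarith)) (weight_le 10 (by push_cast; linarith))
      (weight_le 10 (by push_cast; linarith)) (by rw [hr]; norm_num)
  · exact fin (weight_le 5 (by push_cast; linarith)) (weight_le 11 (by push_cast; linarith))
      (weight_le 6 (by push_cast; linarith)) (by rw [hr]; norm_num)
  · exact fin (weight_le 5 (by push_cast; linarith)) (zero hA')
      (weight_le 6 (by push_cast; linarith)) (by rw [hr]; norm_num)
  · exact fin (weight_le 5 (by push_cast; linarith)) (weight_le 6 (by push_cast; linarith))
      (weight_le 11 (by push_cast; linarith)) (by rw [hr]; norm_num)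
  · exact fin (weight_le 6 (by push_cast; linarith)) (weight_le 7 (by push_cast; linarith))
      (weight_le 7 (by push_cast; linarith)) (by rw [hr]; norm_num)

/-- The three descendants contribute at most 1 each besides their weights, and the visit itself 1.
This is the 4 in the potential, freed when the linear factor drops by 1. -/
theorem potential_branch {T : SimpleGraph V} (hT : PartialTree G σ T) (hG : IsSubcubic G)
    (hL : Live G k σ) (hv : σ v = 1) (hu : outN G σ v = {u₁, u₂}) (hne : u₁ ≠ u₂)
    (hF : ¬ HasFree G σ) :
    potential G k (grow σ v {u₁, u₂}) + potential G k (grow σ v {u₁}) +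
      potential G k (grow σ v {u₂}) + 1 ≤ potential G k σ := by
  have hS : ∀ S ⊆ outN G σ v, potential G k (grow σ v S) ≤
      1 + 4 * (Fintype.card V - (closedSet σ).card) * weight G k (grow σ v S) := by
    intro S hS
    have h5 : ((closedSet (grow σ v S)).card : ℝ) = (closedSet σ).card + 1 := by
      exact_mod_cast card_closedSet_grow hv fun x hx => outN_eq_zero x (hS hx)
    refine (potential_le k _).trans (le_of_eq ?_)
    rw [h5]; ring
  have h1 := hS {u₁, u₂} (by rw [hu])
  have h2 := hS {u₁} (by rw [hu]; simp)
  have h3 := hS {u₂} (by rw [hu]; simp)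
  have h4 := weight_branch (k := k) hT hG hv hu hne hF
  have h5 : 1 ≤ ratio ^ measure G k σ :=
    one_le_zpow₀ one_lt_ratio.le (hL.measure_nonneg hG ⟨T, hT⟩)
  have h6 := card_closedSet_le σ
  have h7 := mul_le_mul_of_nonneg_left h4 (by linarith :
    (0 : ℝ) ≤ 4 * (Fintype.card V - (closedSet σ).card))
  conv_rhs => rw [potential, if_pos hL]
  linarith

end Branch

theorem potential_le_pow {k : ℕ} (σ : V → ℕ) :
    potential G k σ ≤ 4 * (Fintype.card V + 1) * 2.7321 ^ k := by
  have h27 : (1 : ℝ) ≤ 2.7321 ^ k := one_le_pow₀ (by norm_num)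
  unfold potential
  split_ifs
  · have h1 : ratio ^ measure G k σ ≤ 2.7321 ^ k := by
      refine (zpow_le_zpow_right₀ one_lt_ratio.le (n := ((6 * k : ℕ) : ℤ)) ?_).trans ?_
      · unfold measure; split_ifs <;> push_cast <;> omega
      · rw [zpow_natCast, pow_mul]
        exact pow_le_pow_left₀ (pow_nonneg (by linarith [one_lt_ratio]) _) ratio_pow_six_le _
    have h0 : 0 < ratio ^ measure G k σ := zpow_pos (by linarith [one_lt_ratio]) _
    have h2 : (0 : ℝ) ≤ (closedSet σ).card := Nat.cast_nonneg _
    have h3 : (0 : ℝ) ≤ Fintype.card V := Nat.cast_nonneg _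
    nlinarith [mul_nonneg h2 h0.le, mul_nonneg h3 (sub_nonneg.2 h1)]
  · have h3 : (0 : ℝ) ≤ Fintype.card V := Nat.cast_nonneg _
    nlinarith

end Measure

end MIST

namespace MIST

/-! ### A language of bounded loops and its compilation -/

section Commands

/-- Commands with bounded loops. Register `0` holds the number of vertices, register `2` holds `1`,
and register `3` is used by `add`; the second summand of an addition is cut off at the number of
vertices. The loop `forn i p` runs `p` with register `i` equal to `n - 1, …, 0`. -/
inductive Cmd where
  | skip
  | set (x c : ℕ)
  | copy (x y : ℕ)
  | add (x y z : ℕ)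
  | sub (x y z : ℕ)
  | load (x y : ℕ)
  | store (x y : ℕ)
  | seq (p q : Cmd)
  | ite (x : ℕ) (p q : Cmd)
  | forn (i : ℕ) (p : Cmd)

namespace Cmd

/-- The effect of a loop whose counter is `i` and whose body has the effect `f`. -/
def iter (i : ℕ) (f : State → State) : ℕ → State → State
  | 0, s => { s with reg := Function.update s.reg i 0 }
  | m + 1, s => iter i f m (f { s with reg := Function.update s.reg i m })

/-- The effect of a command. -/
def den : Cmd → State → State
  | skip, s => s
  | set x c, s => { s with reg := Function.update s.reg x c }
  | copy x y, s => { s with reg := Function.update s.reg x (s.reg y) }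
  | add x y z, s =>
    let m := min (s.reg z) (s.reg 0)
    { s with reg := Function.update (Function.update s.reg 3 m) x (s.reg y + m) }
  | sub x y z, s => { s with reg := Function.update s.reg x (s.reg y - s.reg z) }
  | load x y, s => { s with reg := Function.update s.reg x (s.mem (s.reg y)) }
  | store x y, s => { s with mem := Function.update s.mem (s.reg x) (s.reg y) }
  | seq p q, s => q.den (p.den s)
  | ite x p q, s => if s.reg x = 0 then q.den s else p.den s
  | forn i p, s => iter i p.den (s.reg 0) s

/-- The program of a command. -/
def compile : Cmd → Prog
  | skip => .skip
  | set x c => .instr (.const x c)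
  | copy x y => .instr (.copy x y)
  | add x y z => .seq (.instr (.sub 3 z 0)) (.seq (.instr (.sub 3 z 3)) (.instr (.add x y 3)))
  | sub x y z => .instr (.sub x y z)
  | load x y => .instr (.load x y)
  | store x y => .instr (.store x y)
  | seq p q => .seq p.compile q.compile
  | ite x p q => .ite x p.compile q.compile
  | forn i p => .seq (.instr (.copy i 0)) (.loop i (.seq (.instr (.sub i i 2)) p.compile))

/-- The registers that a command may change. -/
def writes : Cmd → List ℕ
  | skip => []
  | set x _ => [x]
  | copy x _ => [x]
  | add x _ _ => [3, x]
  | sub x _ _ => [x]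
  | load x _ => [x]
  | store _ _ => []
  | seq p q => p.writes ++ q.writes
  | ite _ p q => p.writes ++ q.writes
  | forn i p => i :: p.writes

/-- The command does not write to the memory. -/
def readOnly : Cmd → Bool
  | store _ _ => false
  | seq p q => p.readOnly && q.readOnly
  | ite _ p q => p.readOnly && q.readOnly
  | forn _ p => p.readOnly
  | _ => true

/-- The command respects the conventions on the registers. -/
def wf : Cmd → Bool
  | skip => true
  | set x _ => x ∉ [0, 2]
  | copy x _ => x ∉ [0, 2]
  | add x y z => x ∉ [0, 2] && y ≠ 3 && z ≠ 3
  | sub x _ _ => x ∉ [0, 2]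
  | load x _ => x ∉ [0, 2]
  | store _ _ => true
  | seq p q => p.wf && q.wf
  | ite _ p q => p.wf && q.wf
  | forn i p => i ∉ [0, 2] && i ∉ p.writes && p.wf

theorem iter_reg {i r : ℕ} {f : State → State} (hr : r ≠ i) (hf : ∀ s, (f s).reg r = s.reg r)
    (m : ℕ) (s : State) : (iter i f m s).reg r = s.reg r := by
  induction m generalizing s with
  | zero => simp [iter, hr]
  | succ m ih => rw [iter, ih, hf]; simp [hr]

/-- The frame rule: since `writes` is computable, its side conditions for concrete commands can be
settled by `decide`. -/
theorem den_reg {c : Cmd} {r : ℕ} (hr : r ∉ c.writes) (s : State) : (c.den s).reg r = s.reg r := by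
  induction c generalizing s with
  | skip => rfl
  | seq p q ihp ihq =>
    simp only [writes, List.mem_append, not_or] at hr
    rw [den, ihq hr.2, ihp hr.1]
  | ite x p q ihp ihq =>
    simp only [writes, List.mem_append, not_or] at hr
    rw [den]
    split_ifs
    · exact ihq hr.2 s
    · exact ihp hr.1 s
  | forn i p ih =>
    simp only [writes, List.mem_cons, not_or] at hr
    exact iter_reg hr.1 (ih hr.2) _ _
  | _ => simp_all [writes, den]

theorem iter_mem {i : ℕ} {f : State → State} (hf : ∀ s, (f s).mem = s.mem) (m : ℕ) (s : State) :
    (iter i f m s).mem = s.mem := by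
  induction m generalizing s with
  | zero => rfl
  | succ m ih => rw [iter, ih, hf]

theorem den_mem {c : Cmd} (hc : c.readOnly = true) (s : State) : (c.den s).mem = s.mem := by
  induction c generalizing s with
  | seq p q ihp ihq =>
    simp only [readOnly, Bool.and_eq_true] at hc
    rw [den, ihq hc.2, ihp hc.1]
  | ite x p q ihp ihq =>
    simp only [readOnly, Bool.and_eq_true] at hc
    rw [den]
    split_ifs
    · exact ihq hc.2 s
    · exact ihp hc.1 s
  | forn i p ih => exact iter_mem (ih hc) _ _
  | store => simp [readOnly] at hc
  | _ => rfl

theorem not_mem_writes_of_wf {c : Cmd} (h : c.wf = true) : 0 ∉ c.writes ∧ 2 ∉ c.writes := by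
  induction c <;> simp_all [wf, writes] <;> omega

/-- The rule for loops: `I m` holds when the iterations from `m` on have been done. -/
theorem den_forn {i n : ℕ} {p : Cmd} {s : State} (I : ℕ → State → Prop) (h0 : s.reg 0 = n)
    (h : I n s) (step : ∀ m s', m < n → I (m + 1) s' →
      I m (p.den { s' with reg := Function.update s'.reg i m })) :
    ∃ s', I 0 s' ∧ (forn i p).den s = { s' with reg := Function.update s'.reg i 0 } := by
  have key : ∀ m s', m ≤ n → I m s' → ∃ s'', I 0 s'' ∧
      iter i p.den m s' = { s'' with reg := Function.update s''.reg i 0 } := by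
    intro m
    induction m with
    | zero => exact fun s' _ h' => ⟨s', h', rfl⟩
    | succ m ih => exact fun s' hm h' => ih _ (by omega) (step m s' (by omega) h')
  rw [den, h0]
  exact key _ s le_rfl h

/-- All registers and memory cells hold numbers of size at most `M`. -/
def Bounded (M : ℕ) (s : State) : Prop := (∀ r, s.reg r ≤ M) ∧ ∀ a, s.mem a ≤ M

/-- A bound for the cost of an instruction that handles numbers of size at most `M`. -/
def unit (M : ℕ) : ℕ := 1 + 3 * M.size

theorem unit_mono {M M' : ℕ} (h : M ≤ M') : unit M ≤ unit M' := by
  have := Nat.size_le_size h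
  unfold unit; omega

theorem Bounded.mono {M M' : ℕ} {s : State} (hs : Bounded M s) (h : M ≤ M') : Bounded M' s :=
  ⟨fun r => (hs.1 r).trans h, fun a => (hs.2 a).trans h⟩

theorem Bounded.update {M v : ℕ} {s : State} (hs : Bounded M s) (r : ℕ) (hv : v ≤ M) :
    Bounded M { s with reg := Function.update s.reg r v } := by
  refine ⟨fun r' => ?_, hs.2⟩
  simp only [Function.update_apply]
  split_ifs
  · exact hv
  · exact hs.1 r'

theorem Bounded.update_mem {M v : ℕ} {s : State} (hs : Bounded M s) (a : ℕ) (hv : v ≤ M) :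
    Bounded M { s with mem := Function.update s.mem a v } := by
  refine ⟨hs.1, fun a' => ?_⟩
  simp only [Function.update_apply]
  split_ifs
  · exact hv
  · exact hs.2 a'

/-- The bound `T` on the growth caused by the body does not depend on `M`, so `m` rounds add only `m
* T` instead of compounding. -/
theorem exec_loop {i n T : ℕ} {p : Cmd} (hi : i ≠ 0 ∧ i ≠ 2) (hip : i ∉ p.writes) (hp : p.wf = true)
    (ih : ∀ s M, s.reg 0 = n → s.reg 2 = 1 → Bounded M s → ∃ t, Exec p.compile s t (p.den s) ∧
      t ≤ T * unit (M + T) ∧ Bounded (M + T) (p.den s)) (m : ℕ) (s : State) (M : ℕ)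
    (hm : s.reg i = m) (h0 : s.reg 0 = n) (h2 : s.reg 2 = 1) (hB : Bounded M s) :
    ∃ t, Exec (.loop i (.seq (.instr (.sub i i 2)) p.compile)) s t (iter i p.den m s) ∧
      t ≤ (m * (T + 2) + 1) * unit (M + m * T) ∧ Bounded (M + m * T) (iter i p.den m s) := by
  obtain ⟨hw0, hw2⟩ := not_mem_writes_of_wf hp
  induction m generalizing s M with
  | zero =>
    have hs : iter i p.den 0 s = s := by
      rw [iter, ← hm, Function.update_eq_self]
    rw [hs]
    refine ⟨_, .loop_false hm, ?_, by simpa using hB⟩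
    simp [hm, unit]
  | succ m ihm =>
    set s₁ : State := { s with reg := Function.update s.reg i m } with hs₁
    have hle : ∀ r, (s.reg r).size ≤ M.size := fun r => Nat.size_le_size (hB.1 r)
    have hB₁ : Bounded M s₁ := hB.update i ((by omega : m ≤ s.reg i).trans (hB.1 i))
    have hsub : Exec (.instr (.sub i i 2)) s (Instr.cost (.sub i i 2) s) s₁ := by
      have := Exec.instr (.sub i i 2) s
      rwa [Instr.run, hm, h2, Nat.add_sub_cancel] at this
    obtain ⟨t₁, e₁, ht₁, hB₂⟩ := ih s₁ M (by simp [hs₁, hi.1.symm, h0])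
      (by simp [hs₁, hi.2.symm, h2]) hB₁
    obtain ⟨t₂, e₂, ht₂, hB₃⟩ := ihm (p.den s₁) (M + T) (by rw [den_reg hip]; simp [hs₁])
      (by rw [den_reg hw0]; simp [hs₁, hi.1.symm, h0])
      (by rw [den_reg hw2]; simp [hs₁, hi.2.symm, h2]) hB₂
    have hM : M + T + m * T = M + (m + 1) * T := by ring
    rw [hM] at ht₂ hB₃
    refine ⟨_, .loop_true (by omega) (.seq hsub e₁) e₂, ?_, hB₃⟩
    have u1 : unit (M + T) ≤ unit (M + (m + 1) * T) := unit_mono (by nlinarith)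
    have u2 : unit M ≤ unit (M + (m + 1) * T) := unit_mono (by omega)
    have c1 : 1 + (s.reg i).size ≤ unit M := by have := hle i; unfold unit; omega
    have c2 : Instr.cost (.sub i i 2) s ≤ unit M := by
      have := hle i; have := hle 2; simp only [Instr.cost]; unfold unit; omega
    have c3 := ht₁.trans (Nat.mul_le_mul_left T u1)
    calc _ ≤ unit (M + (m + 1) * T) + (unit (M + (m + 1) * T) + T * unit (M + (m + 1) * T)) +
          (m * (T + 2) + 1) * unit (M + (m + 1) * T) := by omega
      _ = _ := by ring

theorem mul_pow_le {K L n : ℕ} (hn : 1 ≤ n) (h : K ≤ L) : K * n ^ K ≤ L * n ^ L :=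
  Nat.mul_le_mul h (Nat.pow_le_pow_right hn h)

theorem mul_pow_add_le {K L n : ℕ} (hn : 1 ≤ n) :
    K * n ^ K + L * n ^ L ≤ (K + L) * n ^ (K + L) := by
  rw [add_mul]
  exact add_le_add (Nat.mul_le_mul_left _ (Nat.pow_le_pow_right hn (by omega)))
    (Nat.mul_le_mul_left _ (Nat.pow_le_pow_right hn (by omega)))

/-- Commands run in polynomial time and enlarge the numbers at most by a polynomial. -/
theorem exec_compile {c : Cmd} (hc : c.wf = true) : ∃ K, ∀ n s M, 1 ≤ n → s.reg 0 = n →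
    s.reg 2 = 1 → Bounded M s → ∃ t, Exec c.compile s t (c.den s) ∧
      t ≤ K * n ^ K * unit (M + K * n ^ K) ∧ Bounded (M + K * n ^ K) (c.den s) := by
  have simple : ∀ {M N : ℕ} {c : Cmd} {i : Instr} {s : State}, c.compile = .instr i →
      c.den s = i.run s → i.cost s ≤ N * unit (M + N) → Bounded (M + N) (c.den s) →
      ∃ t, Exec c.compile s t (c.den s) ∧ t ≤ N * unit (M + N) ∧ Bounded (M + N) (c.den s) := by
    intro M N c i s h1 h2 h3 h4
    exact ⟨_, by rw [h1, h2]; exact .instr i s, h3, h4⟩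
  have one : ∀ {M t n : ℕ}, 1 ≤ n → t ≤ unit M → t ≤ 1 * n ^ 1 * unit (M + 1 * n ^ 1) := by
    intro M t n hn ht
    refine ht.trans ((unit_mono (by omega : M ≤ M + 1 * n ^ 1)).trans ?_)
    exact Nat.le_mul_of_pos_left _ (by rw [one_mul, pow_one]; exact hn)
  induction c with
  | skip =>
    refine ⟨1, fun n s M hn _ _ hB => ⟨1, .skip s, one hn (by unfold unit; omega),
      hB.mono (by omega)⟩⟩
  | set x a =>
    refine ⟨a + 1, fun n s M hn _ _ hB => simple rfl rfl ?_ ?_⟩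
    · have h1 : a + 1 ≤ (a + 1) * n ^ (a + 1) := Nat.le_mul_of_pos_right _ (by positivity)
      refine le_trans ?_ (Nat.le_mul_of_pos_left _ (by omega))
      have := Nat.size_le_size (by omega : a ≤ M + (a + 1) * n ^ (a + 1))
      simp only [Instr.cost, unit]; omega
    · have h1 : a + 1 ≤ (a + 1) * n ^ (a + 1) := Nat.le_mul_of_pos_right _ (by positivity)
      exact (hB.mono (by omega)).update _ (by omega)
  | copy x y =>
    refine ⟨1, fun n s M hn _ _ hB => simple rfl rfl (one hn ?_) ?_⟩
    · have := Nat.size_le_size (hB.1 y)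
      simp only [Instr.cost, unit]; omega
    · exact (hB.update x (hB.1 y)).mono (by omega)
  | sub x y z =>
    refine ⟨1, fun n s M hn _ _ hB => simple rfl rfl (one hn ?_) ?_⟩
    · have := Nat.size_le_size (hB.1 y)
      have := Nat.size_le_size (hB.1 z)
      simp only [Instr.cost, unit]; omega
    · exact (hB.update x ((Nat.sub_le _ _).trans (hB.1 y))).mono (by omega)
  | load x y =>
    refine ⟨1, fun n s M hn _ _ hB => simple rfl rfl (one hn ?_) ?_⟩
    · have := Nat.size_le_size (hB.1 y)
      have := Nat.size_le_size (hB.2 (s.reg y))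
      simp only [Instr.cost, unit]; omega
    · exact (hB.update x (hB.2 _)).mono (by omega)
  | store x y =>
    refine ⟨1, fun n s M hn _ _ hB => simple rfl rfl (one hn ?_) ?_⟩
    · have := Nat.size_le_size (hB.1 y)
      have := Nat.size_le_size (hB.1 x)
      simp only [Instr.cost, unit]; omega
    · exact (hB.update_mem _ (hB.1 y)).mono (by omega)
  -- As the second summand is truncated at `n`, an addition raises the largest number by at most
  -- `n`; repeated doubling inside loops is impossible.
  | add x y z =>
    simp only [wf, Bool.and_eq_true, decide_eq_true_eq] at hc
    obtain ⟨⟨-, hy⟩, hz⟩ := hc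
    refine ⟨3, fun n s M hn h0 _ hB => ?_⟩
    have hn3 : n ≤ n ^ 3 := Nat.le_self_pow (by omega) n
    have hmin : s.reg z - (s.reg z - s.reg 0) = min (s.reg z) (s.reg 0) := by omega
    have hrun : Instr.run (.add x y 3) (Instr.run (.sub 3 z 3) (Instr.run (.sub 3 z 0) s)) =
        (add x y z).den s := by
      simp [Instr.run, den, hy, hz, hmin]
    have e := Exec.seq (Exec.instr (.sub 3 z 0) s)
      (Exec.seq (Exec.instr (.sub 3 z 3) _) (Exec.instr (.add x y 3) _))
    rw [hrun] at e
    refine ⟨_, e, ?_, ?_⟩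
    · have hy' := Nat.size_le_size ((hB.1 y).trans (by omega : M ≤ M + 3 * n ^ 3))
      have hz' := Nat.size_le_size ((hB.1 z).trans (by omega : M ≤ M + 3 * n ^ 3))
      have h0' := Nat.size_le_size ((hB.1 0).trans (by omega : M ≤ M + 3 * n ^ 3))
      have h1 := Nat.size_le_size
        ((Nat.sub_le (s.reg z) (s.reg 0)).trans ((hB.1 z).trans (by omega : M ≤ M + 3 * n ^ 3)))
      have h2 := Nat.size_le_size ((Nat.sub_le (s.reg z) (s.reg z - s.reg 0)).trans
        ((hB.1 z).trans (by omega : M ≤ M + 3 * n ^ 3)))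
      have h3 : 3 * unit (M + 3 * n ^ 3) ≤ 3 * n ^ 3 * unit (M + 3 * n ^ 3) :=
        Nat.mul_le_mul_right _ (Nat.le_mul_of_pos_right _ (by positivity))
      refine le_trans ?_ h3
      simp only [Instr.cost, Instr.run, Function.update_self, ne_eq, hy, hz, not_false_eq_true,
        Function.update_of_ne, unit]
      omega
    · have hm : min (s.reg z) (s.reg 0) ≤ n := by omega
      have := hB.1 y
      have h1 := (hB.mono (by omega : M ≤ M + 3 * n ^ 3)).update 3
        (v := min (s.reg z) (s.reg 0)) (by omega)
      exact h1.update x (v := s.reg y + min (s.reg z) (s.reg 0)) (by omega)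
  | seq p q ihp ihq =>
    simp only [wf, Bool.and_eq_true] at hc
    obtain ⟨K, hK⟩ := ihp hc.1
    obtain ⟨L, hL⟩ := ihq hc.2
    refine ⟨K + L, fun n s M hn h0 h2 hB => ?_⟩
    obtain ⟨t₁, e₁, ht₁, hB₁⟩ := hK n s M hn h0 h2 hB
    obtain ⟨hw0, hw2⟩ := not_mem_writes_of_wf hc.1
    obtain ⟨t₂, e₂, ht₂, hB₂⟩ := hL n (p.den s) _ hn (by rw [den_reg hw0, h0])
      (by rw [den_reg hw2, h2]) hB₁
    have h := mul_pow_add_le (K := K) (L := L) hn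
    refine ⟨_, .seq e₁ e₂, ?_, hB₂.mono (by omega)⟩
    have h3 := Nat.mul_le_mul_left (K * n ^ K)
      (unit_mono (by omega : M + K * n ^ K ≤ M + (K + L) * n ^ (K + L)))
    have h4 := Nat.mul_le_mul_left (L * n ^ L)
      (unit_mono (by omega : M + K * n ^ K + L * n ^ L ≤ M + (K + L) * n ^ (K + L)))
    have h5 := Nat.mul_le_mul_right (unit (M + (K + L) * n ^ (K + L))) h
    rw [add_mul] at h5
    omega
  | ite x p q ihp ihq =>
    simp only [wf, Bool.and_eq_true] at hc
    obtain ⟨K, hK⟩ := ihp hc.1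
    obtain ⟨L, hL⟩ := ihq hc.2
    refine ⟨K + L + 1, fun n s M hn h0 h2 hB => ?_⟩
    have hx := Nat.size_le_size ((hB.1 x).trans
      (by omega : M ≤ M + (K + L + 1) * n ^ (K + L + 1)))
    have h := mul_pow_add_le (K := K + L) (L := 1) hn
    have hk := mul_pow_le hn (by omega : K ≤ K + L)
    have hl := mul_pow_le hn (by omega : L ≤ K + L)
    have hn1 : 1 ≤ 1 * n ^ 1 := by simpa using hn
    have fin : ∀ {t A : ℕ}, A + 1 ≤ (K + L + 1) * n ^ (K + L + 1) → t ≤ A * unit (M + A) →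
        1 + (s.reg x).size + t ≤ (K + L + 1) * n ^ (K + L + 1) *
          unit (M + (K + L + 1) * n ^ (K + L + 1)) := by
      intro t A hA ht
      have h3 := Nat.mul_le_mul_left A
        (unit_mono (by omega : M + A ≤ M + (K + L + 1) * n ^ (K + L + 1)))
      have h5 := Nat.mul_le_mul_right (unit (M + (K + L + 1) * n ^ (K + L + 1))) hA
      have h6 : 1 + (s.reg x).size ≤ unit (M + (K + L + 1) * n ^ (K + L + 1)) := by
        unfold unit; omega
      rw [add_mul, one_mul] at h5
      omega
    by_cases h1 : s.reg x = 0
    · obtain ⟨t, e, ht, hB'⟩ := hL n s M hn h0 h2 hB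
      refine ⟨_, ?_, fin (A := L * n ^ L) (by omega) ht, ?_⟩
      · rw [den, if_pos h1]; exact .ite_false h1 e
      · rw [den, if_pos h1]; exact hB'.mono (by omega)
    · obtain ⟨t, e, ht, hB'⟩ := hK n s M hn h0 h2 hB
      refine ⟨_, ?_, fin (A := K * n ^ K) (by omega) ht, ?_⟩
      · rw [den, if_neg h1]; exact .ite_true h1 e
      · rw [den, if_neg h1]; exact hB'.mono (by omega)
  | forn i p ih =>
    simp only [wf, Bool.and_eq_true, decide_eq_true_eq, List.mem_cons, List.not_mem_nil,
      or_false, not_or] at hc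
    obtain ⟨⟨hi, hip⟩, hp⟩ := hc
    have hi : i ≠ 0 ∧ i ≠ 2 := hi
    obtain ⟨K, hK⟩ := ih hp
    -- The loop raises the degree by one; the remaining slack absorbs the tests, the decrements and
    -- the initial copy.
    refine ⟨K + 4, fun n s M hn h0 h2 hB => ?_⟩
    set s₁ : State := { s with reg := Function.update s.reg i (s.reg 0) } with hs₁
    have hB₁ : Bounded M s₁ := hB.update i (hB.1 0)
    obtain ⟨t, e, ht, hB'⟩ := exec_loop hi hip hp (fun s M h0 h2 hB => hK n s M hn h0 h2 hB) n s₁ M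
      (by simp [hs₁, h0]) (by simp [hs₁, hi.1.symm, h0]) (by simp [hs₁, hi.2.symm, h2]) hB₁
    have hiter : iter i p.den n s₁ = (forn i p).den s := by
      obtain ⟨m, rfl⟩ : ∃ m, n = m + 1 := ⟨n - 1, by omega⟩
      rw [den, h0, iter, iter]
      simp [hs₁]
    rw [hiter] at e hB'
    have hle : n * (K * n ^ K + 2) + 2 ≤ (K + 4) * n ^ (K + 4) := by
      have h1 : n ^ (K + 1) ≤ n ^ (K + 4) := Nat.pow_le_pow_right hn (by omega)
      have h3 : n ^ 1 ≤ n ^ (K + 4) := Nat.pow_le_pow_right hn (by omega)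
      have h4 := Nat.mul_le_mul_left K h1
      calc n * (K * n ^ K + 2) + 2 = K * n ^ (K + 1) + 2 * n ^ 1 + 2 := by ring
        _ ≤ (K + 4) * n ^ (K + 4) := by rw [add_mul]; rw [pow_one] at h3 ⊢; omega
    have hle' : n * (K * n ^ K) ≤ (K + 4) * n ^ (K + 4) := by
      refine le_trans ?_ hle
      rw [mul_add]; omega
    refine ⟨_, .seq (.instr _ _) e, ?_, hB'.mono (by omega)⟩
    have h5 := Nat.mul_le_mul_left (n * (K * n ^ K + 2) + 1)
      (unit_mono (by omega : M + n * (K * n ^ K) ≤ M + (K + 4) * n ^ (K + 4)))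
    have h6 := Nat.mul_le_mul_right (unit (M + (K + 4) * n ^ (K + 4))) hle
    have h7 : Instr.cost (.copy i 0) s ≤ unit (M + (K + 4) * n ^ (K + 4)) := by
      have := Nat.size_le_size ((hB.1 0).trans (by omega : M ≤ M + (K + 4) * n ^ (K + 4)))
      simp only [Instr.cost, unit]; omega
    have h8 : (n * (K * n ^ K + 2) + 2) * unit (M + (K + 4) * n ^ (K + 4)) =
      (n * (K * n ^ K + 2) + 1) * unit (M + (K + 4) * n ^ (K + 4)) +
        unit (M + (K + 4) * n ^ (K + 4)) := by ring
    omega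

end Cmd

end Commands

end MIST

namespace MIST

/-! ### The search as a command -/

section Programs

open Cmd

namespace Cmd

/-- Commands in succession. -/
def block : List Cmd → Cmd
  | [] => skip
  | c :: cs => seq c (block cs)

/-- The body of the loop in `scan`. -/
def scanBody : Cmd := block [
  add 15 12 14,
  load 16 15,
  ite 16
    (block [
      add 15 7 14,
      load 16 15,
      ite 16 skip
        (block [copy 19 14, ite 17 (set 17 1) (block [set 17 2, copy 18 14])])])
    skip]

/-- Counts the outside neighbours of a vertex: register `17` gets `0`, `2` or `1` if there are
none, exactly one or at least two of them, registers `18` and `19` get the last and the first one.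
Register `7` points to the partial tree, register `12` to the row of the vertex. -/
def scan : Cmd := block [set 17 0, forn 14 scanBody]

/-- Records the vertex in register `13` and its outside neighbours. -/
def take : Cmd := block [copy 8 17, copy 9 13, copy 10 18, copy 11 19]

/-- Loads the status of the vertex in register `13`. -/
def status : Cmd := block [sub 12 12 0, add 15 7 13, load 16 15, sub 25 16 2]

/-- Records the vertex in register `13` if it is better than the present one. -/
def keep : Cmd := ite 17 (block [sub 16 17 2, ite 16 take (ite 8 skip take)]) skip

/-- The body of the loop in `find`. -/
def findBody : Cmd := block [status, ite 16 (ite 25 skip (block [scan, keep])) skip]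

/-- Looks for an open vertex with an outside neighbour, preferably with exactly one. The result is
in the registers `8` to `11`. -/
def find : Cmd := block [set 8 0, copy 12 6, forn 13 findBody]

/-- Closes the vertex found by `find` and attaches the vertices in the registers `x` and `y`. -/
def expand (x y : ℕ) : Cmd := block [
  add 15 7 9, set 25 2, store 15 25,
  add 15 7 x, store 15 2,
  add 15 7 y, store 15 2]

/-- The body of the loop in `greedy`. -/
def greedyBody : Cmd := block [find, ite 8 (expand 10 11) skip]

/-- Greedy completion of the partial tree at register `7`. -/
def greedy : Cmd := forn 20 greedyBody

/-- The body of the loop in `copyBlock`. -/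
def copyBody : Cmd := block [add 15 24 13, load 16 15, add 15 7 13, store 15 16]

/-- Copies the partial tree at register `24` to register `7`. -/
def copyBlock : Cmd := forn 13 copyBody

/-- The body of the loop in `count`. -/
def countBody : Cmd := block [
  add 15 7 13,
  load 16 15,
  ite 16 (block [sub 16 16 2, ite 16 (add 21 21 2) skip]) (add 22 22 2)]

/-- Counts closed vertices in register `21` and outside vertices in register `22`. -/
def count : Cmd := block [set 21 0, set 22 0, forn 13 countBody]

/-- Writes a descendant of the partial tree at register `24` to register `7`. -/
def child (x y : ℕ) : Cmd := block [copyBlock, expand x y]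

/-- Puts the first descendant above the stack. -/
def spawnFst : Cmd := block [copy 7 5, child 10 10]

/-- Puts the second descendant above the first. -/
def spawnSnd : Cmd := block [add 7 5 0, child 11 11]

/-- Replaces the top of the stack by the third descendant. -/
def spawnTop : Cmd := block [copy 7 24, expand 10 11]

/-- Replaces the partial tree on top of the stack by its descendants. -/
def branch : Cmd := block [
  sub 16 8 2,
  ite 16 (expand 10 10) (block [spawnFst, spawnSnd, spawnTop, block [add 5 5 0, add 5 5 0]])]

/-- Completes the top of the stack greedily and counts. -/
def examine : Cmd := block [block [sub 24 5 0, copy 7 5], copyBlock, greedy, count]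

/-- Removes the top of the stack, or replaces it by its descendants, or stops the search. -/
def advance : Cmd :=
  ite 22
    (copy 5 24)
    (block [
      sub 16 1 21,
      ite 16
        (block [copy 7 24, find, ite 8 branch (copy 5 24)])
        (block [set 23 1, copy 5 6])])

/-- One step of the search: treats the partial tree on top of the stack. Register `5` points to the
end of the stack, register `6` to its beginning; register `23` is set when a solution is found. -/
def body : Cmd := block [examine, advance, sub 4 5 6]

/-- The body of the second loop in `init`. -/
def initBody : Cmd := block [
  load 16 13,
  ite 16 (block [store 5 2, add 15 5 13, store 15 2, add 5 5 0]) skip]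

/-- Puts the partial trees with one edge at vertex `0` on the stack. -/
def init : Cmd := block [
  set 6 0, forn 13 (add 6 6 0), block [copy 5 6, set 23 0], forn 13 initBody, sub 4 5 6]

end Cmd

/-! ### Correctness of the scanning commands -/

section Specs

open Classical

variable {n : ℕ} {G : SimpleGraph (Fin n)}

/-- The outcome of a search for the elements of `D`. -/
def Found (D : Finset (Fin n)) (o a b : ℕ) : Prop :=
  o = 0 ∧ D = ∅ ∨ o = 2 ∧ (∃ u : Fin n, a = u ∧ b = u ∧ D = {u}) ∨
    o = 1 ∧ ∃ u₁ u₂ : Fin n, u₁ ≠ u₂ ∧ a = u₁ ∧ b = u₂ ∧ u₁ ∈ D ∧ u₂ ∈ D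

theorem Found.insert {D : Finset (Fin n)} {o a b : ℕ} (h : Found D o a b) {u : Fin n}
    (hu : u ∉ D) : Found (insert u D) (if o = 0 then 2 else 1) (if o = 0 then (u : ℕ) else a) u := by
  rcases h with ⟨rfl, rfl⟩ | ⟨rfl, x, rfl, rfl, rfl⟩ | ⟨rfl, u₁, u₂, hne, rfl, rfl, h1, h2⟩
  · exact Or.inr (Or.inl ⟨rfl, u, rfl, rfl, rfl⟩)
  · exact Or.inr (Or.inr ⟨rfl, x, u, fun h => hu (by simp [h]), rfl, rfl, by simp, by simp⟩)
  · exact Or.inr (Or.inr ⟨rfl, u₁, u, fun h => hu (h ▸ h1), rfl, rfl, by simp [h1], by simp⟩)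

/-- The memory holds the adjacency matrix. -/
def HasMatrix (G : SimpleGraph (Fin n)) (mem : ℕ → ℕ) : Prop :=
  ∀ i j : Fin n, mem (n * (i : ℕ) + j) = if G.Adj i j then 1 else 0

/-- The memory holds the partial tree `σ` at address `p`. -/
def HasBlock (mem : ℕ → ℕ) (p : ℕ) (σ : Fin n → ℕ) : Prop := ∀ v : Fin n, mem (p + v) = σ v

theorem scan_spec {s : State} {v : Fin n} {σ : Fin n → ℕ} (h0 : s.reg 0 = n)
    (hr : s.reg 12 = n * v) (hG : HasMatrix G s.mem) (hσ : HasBlock s.mem (s.reg 7) σ) :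
    Found (outN G σ v) ((scan.den s).reg 17) ((scan.den s).reg 18) ((scan.den s).reg 19) := by
  -- The loop counts down, so after the rounds from `m` on exactly the vertices with index at least
  -- `m` have been seen.
  let D : ℕ → Finset (Fin n) := fun m => {u ∈ outN G σ v | m ≤ u.val}
  let s₁ : State := { s with reg := Function.update s.reg 17 0 }
  let I : ℕ → State → Prop := fun m s' => s'.reg 0 = n ∧ s'.reg 12 = s.reg 12 ∧
    s'.reg 7 = s.reg 7 ∧ s'.mem = s.mem ∧ Found (D m) (s'.reg 17) (s'.reg 18) (s'.reg 19)
  have hI₁ : I n s₁ := by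
    refine ⟨by simp [s₁, h0], by simp [s₁], by simp [s₁], rfl, Or.inl ⟨by simp [s₁], ?_⟩⟩
    simp [D]
  have step : ∀ m s', m < n → I (m + 1) s' →
      I m (scanBody.den { s' with reg := Function.update s'.reg 14 m }) := by
    rintro m s' hm ⟨h0', h12, h7, hmem, hF⟩
    have hm' : m < n := hm
    have hmin : min m n = m := by omega
    set u : Fin n := ⟨m, hm'⟩ with hu
    have e1 : s.mem (n * v + m) = if G.Adj v u then 1 else 0 := hG v u
    have e2 : s.mem (s.reg 7 + m) = σ u := hσ u
    have hu' : (u : ℕ) = m := rfl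
    have hnot : u ∉ D (m + 1) := by simp [D, hu]
    change _ ∧ _ ∧ _ ∧ _ ∧ Found (D m) _ _ _
    by_cases ha : G.Adj v u
    · by_cases hz : σ u = 0
      · have hD : D m = insert u (D (m + 1)) := by
          ext x
          simp only [D, Finset.mem_filter, Finset.mem_insert, mem_outN, Fin.ext_iff, hu]
          constructor
          · rintro ⟨h1, h2⟩
            by_cases hx : (x : ℕ) = m
            · exact Or.inl hx
            · exact Or.inr ⟨h1, by omega⟩
          · rintro (h1 | ⟨h1, h2⟩)
            · have : x = u := Fin.ext h1
              subst this
              exact ⟨⟨ha, hz⟩, h1.ge⟩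
            · exact ⟨h1, by omega⟩
        have hF' := hF.insert hnot
        rw [hD]
        by_cases ho : s'.reg 17 = 0
        · simpa [scanBody, den, block, h0', h12, h7, hr, hmem, hmin, e1, e2, ha, hz, ho, hu'] using hF'
        · simpa [scanBody, den, block, h0', h12, h7, hr, hmem, hmin, e1, e2, ha, hz, ho, hu'] using hF'
      · have hD : D m = D (m + 1) := by
          ext x
          simp only [D, Finset.mem_filter, mem_outN]
          refine and_congr_right fun h1 => ⟨fun h2 => ?_, fun h2 => by omega⟩
          by_contra hx
          have : x = u := Fin.ext (by simp only [hu]; omega)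
          exact hz (this ▸ h1.2)
        rw [hD]
        simpa [scanBody, den, block, h0', h12, h7, hr, hmem, hmin, e1, e2, ha, hz] using hF
    · have hD : D m = D (m + 1) := by
        ext x
        simp only [D, Finset.mem_filter, mem_outN]
        refine and_congr_right fun h1 => ⟨fun h2 => ?_, fun h2 => by omega⟩
        by_contra hx
        have : x = u := Fin.ext (by simp only [hu]; omega)
        exact ha (this ▸ h1.1)
      rw [hD]
      simpa [scanBody, den, block, h0', h12, h7, hr, hmem, hmin, e1, e2, ha] using hF
  obtain ⟨s', hI, hs'⟩ := den_forn (i := 14) I (by simp [s₁, h0]) hI₁ step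
  have hD : D 0 = outN G σ v := by simp [D]
  have : scan.den s = { s' with reg := Function.update s'.reg 14 0 } := hs'
  rw [this]
  simpa [← hD] using hI.2.2.2.2

/-- The outcome of the search for an open vertex `v ≥ m` with outside neighbours. -/
def FoundVertex (G : SimpleGraph (Fin n)) (σ : Fin n → ℕ) (m F V a b : ℕ) : Prop :=
  F = 0 ∧ (∀ v : Fin n, m ≤ v → σ v = 1 → outN G σ v = ∅) ∨
  F = 2 ∧ (∃ v u : Fin n, V = v ∧ a = u ∧ b = u ∧ σ v = 1 ∧ outN G σ v = {u}) ∨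
  F = 1 ∧ (∃ v u₁ u₂ : Fin n, V = v ∧ a = u₁ ∧ b = u₂ ∧ u₁ ≠ u₂ ∧ σ v = 1 ∧
    outN G σ v = {u₁, u₂}) ∧ ∀ w : Fin n, m ≤ w → σ w = 1 → (outN G σ w).card ≠ 1

theorem FoundVertex.of_forall {σ : Fin n → ℕ} {m : ℕ} (hm : m < n) {F V a b : ℕ}
    (h : FoundVertex G σ (m + 1) F V a b)
    (hv : σ ⟨m, hm⟩ = 1 → outN G σ ⟨m, hm⟩ = ∅) : FoundVertex G σ m F V a b := by
  have key : ∀ v : Fin n, m ≤ v → v = ⟨m, hm⟩ ∨ m + 1 ≤ v := by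
    intro v hv
    by_cases h1 : (v : ℕ) = m
    · exact Or.inl (Fin.ext h1)
    · exact Or.inr (by omega)
  rcases h with ⟨hF, h⟩ | h | ⟨hF, h, h'⟩
  · refine Or.inl ⟨hF, fun v hmv h1 => ?_⟩
    rcases key v hmv with rfl | h2
    · exact hv h1
    · exact h v h2 h1
  · exact Or.inr (Or.inl h)
  · refine Or.inr (Or.inr ⟨hF, h, fun w hmw h1 => ?_⟩)
    rcases key w hmw with rfl | h2
    · rw [hv h1]; simp
    · exact h' w h2 h1

/-- A vertex with one outside neighbour always overwrites the record, one with two only an empty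
record. So code `1` certifies that no free vertex has been seen. -/
theorem keep_spec {s : State} {σ : Fin n → ℕ} {m : ℕ} (hm : m < n) (h13 : s.reg 13 = m)
    (h2 : s.reg 2 = 1) (h1 : σ ⟨m, hm⟩ = 1) (hc : (outN G σ ⟨m, hm⟩).card ≤ 2)
    (hs : Found (outN G σ ⟨m, hm⟩) (s.reg 17) (s.reg 18) (s.reg 19))
    (h : FoundVertex G σ (m + 1) (s.reg 8) (s.reg 9) (s.reg 10) (s.reg 11)) :
    FoundVertex G σ m ((keep.den s).reg 8) ((keep.den s).reg 9) ((keep.den s).reg 10)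
      ((keep.den s).reg 11) := by
  rcases hs with ⟨ho, hD⟩ | ⟨ho, u, ha, hb, hD⟩ | ⟨ho, u₁, u₂, hne, ha, hb, hu1, hu2⟩
  · have := h.of_forall hm fun _ => hD
    simpa [keep, den, ho] using this
  · refine Or.inr (Or.inl ⟨?_, ⟨m, hm⟩, u, ?_, ?_, ?_, h1, hD⟩) <;>
      simp [keep, take, den, block, ho, h2, ha, hb, h13]
  · have hD : outN G σ ⟨m, hm⟩ = {u₁, u₂} := by
      refine (Finset.eq_of_subset_of_card_le (Finset.insert_subset hu1 (by simpa using hu2)) ?_).symm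
      rwa [Finset.card_pair hne]
    have key : ∀ w : Fin n, m ≤ w → w = ⟨m, hm⟩ ∨ m + 1 ≤ w := by
      intro v hv
      by_cases h1 : (v : ℕ) = m
      · exact Or.inl (Fin.ext h1)
      · exact Or.inr (by omega)
    rcases h with ⟨hF, h⟩ | ⟨hF, h⟩ | ⟨hF, h, h'⟩
    · refine Or.inr (Or.inr ⟨?_, ⟨⟨m, hm⟩, u₁, u₂, ?_, ?_, ?_, hne, h1, hD⟩, ?_⟩)
      · simp [keep, take, den, block, ho, h2, hF]
      · simp [keep, take, den, block, ho, h2, hF, h13]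
      · simp [keep, take, den, block, ho, h2, hF, ha]
      · simp [keep, take, den, block, ho, h2, hF, hb]
      · intro w hmw hw
        rcases key w hmw with rfl | h3
        · rw [hD, Finset.card_pair hne]; norm_num
        · rw [h w h3 hw]; simp
    · refine Or.inr (Or.inl ?_)
      simpa [keep, take, den, block, ho, h2, hF] using h
    · refine Or.inr (Or.inr ⟨by simp [keep, take, den, block, ho, h2, hF], ?_, ?_⟩)
      · simpa [keep, take, den, block, ho, h2, hF] using h
      · intro w hmw hw
        rcases key w hmw with rfl | h3
        · rw [hD, Finset.card_pair hne]; norm_num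
        · exact h' w h3 hw

/-- The conventions that hold throughout the search. -/
structure Setup (G : SimpleGraph (Fin n)) (s : State) : Prop where
  size : s.reg 0 = n
  one : s.reg 2 = 1
  base : s.reg 6 = n * n
  matrix : HasMatrix G s.mem

theorem find_spec {s : State} {σ : Fin n → ℕ} (hs : Setup G s) (hσ : HasBlock s.mem (s.reg 7) σ)
    (h2 : ∀ v, σ v ≤ 2) (hc : ∀ v, σ v = 1 → (outN G σ v).card ≤ 2) :
    FoundVertex G σ 0 ((find.den s).reg 8) ((find.den s).reg 9) ((find.den s).reg 10)
      ((find.den s).reg 11) := by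
  let s₁ : State := (block [set 8 0, copy 12 6]).den s
  -- The row pointer in register `12` starts at `n * n` and moves back by `n` in every round, which
  -- avoids multiplication.
  let I : ℕ → State → Prop := fun m s' => s'.reg 0 = n ∧ s'.reg 2 = 1 ∧ s'.reg 12 = n * m ∧
    s'.reg 7 = s.reg 7 ∧ s'.mem = s.mem ∧
    FoundVertex G σ m (s'.reg 8) (s'.reg 9) (s'.reg 10) (s'.reg 11)
  have hI₁ : I n s₁ := by
    refine ⟨by simp [s₁, den, block, hs.size], by simp [s₁, den, block, hs.one],
      by simp [s₁, den, block, hs.base], by simp [s₁, den, block], rfl,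
      Or.inl ⟨by simp [s₁, den, block], fun v hv => by have := v.isLt; omega⟩⟩
  have step : ∀ m s', m < n → I (m + 1) s' →
      I m (findBody.den { s' with reg := Function.update s'.reg 13 m }) := by
    rintro m s' hm ⟨g0, g2, g12, g7, gm, hF⟩
    have hmin : min m n = m := by omega
    have e2 : s.mem (s.reg 7 + m) = σ ⟨m, hm⟩ := hσ ⟨m, hm⟩
    set s₂ := status.den { s' with reg := Function.update s'.reg 13 m } with hs₂
    have k : ∀ r, r ∉ 13 :: status.writes → s₂.reg r = s'.reg r := by
      intro r hr
      rw [List.mem_cons, not_or] at hr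
      rw [hs₂, den_reg hr.2]
      simp [hr.1]
    have km : s₂.mem = s.mem := by rw [hs₂, den_mem (by decide)]; exact gm
    have k12 : s₂.reg 12 = n * m := by
      simp [hs₂, status, den, block, g0, g12, mul_add]
    have k13 : s₂.reg 13 = m := by simp [hs₂, status, den, block]
    have k16 : s₂.reg 16 = σ ⟨m, hm⟩ := by
      simp [hs₂, status, den, block, g0, g7, gm, hmin, e2]
    have k25 : s₂.reg 25 = σ ⟨m, hm⟩ - 1 := by
      simp [hs₂, status, den, block, g0, g2, g7, gm, hmin, e2]
    have k0 : s₂.reg 0 = n := by rw [k 0 (by decide), g0]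
    have k2 : s₂.reg 2 = 1 := by rw [k 2 (by decide), g2]
    have k7 : s₂.reg 7 = s.reg 7 := by rw [k 7 (by decide), g7]
    have kF : FoundVertex G σ (m + 1) (s₂.reg 8) (s₂.reg 9) (s₂.reg 10) (s₂.reg 11) := by
      rwa [k 8 (by decide), k 9 (by decide), k 10 (by decide), k 11 (by decide)]
    by_cases h1 : σ ⟨m, hm⟩ = 1
    · have hb : findBody.den { s' with reg := Function.update s'.reg 13 m } =
          keep.den (scan.den s₂) := by
        simp [findBody, block, den, ← hs₂, k16, k25, h1]
      rw [hb]
      have hS := scan_spec (v := ⟨m, hm⟩) k0 k12 (by rw [km]; exact hs.matrix)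
        (by rw [km, k7]; exact hσ)
      have q : ∀ r, r ∉ scan.writes ++ keep.writes →
          (keep.den (scan.den s₂)).reg r = s₂.reg r := by
        intro r hr
        rw [List.mem_append, not_or] at hr
        rw [den_reg hr.2, den_reg hr.1]
      refine ⟨by rw [q 0 (by decide), k0], by rw [q 2 (by decide), k2],
        by rw [q 12 (by decide), k12], by rw [q 7 (by decide), k7],
        by rw [den_mem (by decide), den_mem (by decide), km], ?_⟩
      refine keep_spec hm (by rw [den_reg (by decide), k13]) (by rw [den_reg (by decide), k2])
        h1 (hc _ h1) hS ?_
      rwa [den_reg (c := scan) (by decide), den_reg (c := scan) (by decide),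
        den_reg (c := scan) (by decide), den_reg (c := scan) (by decide)]
    · have hb : findBody.den { s' with reg := Function.update s'.reg 13 m } = s₂ := by
        have := h2 ⟨m, hm⟩
        rcases (by omega : σ ⟨m, hm⟩ = 0 ∨ σ ⟨m, hm⟩ = 2) with h3 | h3
        · simp [findBody, block, den, ← hs₂, k16, h3]
        · simp [findBody, block, den, ← hs₂, k16, k25, h3]
      rw [hb]
      exact ⟨k0, k2, k12, k7, km, kF.of_forall hm fun h => absurd h h1⟩
  obtain ⟨s', hI, hs'⟩ := den_forn (i := 13) I (by simp [s₁, den, block, hs.size]) hI₁ step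
  have : find.den s = { s' with reg := Function.update s'.reg 13 0 } := hs'
  rw [this]
  simpa using hI.2.2.2.2.2

end Specs

end Programs

end MIST

namespace MIST

open Cmd

/-! ### Correctness of expansion, greedy completion, copying and counting -/

section Specs

open Classical

variable {n : ℕ} {G : SimpleGraph (Fin n)}

theorem HasMatrix.congr {mem mem' : ℕ → ℕ} (h : HasMatrix G mem)
    (he : ∀ a < n * n, mem' a = mem a) : HasMatrix G mem' := by
  intro i j
  rw [he, h i j]
  have h1 := i.isLt
  have h2 := j.isLt
  nlinarith

theorem HasBlock.congr {mem mem' : ℕ → ℕ} {p : ℕ} {σ : Fin n → ℕ} (h : HasBlock mem p σ)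
    (he : ∀ a, p ≤ a → a < p + n → mem' a = mem a) : HasBlock mem' p σ := fun v => by
  have := v.isLt
  rw [he _ (by omega) (by omega), h v]

/-- The case `u₁ = u₂` is allowed: it attaches a single vertex. Registers `3`, `15` and `25` are
excluded because the command overwrites them before its last reads. -/
theorem expand_spec {s : State} {σ : Fin n → ℕ} {x y : ℕ} {v u₁ u₂ : Fin n} (hs : Setup G s)
    (hb : n * n ≤ s.reg 7) (hσ : HasBlock s.mem (s.reg 7) σ) (hx : x ∉ [3, 15, 25])
    (hy : y ∉ [3, 15, 25]) (h9 : s.reg 9 = v) (hxu : s.reg x = u₁) (hyu : s.reg y = u₂)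
    (h1 : u₁ ≠ v) (h2 : u₂ ≠ v) :
    Setup G ((expand x y).den s) ∧
    HasBlock ((expand x y).den s).mem (s.reg 7) (grow σ v {u₁, u₂}) ∧
    ∀ a, a < s.reg 7 ∨ s.reg 7 + n ≤ a → ((expand x y).den s).mem a = s.mem a := by
  simp only [List.mem_cons, List.not_mem_nil, or_false, not_or] at hx hy
  have hm : ((expand x y).den s).mem = Function.update (Function.update
      (Function.update s.mem (s.reg 7 + v) 2) (s.reg 7 + u₁) 1) (s.reg 7 + u₂) 1 := by
    simp [expand, block, den, hs.size, hs.one, h9, hxu, hyu, hx, hy]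
  have hf : ∀ a, a < s.reg 7 ∨ s.reg 7 + n ≤ a → ((expand x y).den s).mem a = s.mem a := by
    intro a ha
    have := v.isLt
    have := u₁.isLt
    have := u₂.isLt
    rw [hm, Function.update_of_ne (by omega), Function.update_of_ne (by omega),
      Function.update_of_ne (by omega)]
  refine ⟨⟨?_, ?_, ?_, hs.matrix.congr fun a ha => hf a (by omega)⟩, ?_, hf⟩
  · rw [den_reg (by simp [expand, block, writes]), hs.size]
  · rw [den_reg (by simp [expand, block, writes]), hs.one]
  · rw [den_reg (by simp [expand, block, writes]), hs.base]
  · intro w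
    rw [hm]
    simp only [Function.update_apply, Nat.add_left_cancel_iff, grow, Finset.mem_insert,
      Finset.mem_singleton, ← Fin.ext_iff, hσ w]
    grind

/-- A round in which `find` fails is an idle greedy step, so `n` rounds always form a run of length
`n`. Only the cells below the working copy need protection. -/
theorem greedy_spec {s : State} {σ : Fin n → ℕ} (hG : IsSubcubic G) (hs : Setup G s)
    (hb : n * n ≤ s.reg 7) (hσ : HasBlock s.mem (s.reg 7) σ) (hT : ∃ T, PartialTree G σ T) :
    Setup G (greedy.den s) ∧
    (∃ τ, GreedyRun G n σ τ ∧ HasBlock (greedy.den s).mem (s.reg 7) τ) ∧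
    ∀ a, a < s.reg 7 → (greedy.den s).mem a = s.mem a := by
  let I : ℕ → State → Prop := fun m s' => m ≤ n ∧ Setup G s' ∧ s'.reg 7 = s.reg 7 ∧
    (∃ τ, GreedyRun G (n - m) σ τ ∧ HasBlock s'.mem (s.reg 7) τ) ∧
    ∀ a, a < s.reg 7 → s'.mem a = s.mem a
  have hI₁ : I n s := ⟨le_rfl, hs, rfl, ⟨σ, by rw [Nat.sub_self]; exact .zero σ, hσ⟩,
    fun _ _ => rfl⟩
  have step : ∀ m s', m < n → I (m + 1) s' →
      I m (greedyBody.den { s' with reg := Function.update s'.reg 20 m }) := by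
    rintro m s' hm ⟨-, hs', h7, ⟨τ, hr, hτ⟩, hf⟩
    have hnm : n - m = n - (m + 1) + 1 := by omega
    set s₁ : State := { s' with reg := Function.update s'.reg 20 m } with hs₁
    have g7 : s₁.reg 7 = s.reg 7 := by simp [hs₁, h7]
    have hs₁' : Setup G s₁ :=
      ⟨by simp [hs₁, hs'.size], by simp [hs₁, hs'.one], by simp [hs₁, hs'.base], hs'.matrix⟩
    obtain ⟨T, hT'⟩ := hr.exists_partialTree hT
    have hF := find_spec hs₁' (by rw [g7]; exact hτ) hT'.le_two fun v hv => hT'.card_outN_le hG hv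
    set s₂ := find.den s₁ with hs₂
    have k : ∀ r, r ∉ find.writes → s₂.reg r = s₁.reg r := fun r hr => den_reg hr s₁
    have km : s₂.mem = s'.mem := den_mem (by decide) s₁
    have hs₂' : Setup G s₂ := ⟨by rw [k 0 (by decide), hs₁'.size], by rw [k 2 (by decide), hs₁'.one],
      by rw [k 6 (by decide), hs₁'.base], by rw [km]; exact hs'.matrix⟩
    have k7 : s₂.reg 7 = s.reg 7 := by rw [k 7 (by decide), g7]
    have main : s₂.reg 8 ≠ 0 → ∀ v u₁ u₂ : Fin n, s₂.reg 9 = v → s₂.reg 10 = u₁ → s₂.reg 11 = u₂ →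
        τ v = 1 → outN G τ v = {u₁, u₂} → I m (greedyBody.den s₁) := by
      intro h8 v u₁ u₂ h9 h10 h11 hv hu
      have hb : greedyBody.den s₁ = (expand 10 11).den s₂ := by
        simp [greedyBody, block, den, ← hs₂, h8]
      have hne : ∀ u ∈ outN G τ v, u ≠ v := fun u hu => (mem_outN.1 hu).1.ne.symm
      obtain ⟨e1, e2, e3⟩ := expand_spec (x := 10) (y := 11) hs₂' (by omega)
        (by rw [km, k7]; exact hτ) (by decide) (by decide) h9 h10 h11
        (hne u₁ (by rw [hu]; simp)) (hne u₂ (by rw [hu]; simp))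
      rw [hb]
      refine ⟨hm.le, e1, by rw [den_reg (by decide), k7], ⟨_, ?_, by rw [← k7]; exact e2⟩,
        fun a ha => ?_⟩
      · rw [hnm]
        exact hr.succ (Or.inl ⟨v, hv, by rw [hu]; simp, by rw [hu]⟩)
      · rw [e3 a (by omega), km, hf a ha]
    rcases hF with ⟨h8, h⟩ | ⟨h8, v, u, h9, h10, h11, hv, hu⟩ | ⟨h8, ⟨v, u₁, u₂, h9, h10, h11, -, hv, hu⟩, -⟩
    · have hb : greedyBody.den s₁ = s₂ := by
        simp [greedyBody, block, den, ← hs₂, h8]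
      rw [hb]
      refine ⟨hm.le, hs₂', k7, ⟨τ, ?_, by rw [km]; exact hτ⟩, fun a ha => by rw [km, hf a ha]⟩
      rw [hnm]
      exact hr.succ (Or.inr ⟨fun v hv => h v (Nat.zero_le _) hv, rfl⟩)
    · exact main (by omega) v u u h9 h10 h11 hv (by simpa using hu)
    · exact main (by omega) v u₁ u₂ h9 h10 h11 hv hu
  obtain ⟨s', hI, hs'⟩ := den_forn (i := 20) I hs.size hI₁ step
  have he : greedy.den s = { s' with reg := Function.update s'.reg 20 0 } := hs'
  obtain ⟨-, h1, -, h2, h3⟩ := hI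
  rw [he]
  exact ⟨⟨by simp [h1.size], by simp [h1.one], by simp [h1.base], h1.matrix⟩, h2, h3⟩

theorem copyBlock_spec {s : State} {σ : Fin n → ℕ} (h0 : s.reg 0 = n)
    (hσ : HasBlock s.mem (s.reg 24) σ) (hd : s.reg 24 + n ≤ s.reg 7) :
    HasBlock (copyBlock.den s).mem (s.reg 7) σ ∧
    ∀ a, a < s.reg 7 ∨ s.reg 7 + n ≤ a → (copyBlock.den s).mem a = s.mem a := by
  let I : ℕ → State → Prop := fun m s' => s'.reg 0 = n ∧ s'.reg 7 = s.reg 7 ∧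
    s'.reg 24 = s.reg 24 ∧ (∀ v : Fin n, m ≤ v → s'.mem (s.reg 7 + v) = σ v) ∧
    ∀ a, a < s.reg 7 ∨ s.reg 7 + n ≤ a → s'.mem a = s.mem a
  have hI₁ : I n s := ⟨h0, rfl, rfl, fun v hv => by have := v.isLt; omega, fun _ _ => rfl⟩
  have step : ∀ m s', m < n → I (m + 1) s' →
      I m (copyBody.den { s' with reg := Function.update s'.reg 13 m }) := by
    rintro m s' hm ⟨g0, g7, g24, g, gf⟩
    have hmin : min m n = m := by omega
    have e : s'.mem (s.reg 24 + m) = σ ⟨m, hm⟩ := by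
      rw [gf _ (by omega)]; exact hσ ⟨m, hm⟩
    have hmem : (copyBody.den { s' with reg := Function.update s'.reg 13 m }).mem =
        Function.update s'.mem (s.reg 7 + m) (σ ⟨m, hm⟩) := by
      simp [copyBody, block, den, g0, g7, g24, hmin, e]
    refine ⟨?_, ?_, ?_, fun v hv => ?_, fun a ha => ?_⟩
    · simp [copyBody, block, den, g0]
    · simp [copyBody, block, den, g7]
    · simp [copyBody, block, den, g24]
    · rw [hmem]
      by_cases hv' : (v : ℕ) = m
      · have : v = ⟨m, hm⟩ := Fin.ext hv'
        subst this
        simp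
      · rw [Function.update_of_ne (by omega), g v (by omega)]
    · rw [hmem, Function.update_of_ne (by omega), gf a ha]
  obtain ⟨s', hI, hs'⟩ := den_forn (i := 13) I h0 hI₁ step
  have he : copyBlock.den s = { s' with reg := Function.update s'.reg 13 0 } := hs'
  rw [he]
  exact ⟨fun v => hI.2.2.2.1 v (Nat.zero_le _), hI.2.2.2.2⟩

theorem card_filter_step {S : Finset (Fin n)} {m : ℕ} (hm : m < n) :
    ({v ∈ S | m ≤ v.val} : Finset (Fin n)).card =
      ({v ∈ S | m + 1 ≤ v.val} : Finset (Fin n)).card + if ⟨m, hm⟩ ∈ S then 1 else 0 := by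
  have key : ∀ x : Fin n, m ≤ x → x ≠ ⟨m, hm⟩ → m + 1 ≤ x := by
    intro x h1 h2
    have : (x : ℕ) ≠ m := fun h => h2 (Fin.ext h)
    omega
  split_ifs with h
  · rw [← Finset.card_insert_of_notMem (a := (⟨m, hm⟩ : Fin n)) (by simp)]
    congr 1
    ext x
    simp only [Finset.mem_filter, Finset.mem_insert]
    constructor
    · rintro ⟨h1, h2⟩
      by_cases hx : x = ⟨m, hm⟩
      · exact Or.inl hx
      · exact Or.inr ⟨h1, key x h2 hx⟩
    · rintro (rfl | ⟨h1, h2⟩)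
      · exact ⟨h, le_rfl⟩
      · exact ⟨h1, by omega⟩
  · congr 1
    ext x
    simp only [Finset.mem_filter]
    exact and_congr_right fun h1 => ⟨fun h2 => key x h2 fun hx => h (hx ▸ h1), fun h2 => by omega⟩

theorem count_spec {s : State} {σ : Fin n → ℕ} (h0 : s.reg 0 = n) (h2 : s.reg 2 = 1)
    (hσ : HasBlock s.mem (s.reg 7) σ) (hle : ∀ v, σ v ≤ 2) :
    (count.den s).reg 21 = (closedSet σ).card ∧ (count.den s).reg 22 = (outSet σ).card := by
  let s₁ : State := (block [set 21 0, set 22 0]).den s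
  let I : ℕ → State → Prop := fun m s' => s'.reg 0 = n ∧ s'.reg 2 = 1 ∧ s'.reg 7 = s.reg 7 ∧
    s'.mem = s.mem ∧ s'.reg 21 = ({v ∈ closedSet σ | m ≤ v.val} : Finset (Fin n)).card ∧
    s'.reg 22 = ({v ∈ outSet σ | m ≤ v.val} : Finset (Fin n)).card
  have hI₁ : I n s₁ := by
    have hz : ∀ S : Finset (Fin n), ({v ∈ S | n ≤ v.val} : Finset (Fin n)).card = 0 := fun S =>
      Finset.card_eq_zero.2 (Finset.filter_eq_empty_iff.2 fun v _ => by have := v.isLt; omega)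
    refine ⟨by simp [s₁, block, den, h0], by simp [s₁, block, den, h2], by simp [s₁, block, den],
      rfl, ?_, ?_⟩ <;> rw [hz] <;> simp [s₁, block, den]
  have step : ∀ m s', m < n → I (m + 1) s' →
      I m (countBody.den { s' with reg := Function.update s'.reg 13 m }) := by
    rintro m s' hm ⟨g0, g2, g7, gm, gc, go⟩
    have hmin : min m n = m := by omega
    have hmin1 : min 1 n = 1 := by omega
    have e : s.mem (s.reg 7 + m) = σ ⟨m, hm⟩ := hσ ⟨m, hm⟩
    have := hle ⟨m, hm⟩
    change _ ∧ _ ∧ _ ∧ _ ∧ _ = _ ∧ _ = _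
    rw [card_filter_step hm, card_filter_step hm, ← gc, ← go]
    simp only [mem_closedSet, mem_outSet]
    rcases (by omega : σ ⟨m, hm⟩ = 0 ∨ σ ⟨m, hm⟩ = 1 ∨ σ ⟨m, hm⟩ = 2) with h | h | h <;>
      simp [countBody, block, den, g0, g2, g7, gm, hmin, hmin1, e, h]
  obtain ⟨s', hI, hs'⟩ := den_forn (i := 13) I (by simp [s₁, block, den, h0]) hI₁ step
  have he : count.den s = { s' with reg := Function.update s'.reg 13 0 } := hs'
  rw [he]
  obtain ⟨-, -, -, -, h3, h4⟩ := hI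
  simpa using And.intro h3 h4

theorem child_spec {s : State} {σ : Fin n → ℕ} {x y : ℕ} {v u₁ u₂ : Fin n} (hs : Setup G s)
    (hb : n * n ≤ s.reg 7) (hσ : HasBlock s.mem (s.reg 24) σ) (hd : s.reg 24 + n ≤ s.reg 7)
    (hx : x ∉ [3, 13, 15, 16, 25]) (hy : y ∉ [3, 13, 15, 16, 25]) (h9 : s.reg 9 = v)
    (hxu : s.reg x = u₁) (hyu : s.reg y = u₂) (h1 : u₁ ≠ v) (h2 : u₂ ≠ v) :
    Setup G ((child x y).den s) ∧
    HasBlock ((child x y).den s).mem (s.reg 7) (grow σ v {u₁, u₂}) ∧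
    ∀ a, a < s.reg 7 ∨ s.reg 7 + n ≤ a → ((child x y).den s).mem a = s.mem a := by
  simp only [List.mem_cons, List.not_mem_nil, or_false, not_or] at hx hy
  obtain ⟨c1, c2⟩ := copyBlock_spec hs.size hσ hd
  have k : ∀ r, r ∉ copyBlock.writes → (copyBlock.den s).reg r = s.reg r := fun r hr => den_reg hr s
  have k7 := k 7 (by decide)
  have hs' : Setup G (copyBlock.den s) := ⟨by rw [k 0 (by decide), hs.size],
    by rw [k 2 (by decide), hs.one], by rw [k 6 (by decide), hs.base],
    hs.matrix.congr fun a ha => c2 a (by omega)⟩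
  obtain ⟨e1, e2, e3⟩ := expand_spec (x := x) (y := y) hs' (by omega) (by rw [k7]; exact c1)
    (by simp [hx]) (by simp [hy]) (by rw [k 9 (by decide), h9])
    (by rw [k x (by simp [copyBlock, copyBody, block, writes, hx]), hxu])
    (by rw [k y (by simp [copyBlock, copyBody, block, writes, hy]), hyu]) h1 h2
  have he : (child x y).den s = (expand x y).den (copyBlock.den s) := rfl
  rw [k7] at e2 e3
  rw [he]
  exact ⟨e1, e2, fun a ha => by rw [e3 a ha, c2 a ha]⟩

end Specs

end MIST

namespace MIST

open Cmd

/-! ### The stack and one step of the search -/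

section Search

open Classical

variable {n k : ℕ} {G : SimpleGraph (Fin n)}

theorem Setup.congr {s s' : State} (h : Setup G s) (h0 : s'.reg 0 = s.reg 0)
    (h2 : s'.reg 2 = s.reg 2) (h6 : s'.reg 6 = s.reg 6) (hm : ∀ a < n * n, s'.mem a = s.mem a) :
    Setup G s' :=
  ⟨h0.trans h.size, h2.trans h.one, h6.trans h.base, h.matrix.congr hm⟩

/-- The memory holds the partial trees of the list `L` between the addresses `b` and `p`, the first
one at the end. -/
def HasStack (mem : ℕ → ℕ) (b : ℕ) : List (Fin n → ℕ) → ℕ → Prop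
  | [], p => p = b
  | σ :: L, p => ∃ q, p = q + n ∧ HasBlock mem q σ ∧ HasStack mem b L q

theorem HasStack.le {mem : ℕ → ℕ} {b : ℕ} {L : List (Fin n → ℕ)} {p : ℕ}
    (h : HasStack mem b L p) : b ≤ p := by
  induction L generalizing p with
  | nil => exact h.ge
  | cons σ L ih =>
    obtain ⟨q, rfl, -, h⟩ := h
    exact (ih h).trans (Nat.le_add_right _ _)

theorem HasStack.congr {mem mem' : ℕ → ℕ} {b : ℕ} {L : List (Fin n → ℕ)} {p : ℕ}
    (h : HasStack mem b L p) (he : ∀ a < p, mem' a = mem a) : HasStack mem' b L p := by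
  induction L generalizing p with
  | nil => exact h
  | cons σ L ih =>
    obtain ⟨q, rfl, h1, h⟩ := h
    exact ⟨q, rfl, h1.congr fun a _ h2 => he a h2, ih h fun a ha => he a (by omega)⟩

/-- The invariant of the search. -/
structure SearchInv (G : SimpleGraph (Fin n)) (k : ℕ) (s : State) (L : List (Fin n → ℕ)) :
    Prop where
  setup : Setup G s
  target : s.reg 1 = k
  stack : HasStack s.mem (n * n) L (s.reg 5)
  valid : ∀ σ ∈ L, ∃ T, PartialTree G σ T
  sound : s.reg 23 = 0 ∨ s.reg 23 = 1 ∧ HasInternalSpanningTree G k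
  complete : HasInternalSpanningTree G k → s.reg 23 = 1 ∨ ∃ σ ∈ L, Extendable G k σ

/-- The situation after the examination of the partial tree `σ` on top of the stack. -/
structure Examined (G : SimpleGraph (Fin n)) (k : ℕ) (s : State) (σ : Fin n → ℕ)
    (L : List (Fin n → ℕ)) (τ : Fin n → ℕ) : Prop where
  setup : Setup G s
  target : s.reg 1 = k
  top : s.reg 5 = s.reg 24 + n
  block : HasBlock s.mem (s.reg 24) σ
  stack : HasStack s.mem (n * n) L (s.reg 24)
  run : GreedyRun G n σ τ
  closed : s.reg 21 = (closedSet τ).card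
  out : s.reg 22 = (outSet τ).card
  valid : ∀ σ' ∈ σ :: L, ∃ T, PartialTree G σ' T
  sound : s.reg 23 = 0 ∨ s.reg 23 = 1 ∧ HasInternalSpanningTree G k
  complete : HasInternalSpanningTree G k → s.reg 23 = 1 ∨ ∃ σ' ∈ σ :: L, Extendable G k σ'

/-- The greedy completion runs on a copy just above the stack, so the stack, `σ` included, survives.
-/
theorem examine_spec (hG : IsSubcubic G) {s : State} {σ : Fin n → ℕ} {L : List (Fin n → ℕ)}
    (h : SearchInv G k s (σ :: L)) : ∃ τ, Examined G k (examine.den s) σ L τ := by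
  obtain ⟨q, hq, hσ, hL⟩ := h.stack
  have hnq := hL.le
  set s₁ := (Cmd.block [sub 24 5 0, copy 7 5]).den s with hs₁
  have m1 : s₁.mem = s.mem := rfl
  have a24 : s₁.reg 24 = q := by simp [hs₁, Cmd.block, den, hq, h.setup.size]
  have a7 : s₁.reg 7 = q + n := by simp [hs₁, Cmd.block, den, hq]
  have h₁ : Setup G s₁ := h.setup.congr (by simp [hs₁, Cmd.block, den])
    (by simp [hs₁, Cmd.block, den]) (by simp [hs₁, Cmd.block, den]) fun _ _ => rfl
  obtain ⟨c1, c2⟩ := copyBlock_spec (σ := σ) h₁.size (by rw [m1, a24]; exact hσ) (by omega)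
  set s₂ := copyBlock.den s₁ with hs₂
  rw [a7] at c1 c2
  have k2 : ∀ r, r ∉ copyBlock.writes → s₂.reg r = s₁.reg r := fun r hr => den_reg hr s₁
  have h₂ : Setup G s₂ := h₁.congr (k2 0 (by decide)) (k2 2 (by decide)) (k2 6 (by decide))
    fun a ha => c2 a (by omega)
  have b7 : s₂.reg 7 = q + n := by rw [k2 7 (by decide), a7]
  have hT := h.valid σ (by simp)
  obtain ⟨h₃, ⟨τ, hr, hτ⟩, c3⟩ := greedy_spec hG h₂ (by omega) (by rw [b7]; exact c1) hT
  set s₃ := greedy.den s₂ with hs₃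
  rw [b7] at hτ c3
  have c7 : s₃.reg 7 = q + n := by rw [hs₃, den_reg (by decide), b7]
  obtain ⟨T, hTτ⟩ := hr.exists_partialTree hT
  obtain ⟨d1, d2⟩ := count_spec (σ := τ) h₃.size h₃.one (by rw [c7]; exact hτ) hTτ.le_two
  have he : examine.den s = count.den s₃ := rfl
  have k : ∀ r, r ∉ examine.writes → (count.den s₃).reg r = s.reg r :=
    fun r hr => he ▸ den_reg hr s
  have km : ∀ a, a < q + n → (count.den s₃).mem a = s.mem a := by
    intro a ha
    rw [den_mem (by decide), c3 a ha, c2 a (Or.inl ha), m1]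
  have d24 : (count.den s₃).reg 24 = q := by
    rw [den_reg (by decide), hs₃, den_reg (by decide), k2 24 (by decide), a24]
  rw [he]
  refine ⟨τ, ?_, ?_, ?_, ?_, ?_, hr, d1, d2, h.valid, ?_, ?_⟩
  · exact h.setup.congr (k 0 (by decide)) (k 2 (by decide)) (k 6 (by decide))
      fun a ha => km a (by omega)
  · rw [k 1 (by decide), h.target]
  · rw [d24, k 5 (by decide), hq]
  · rw [d24]; exact hσ.congr fun a _ ha => km a ha
  · rw [d24]; exact hL.congr fun a ha => km a (by omega)
  · rw [k 23 (by decide)]; exact h.sound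
  · rw [k 23 (by decide)]; exact h.complete

/-- The sum of the potentials of a list of partial trees. -/
noncomputable def total (G : SimpleGraph (Fin n)) (k : ℕ) (L : List (Fin n → ℕ)) : ℝ :=
  (L.map (potential G k)).sum

theorem total_cons (σ : Fin n → ℕ) (L : List (Fin n → ℕ)) :
    total G k (σ :: L) = potential G k σ + total G k L := by simp [total]

theorem total_nonneg (hG : IsSubcubic G) {L : List (Fin n → ℕ)}
    (h : ∀ σ ∈ L, ∃ T, PartialTree G σ T) : 0 ≤ total G k L := by
  refine List.sum_nonneg fun x hx => ?_
  obtain ⟨σ, hσ, rfl⟩ := List.mem_map.1 hx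
  linarith [one_le_potential (k := k) hG (h σ hσ)]

/-- Discarding a partial tree that is not extendable keeps completeness, and its potential, at least
1, pays for the step. -/
theorem Examined.drop {s : State} {σ τ : Fin n → ℕ} {L : List (Fin n → ℕ)}
    (h : Examined G k s σ L τ) (hG : IsSubcubic G) (hn : ¬ Extendable G k σ) {s' : State}
    (h0 : s'.reg 0 = s.reg 0) (h1 : s'.reg 1 = s.reg 1) (h2 : s'.reg 2 = s.reg 2)
    (h5 : s'.reg 5 = s.reg 24) (h6 : s'.reg 6 = s.reg 6) (h23 : s'.reg 23 = s.reg 23)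
    (hm : s'.mem = s.mem) : SearchInv G k s' L ∧ total G k L + 1 ≤ total G k (σ :: L) := by
  refine ⟨⟨h.setup.congr h0 h2 h6 fun _ _ => by rw [hm], by rw [h1, h.target], ?_,
    fun σ' hσ' => h.valid σ' (by simp [hσ']), by rw [h23]; exact h.sound, fun hh => ?_⟩, ?_⟩
  · rw [h5, hm]; exact h.stack
  · rw [h23]
    rcases h.complete hh with hh | ⟨σ', hσ', hh⟩
    · exact Or.inl hh
    · rcases List.mem_cons.1 hσ' with rfl | hσ'
      · exact absurd hh hn
      · exact Or.inr ⟨σ', hσ', hh⟩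
  · rw [total_cons]
    linarith [one_le_potential (k := k) hG (h.valid σ (by simp))]

theorem GreedyRun.of_stuck {σ : Fin n → ℕ} (h : ∀ v, σ v = 1 → outN G σ v = ∅) (m : ℕ) :
    GreedyRun G m σ σ := by
  induction m with
  | zero => exact .zero σ
  | succ m ih => exact ih.succ (Or.inr ⟨h, rfl⟩)

theorem eq_of_subset_pair {V : Type*} [DecidableEq V] {S : Finset V} {a b : V} (h : S ⊆ {a, b})
    (hS : S.Nonempty) : S = {a} ∨ S = {b} ∨ S = {a, b} := by
  obtain ⟨x, hx⟩ := hS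
  have hs : ∀ y ∈ S, y = a ∨ y = b := fun y hy => by simpa using h hy
  by_cases ha : a ∈ S
  · by_cases hb : b ∈ S
    · exact Or.inr (Or.inr (Finset.Subset.antisymm h (by simp [Finset.insert_subset_iff, ha, hb])))
    · exact Or.inl (Finset.eq_singleton_iff_unique_mem.2 ⟨ha, fun y hy =>
        (hs y hy).resolve_right fun h => hb (h ▸ hy)⟩)
  · have hy : ∀ y ∈ S, y = b := fun y hy => (hs y hy).resolve_left fun h => ha (h ▸ hy)
    exact Or.inr (Or.inl (Finset.eq_singleton_iff_unique_mem.2 ⟨hy x hx ▸ hx, hy⟩))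

/-- The outcomes are: the completion does not span (drop); it is a solution (stop); nothing can be
expanded (drop); a free vertex gives one descendant; a vertex with two outside neighbours gives
three. -/
theorem advance_spec (hG : IsSubcubic G) {s : State} {σ τ : Fin n → ℕ} {L : List (Fin n → ℕ)}
    (h : Examined G k s σ L τ) : ∃ L', SearchInv G k (advance.den s) L' ∧
      total G k L' + 1 ≤ total G k (σ :: L) := by
  obtain ⟨T, hT⟩ := h.valid σ (by simp)
  have hcard : Fintype.card (Fin n) = n := Fintype.card_fin n
  have hnq := h.stack.le
  by_cases h22 : s.reg 22 = 0
  swap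
  · have he : advance.den s = (copy 5 24).den s := by simp [advance, den, h22]
    rw [he]
    refine ⟨L, h.drop hG ?_ ?_ ?_ ?_ ?_ ?_ ?_ rfl⟩
    · intro hE
      rw [h.out, (hcard.symm ▸ h.run : GreedyRun G (Fintype.card (Fin n)) σ τ).outSet_eq_empty hE]
        at h22
      simp at h22
    all_goals simp [den]
  have h0 : outSet τ = ∅ := Finset.card_eq_zero.1 (h.out ▸ h22)
  by_cases hk : k ≤ (closedSet τ).card
  · obtain ⟨T', hT'⟩ := h.run.exists_partialTree ⟨T, hT⟩
    have hI := hT'.hasInternalSpanningTree h0 hk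
    have he : advance.den s = (Cmd.block [sub 16 1 21, set 23 1, copy 5 6]).den s := by
      simp [advance, den, Cmd.block, h22, h.target, h.closed, hk]
    rw [he]
    -- A solution empties the stack, which ends the main loop; register `23` keeps the verdict.
    refine ⟨[], ⟨h.setup.congr ?_ ?_ ?_ fun _ _ => rfl, ?_, ?_, by simp, Or.inr ⟨?_, hI⟩,
      fun _ => Or.inl ?_⟩, ?_⟩
    · simp [den, Cmd.block]
    · simp [den, Cmd.block]
    · simp [den, Cmd.block]
    · simp [den, Cmd.block, h.target]
    · simp [HasStack, den, Cmd.block, h.setup.base]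
    · simp [den, Cmd.block]
    · simp [den, Cmd.block]
    · rw [total_cons]
      have := total_nonneg (k := k) hG fun σ' hσ' => h.valid σ' (List.mem_cons_of_mem _ hσ')
      have := one_le_potential (k := k) hG ⟨T, hT⟩
      simp only [total, List.map_nil, List.sum_nil]
      simp only [total] at *
      linarith
  push Not at hk
  have hlive : Live G k σ := ⟨τ, hcard.symm ▸ h.run, h0, hk⟩
  set s₁ := (Cmd.block [sub 16 1 21, copy 7 24]).den s with hs₁
  have a7 : s₁.reg 7 = s.reg 24 := by simp [hs₁, Cmd.block, den]
  have h₁ : Setup G s₁ := h.setup.congr (by simp [hs₁, Cmd.block, den])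
    (by simp [hs₁, Cmd.block, den]) (by simp [hs₁, Cmd.block, den]) fun _ _ => rfl
  have m1 : s₁.mem = s.mem := rfl
  have hF := find_spec h₁ (by rw [a7]; exact h.block) hT.le_two fun v hv => hT.card_outN_le hG hv
  set s₂ := find.den s₁ with hs₂
  have k1 : ∀ r, r ∉ [7, 16] → s₁.reg r = s.reg r := by
    intro r hr
    rw [hs₁, den_reg]
    simpa [Cmd.block, writes, and_comm] using hr
  have k2' : ∀ r, r ∉ find.writes → s₂.reg r = s₁.reg r := fun r hr => den_reg hr s₁
  have k2 : ∀ r, r ∉ 7 :: find.writes → s₂.reg r = s.reg r := by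
    intro r hr
    rw [List.mem_cons, not_or] at hr
    rw [k2' r hr.2, k1]
    have : (16 : ℕ) ∈ find.writes := by decide
    simp only [List.mem_cons, List.not_mem_nil, or_false, not_or]
    exact ⟨hr.1, fun h => hr.2 (h ▸ this)⟩
  have m2 : s₂.mem = s.mem := by rw [hs₂, den_mem (by decide), m1]
  have b7 : s₂.reg 7 = s.reg 24 := by rw [k2' 7 (by decide), a7]
  have h₂ : Setup G s₂ := h.setup.congr (k2 0 (by decide)) (k2 2 (by decide)) (k2 6 (by decide))
    fun a _ => by rw [m2]
  have he : advance.den s = (Cmd.ite 8 branch (copy 5 24)).den s₂ := by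
    have : k - (closedSet τ).card ≠ 0 := by omega
    have e : (find.den s₁) = s₂ := rfl
    rw [← e, hs₁]
    simp [advance, den, Cmd.block, h22, h.target, h.closed, this]
  rw [he]
  rcases hF with ⟨h8, hF⟩ | ⟨h8, v, u, h9, h10, h11, hv, hu⟩ |
    ⟨h8, ⟨v, u₁, u₂, h9, h10, h11, hne, hv, hu⟩, hF⟩
  · have he' : (Cmd.ite 8 branch (copy 5 24)).den s₂ = (copy 5 24).den s₂ := by simp [den, h8]
    rw [he']
    refine ⟨L, h.drop hG ?_ ?_ ?_ ?_ ?_ ?_ ?_ m2⟩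
    -- Here `σ` is its own greedy completion. Were it extendable, it would span with `k` closed
    -- vertices; but it has no more of them than `τ`, which has fewer than `k`.
    · intro hE
      have hr : GreedyRun G (Fintype.card (Fin n)) σ σ :=
        .of_stuck (fun v hv => hF v (Nat.zero_le _) hv) _
      have h1 := hE.le_card_closedSet (hr.outSet_eq_empty hE)
      have h2 := h.run.card_le hG ⟨T, hT⟩
      rw [h0, Finset.card_empty] at h2
      omega
    all_goals simp [den, k2 _ (by decide : 0 ∉ 7 :: find.writes),
      k2 _ (by decide : 1 ∉ 7 :: find.writes), k2 _ (by decide : 2 ∉ 7 :: find.writes),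
      k2 _ (by decide : 24 ∉ 7 :: find.writes), k2 _ (by decide : 6 ∉ 7 :: find.writes),
      k2 _ (by decide : 23 ∉ 7 :: find.writes)]
  · have huv : u ≠ v := by
      have : u ∈ outN G σ v := by rw [hu]; simp
      exact (mem_outN.1 this).1.ne.symm
    set s₃ := (sub 16 8 2).den s₂ with hs₃
    have he' : (Cmd.ite 8 branch (copy 5 24)).den s₂ = (expand 10 10).den s₃ := by
      simp [branch, den, Cmd.block, h8, h₂.one, hs₃]
    have k3 : ∀ r, r ∉ [16] → s₃.reg r = s₂.reg r := fun r hr => by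
      rw [hs₃, den_reg hr]
    have h₃ : Setup G s₃ := h₂.congr (k3 0 (by decide)) (k3 2 (by decide)) (k3 6 (by decide))
      fun _ _ => rfl
    have c7 : s₃.reg 7 = s.reg 24 := by rw [k3 7 (by decide), b7]
    have m3 : s₃.mem = s.mem := m2
    obtain ⟨e1, e2, e3⟩ := expand_spec (x := 10) (y := 10) (σ := σ) h₃ (by omega)
      (by rw [c7, m3]; exact h.block) (by decide) (by decide) (by rw [k3 9 (by decide), h9])
      (by rw [k3 10 (by decide), h10]) (by rw [k3 10 (by decide), h10]) huv huv
    rw [c7, Finset.pair_eq_singleton] at e2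
    rw [c7, m3] at e3
    rw [he']
    have kk : ∀ r, r ∉ (expand 10 10).writes → r ∉ [16] → r ∉ 7 :: find.writes →
        ((expand 10 10).den s₃).reg r = s.reg r := fun r h1 h2 h3 => by
      rw [den_reg h1, k3 r h2, k2 r h3]
    refine ⟨grow σ v {u} :: L, ⟨e1, ?_, ?_, ?_, ?_, ?_⟩, ?_⟩
    · rw [kk 1 (by decide) (by decide) (by decide), h.target]
    · rw [kk 5 (by decide) (by decide) (by decide), h.top]
      exact ⟨_, rfl, e2, h.stack.congr fun a ha => e3 a (Or.inl ha)⟩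
    · intro σ' hσ'
      rcases List.mem_cons.1 hσ' with rfl | hσ'
      · exact ⟨_, hT.grow hv hu.ge (by simp)⟩
      · exact h.valid σ' (by simp [hσ'])
    · rw [kk 23 (by decide) (by decide) (by decide)]; exact h.sound
    · rw [kk 23 (by decide) (by decide) (by decide)]
      intro hh
      rcases h.complete hh with hh | ⟨σ', hσ', hh⟩
      · exact Or.inl hh
      · rcases List.mem_cons.1 hσ' with rfl | hσ'
        · obtain ⟨S, hS, hSne, hE⟩ := hh.exists_grow hv (by rw [hu]; simp)
          rw [hu] at hS
          rw [hSne.subset_singleton_iff.1 hS] at hE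
          exact Or.inr ⟨_, by simp, hE⟩
        · exact Or.inr ⟨σ', by simp [hσ'], hh⟩
    · rw [total_cons, total_cons]
      linarith [potential_grow_free hG ⟨T, hT⟩ hlive hv hu]
  · have hfree : ¬ HasFree G σ := fun ⟨w, hw, hc⟩ => hF w (Nat.zero_le _) hw hc
    have hm : ∀ u ∈ outN G σ v, u ≠ v := fun u hu => (mem_outN.1 hu).1.ne.symm
    have hv1 : u₁ ≠ v := hm u₁ (by rw [hu]; simp)
    have hv2 : u₂ ≠ v := hm u₂ (by rw [hu]; simp)
    set s₃ := (Cmd.block [sub 16 8 2, copy 7 5]).den s₂ with hs₃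
    set s₄ := (child 10 10).den s₃ with hs₄
    set s₅ := (add 7 5 0).den s₄ with hs₅
    set s₆ := (child 11 11).den s₅ with hs₆
    set s₇ := (copy 7 24).den s₆ with hs₇
    set s₈ := (expand 10 11).den s₇ with hs₈
    set s₉ := (Cmd.block [add 5 5 0, add 5 5 0]).den s₈ with hs₉
    have he' : (Cmd.ite 8 branch (copy 5 24)).den s₂ = s₉ := by
      rw [hs₉, hs₈, hs₇, hs₆, hs₅, hs₄, hs₃]
      simp [branch, spawnFst, spawnSnd, spawnTop, den, Cmd.block, h8, h₂.one]
    have k3 : ∀ r, r ∉ [16, 7] → s₃.reg r = s₂.reg r := fun r hr => by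
      rw [hs₃, den_reg hr]
    have k4 : ∀ r, r ∉ (child 10 10).writes → s₄.reg r = s₃.reg r := fun r hr => den_reg hr _
    have k5 : ∀ r, r ∉ [3, 7] → s₅.reg r = s₄.reg r := fun r hr => by rw [hs₅, den_reg hr]
    have k6 : ∀ r, r ∉ (child 11 11).writes → s₆.reg r = s₅.reg r := fun r hr => den_reg hr _
    have k7 : ∀ r, r ∉ [7] → s₇.reg r = s₆.reg r := fun r hr => by rw [hs₇, den_reg hr]
    have k8 : ∀ r, r ∉ (expand 10 11).writes → s₈.reg r = s₇.reg r := fun r hr => den_reg hr _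
    have k9 : ∀ r, r ∉ [3, 5, 3, 5] → s₉.reg r = s₈.reg r := fun r hr => by
      rw [hs₉, den_reg hr]
    have r5 : s₂.reg 5 = s.reg 24 + n := by rw [k2 5 (by decide), h.top]
    have r24 : s₂.reg 24 = s.reg 24 := k2 24 (by decide)
    -- the first descendant
    have p3 : s₃.reg 7 = s.reg 24 + n := by simp [hs₃, den, Cmd.block, r5]
    have m3 : s₃.mem = s.mem := m2
    have h₃ : Setup G s₃ := h₂.congr (k3 0 (by decide)) (k3 2 (by decide)) (k3 6 (by decide))
      fun _ _ => rfl
    have t3 : s₃.reg 24 = s.reg 24 := by rw [k3 24 (by decide), r24]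
    obtain ⟨h₄, x4, f4⟩ := child_spec (x := 10) (y := 10) (σ := σ) h₃ (by omega)
      (by rw [t3, m3]; exact h.block) (by omega) (by decide) (by decide)
      (by rw [k3 9 (by decide), h9]) (by rw [k3 10 (by decide), h10])
      (by rw [k3 10 (by decide), h10]) hv1 hv1
    rw [← hs₄, p3, m3] at f4
    rw [← hs₄, p3, Finset.pair_eq_singleton] at x4
    -- the second descendant
    have k45 : ∀ r, r ∉ (child 10 10).writes → r ∉ [3, 7] → s₅.reg r = s₃.reg r :=
      fun r h1 h2 => by rw [k5 r h2, k4 r h1]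
    have p5 : s₅.reg 7 = s.reg 24 + n + n := by
      have h1 : s₄.reg 0 = n := h₄.size
      have h2 : s₄.reg 5 = s.reg 24 + n := by rw [k4 5 (by decide), k3 5 (by decide), r5]
      simp [hs₅, den, h1, h2]
    have m5 : s₅.mem = s₄.mem := rfl
    have h₅ : Setup G s₅ := h₄.congr (k5 0 (by decide)) (k5 2 (by decide)) (k5 6 (by decide))
      fun _ _ => rfl
    have t5 : s₅.reg 24 = s.reg 24 := by rw [k45 24 (by decide) (by decide), t3]
    obtain ⟨h₆, x6, f6⟩ := child_spec (x := 11) (y := 11) (σ := σ) h₅ (by omega)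
      (by rw [t5, m5]; exact h.block.congr fun a _ ha => f4 a (by omega)) (by omega)
      (by decide) (by decide)
      (by rw [k45 9 (by decide) (by decide), k3 9 (by decide), h9])
      (by rw [k45 11 (by decide) (by decide), k3 11 (by decide), h11])
      (by rw [k45 11 (by decide) (by decide), k3 11 (by decide), h11]) hv2 hv2
    rw [← hs₆, p5, m5] at f6
    rw [← hs₆, p5, Finset.pair_eq_singleton] at x6
    -- the third descendant
    have k67 : ∀ r, r ∉ (child 11 11).writes → r ∉ (child 10 10).writes → r ∉ [3, 7] →
        r ∉ [16, 7] → s₇.reg r = s₂.reg r := fun r h1 h2 h3 h4 => by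
      rw [k7 r (fun h => h3 (by simp_all)), k6 r h1, k45 r h2 h3, k3 r h4]
    have t6 : s₆.reg 24 = s.reg 24 := by rw [k6 24 (by decide), t5]
    have p7 : s₇.reg 7 = s.reg 24 := by simp [hs₇, den, t6]
    have m7 : s₇.mem = s₆.mem := rfl
    have h₇ : Setup G s₇ := h₆.congr (k7 0 (by decide)) (k7 2 (by decide)) (k7 6 (by decide))
      fun _ _ => rfl
    -- This one is made in place and therefore last, as the other two were copied from the same
    -- block.
    obtain ⟨h₈, x8, f8⟩ := expand_spec (x := 10) (y := 11) (σ := σ) h₇ (by omega)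
      (by rw [p7, m7]
          exact h.block.congr fun a _ ha => by rw [f6 a (by omega), f4 a (by omega)])
      (by decide) (by decide)
      (by rw [k67 9 (by decide) (by decide) (by decide) (by decide), h9])
      (by rw [k67 10 (by decide) (by decide) (by decide) (by decide), h10])
      (by rw [k67 11 (by decide) (by decide) (by decide) (by decide), h11]) hv1 hv2
    rw [← hs₈, p7, m7] at f8
    rw [← hs₈, p7] at x8
    have p9 : s₉.reg 5 = s.reg 24 + n + n + n := by
      have h1 : s₈.reg 0 = n := h₈.size
      have h2 : s₈.reg 5 = s.reg 24 + n := by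
        rw [k8 5 (by decide), k67 5 (by decide) (by decide) (by decide) (by decide), r5]
      simp [hs₉, Cmd.block, den, h1, h2]
    have h₉ : Setup G s₉ := h₈.congr (k9 0 (by decide)) (k9 2 (by decide)) (k9 6 (by decide))
      fun _ _ => rfl
    have m9 : s₉.mem = s₈.mem := rfl
    rw [he']
    have kk : ∀ r, r ∉ (expand 10 11).writes → r ∉ (child 11 11).writes →
        r ∉ (child 10 10).writes → r ∉ [3, 7] → r ∉ [16, 7] → r ∉ [3, 5, 3, 5] →
        s₉.reg r = s₂.reg r := fun r h1 h2 h3 h4 h5 h6 => by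
      rw [k9 r h6, k8 r h1, k67 r h2 h3 h4 h5]
    have r1 : s₉.reg 1 = k := by
      rw [kk 1 (by decide) (by decide) (by decide) (by decide) (by decide) (by decide),
        k2 1 (by decide), h.target]
    have r23 : s₉.reg 23 = s.reg 23 := by
      rw [kk 23 (by decide) (by decide) (by decide) (by decide) (by decide) (by decide),
        k2 23 (by decide)]
    refine ⟨grow σ v {u₂} :: grow σ v {u₁} :: grow σ v {u₁, u₂} :: L,
      ⟨h₉, r1, ?_, ?_, by rw [r23]; exact h.sound, ?_⟩, ?_⟩
    · rw [p9, m9]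
      refine ⟨_, rfl, ?_, _, rfl, ?_, _, rfl, x8, ?_⟩
      · exact x6.congr fun a _ _ => f8 a (by omega)
      · exact x4.congr fun a _ _ => by rw [f8 a (by omega), f6 a (by omega)]
      · exact h.stack.congr fun a _ => by rw [f8 a (by omega), f6 a (by omega), f4 a (by omega)]
    · intro σ' hσ'
      simp only [List.mem_cons] at hσ'
      rcases hσ' with rfl | rfl | rfl | hσ'
      · exact ⟨_, hT.grow hv (by rw [hu]; simp) (by simp)⟩
      · exact ⟨_, hT.grow hv (by rw [hu]; simp) (by simp)⟩
      · exact ⟨_, hT.grow hv hu.ge (by simp)⟩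
      · exact h.valid σ' (by simp [hσ'])
    · rw [r23]
      intro hh
      rcases h.complete hh with hh | ⟨σ', hσ', hh⟩
      · exact Or.inl hh
      · rcases List.mem_cons.1 hσ' with rfl | hσ'
        · obtain ⟨S, hS, hSne, hE⟩ := hh.exists_grow hv (by rw [hu]; simp)
          rcases eq_of_subset_pair (hu ▸ hS) hSne with rfl | rfl | rfl
          · exact Or.inr ⟨_, by simp, hE⟩
          · exact Or.inr ⟨_, by simp, hE⟩
          · exact Or.inr ⟨_, by simp, hE⟩
        · exact Or.inr ⟨σ', by simp [hσ'], hh⟩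
    · simp only [total_cons]
      have hp : potential G k (grow σ v {u₁, u₂}) + potential G k (grow σ v {u₁}) +
          potential G k (grow σ v {u₂}) + 1 ≤ potential G k σ := by
        convert potential_branch hT hG hlive hv (u₁ := u₁) (u₂ := u₂) ?_ hne hfree
        convert hu
      linarith

theorem body_spec (hG : IsSubcubic G) {s : State} {σ : Fin n → ℕ} {L : List (Fin n → ℕ)}
    (h : SearchInv G k s (σ :: L)) : ∃ L', SearchInv G k (body.den s) L' ∧
      total G k L' + 1 ≤ total G k (σ :: L) ∧
      (body.den s).reg 4 = (body.den s).reg 5 - (body.den s).reg 6 := by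
  obtain ⟨τ, hE⟩ := examine_spec hG h
  obtain ⟨L', hI, ht⟩ := advance_spec hG hE
  have he : body.den s = (sub 4 5 6).den (advance.den (examine.den s)) := rfl
  set s' := advance.den (examine.den s)
  have k4 : ∀ r, r ∉ [4] → ((sub 4 5 6).den s').reg r = s'.reg r := fun r hr => den_reg hr s'
  rw [he]
  refine ⟨L', ⟨hI.setup.congr (k4 0 (by decide)) (k4 2 (by decide)) (k4 6 (by decide))
    fun _ _ => rfl, by rw [k4 1 (by decide), hI.target],
    by rw [k4 5 (by decide)]; exact hI.stack, hI.valid, by rw [k4 23 (by decide)]; exact hI.sound,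
    by rw [k4 23 (by decide)]; exact hI.complete⟩, ht, ?_⟩
  simp [den]

end Search

end MIST

namespace MIST

open Cmd

/-! ### Initialization, the main loop and the final program -/

section Main

open Classical SimpleGraph

variable {n k : ℕ} {G : SimpleGraph (Fin n)}

/-- The partial tree that consists of the edge from `r` to `v`. -/
noncomputable def edgeTree (r v : Fin n) : Fin n → ℕ := fun w => if w = r ∨ w = v then 1 else 0

theorem edgeTree_ne_zero {r v w : Fin n} : edgeTree r v w ≠ 0 ↔ w = r ∨ w = v := by
  unfold edgeTree; split_ifs <;> simp_all

theorem partialTree_edgeTree {r v : Fin n} (h : G.Adj r v) :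
    PartialTree G (edgeTree r v) (star r {v}) := by
  have hrv : r ≠ v := h.ne
  have hadj : (star r {v}).Adj r v := ⟨hrv, Or.inl ⟨rfl, by simp⟩⟩
  have hle : ∀ w, edgeTree r v w ≤ 1 := fun w => by unfold edgeTree; split_ifs <;> simp
  refine ⟨?_, ?_, ?_, ?_, ?_, ?_, fun w => (hle w).trans (by norm_num),
    ⟨r, edgeTree_ne_zero.2 (Or.inl rfl)⟩⟩
  · rintro a b ⟨-, ⟨rfl, hb⟩ | ⟨rfl, hb⟩⟩ <;> rw [Finset.mem_singleton] at hb <;> subst hb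
    · exact h
    · exact h.symm
  · have := isAcyclic_sup_star (T := (⊥ : SimpleGraph (Fin n))) isAcyclic_bot (v := r) {v}
      (by simpa using hrv) (fun _ _ _ h => h)
    rwa [bot_sup_eq] at this
  · rintro a b ⟨-, ⟨rfl, -⟩ | ⟨-, ha⟩⟩
    · exact edgeTree_ne_zero.2 (Or.inl rfl)
    · exact edgeTree_ne_zero.2 (Or.inr (by simpa using ha))
  · intro a b ha hb
    rcases edgeTree_ne_zero.1 ha with rfl | rfl <;> rcases edgeTree_ne_zero.1 hb with rfl | rfl
    · exact Reachable.refl _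
    · exact hadj.reachable
    · exact hadj.symm.reachable
    · exact Reachable.refl _
  · intro w hw
    rcases edgeTree_ne_zero.1 (by omega : edgeTree r v w ≠ 0) with rfl | rfl
    · refine ⟨v, hadj, ?_⟩
      rintro w' ⟨-, ⟨-, h⟩ | ⟨-, h⟩⟩
      · simpa using h
      · exact absurd (by simpa using h) hrv
    · refine ⟨r, hadj.symm, ?_⟩
      rintro w' ⟨-, ⟨h, -⟩ | ⟨h, -⟩⟩
      · exact absurd h.symm hrv
      · exact h
  · intro w hw
    have := hle w
    omega

/-- With two or more vertices a spanning tree has an edge at `r`, and any such edge can be the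
start; no vertex is closed yet, so the condition on closed vertices is void. -/
theorem exists_extendable_edgeTree (hn : 2 ≤ n) (r : Fin n) (h : HasInternalSpanningTree G k) :
    ∃ v, G.Adj r v ∧ Extendable G k (edgeTree r v) := by
  obtain ⟨T, hT, hk⟩ := h
  have : Nontrivial (Fin n) := Fin.nontrivial_iff_two_le.2 hn
  obtain ⟨v, hv⟩ := hT.2.connected.preconnected.exists_adj_of_nontrivial r
  refine ⟨v, hT.1 hv, _, T, partialTree_edgeTree (hT.1 hv), ?_, hT, hk, ?_⟩
  · rintro a b ⟨-, ⟨rfl, hb⟩ | ⟨rfl, hb⟩⟩ <;> rw [Finset.mem_singleton] at hb <;> subst hb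
    · exact hv
    · exact hv.symm
  · intro a b ha
    unfold edgeTree at ha
    split_ifs at ha; omega

/-- The memory beyond the matrix is still zero, so a starting tree is written by two stores. This is
why the loop invariant tracks zeros above the stack. -/
theorem init_spec (hn : 2 ≤ n) {s : State} (h0 : s.reg 0 = n) (h1 : s.reg 1 = k) (h2 : s.reg 2 = 1)
    (hG : HasMatrix G s.mem) (hz : ∀ a, n * n ≤ a → s.mem a = 0) :
    ∃ L, SearchInv G k (init.den s) L ∧ L.length ≤ n ∧
      (init.den s).reg 4 = (init.den s).reg 5 - (init.den s).reg 6 := by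
  let r : Fin n := ⟨0, by omega⟩
  set s₁ := (Cmd.set 6 0).den s with hs₁
  obtain ⟨s₂, ⟨-, a0, a1, a2, am, a6⟩, hs₂⟩ := den_forn (i := 13) (p := add 6 6 0) (s := s₁)
    (fun m s' => m ≤ n ∧ s'.reg 0 = n ∧ s'.reg 1 = k ∧ s'.reg 2 = 1 ∧ s'.mem = s.mem ∧
      s'.reg 6 = (n - m) * n) (n := n) (by simp [hs₁, den, h0])
    ⟨le_rfl, by simp [hs₁, den, h0], by simp [hs₁, den, h1], by simp [hs₁, den, h2], rfl,
      by simp [hs₁, den]⟩ (by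
      rintro m s' hm ⟨-, g0, g1, g2, gm, g6⟩
      refine ⟨hm.le, by simp [den, g0], by simp [den, g1], by simp [den, g2], gm, ?_⟩
      have : n - m = n - (m + 1) + 1 := by omega
      simp [den, g0, g6, this, add_mul])
  set s₃ := (Cmd.block [copy 5 6, set 23 0]).den ((forn 13 (add 6 6 0)).den s₁) with hs₃
  rw [hs₂] at hs₃
  have b0 : s₃.reg 0 = n := by simp [hs₃, den, Cmd.block, a0]
  let I : ℕ → State → Prop := fun m s' => Setup G s' ∧ s'.reg 1 = k ∧ s'.reg 23 = 0 ∧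
    (∀ a, s'.reg 5 ≤ a → s'.mem a = 0) ∧
    ∃ L, HasStack s'.mem (n * n) L (s'.reg 5) ∧ L.length + m ≤ n ∧
      (∀ v : Fin n, m ≤ v → G.Adj r v → edgeTree r v ∈ L) ∧
      ∀ σ ∈ L, ∃ v, G.Adj r v ∧ σ = edgeTree r v
  have hI₁ : I n s₃ := by
    refine ⟨⟨b0, by simp [hs₃, den, Cmd.block, a2], by simp [hs₃, den, Cmd.block, a6], ?_⟩,
      by simp [hs₃, den, Cmd.block, a1], by simp [hs₃, den, Cmd.block], fun a ha => ?_,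
      [], ?_, by simp, fun v hv => ?_, by simp⟩
    · simp only [hs₃, den, Cmd.block, am]; exact hG
    · have : n * n ≤ a := by simpa [hs₃, den, Cmd.block, a6] using ha
      simpa [hs₃, den, Cmd.block, am] using hz a this
    · simp [hs₃, den, Cmd.block, a6, HasStack]
    · have := v.isLt; omega
  have step : ∀ m s', m < n → I (m + 1) s' →
      I m (initBody.den { s' with reg := Function.update s'.reg 13 m }) := by
    rintro m s' hm ⟨gs, g1, g23, gz, L, gL, gl, gc, gv⟩
    have g0 := gs.size
    have g2 := gs.one
    have g6 := gs.base
    have hmin : min m n = m := by omega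
    have hle := gL.le
    -- The root is vertex `0`, whose row of the matrix begins at address `0`, so the counter serves
    -- as the address.
    have e : s'.mem m = if G.Adj r ⟨m, hm⟩ then 1 else 0 := by
      have := gs.matrix r ⟨m, hm⟩
      simpa [r] using this
    have key : ∀ v : Fin n, m ≤ v → v = ⟨m, hm⟩ ∨ m + 1 ≤ v := by
      intro v hv
      by_cases h1 : (v : ℕ) = m
      · exact Or.inl (Fin.ext h1)
      · exact Or.inr (by omega)
    set s₄ := initBody.den { s' with reg := Function.update s'.reg 13 m } with hs₄
    have k4 : ∀ x, x ∉ 13 :: initBody.writes → s₄.reg x = s'.reg x := by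
      intro x hx
      rw [List.mem_cons, not_or] at hx
      rw [hs₄, den_reg hx.2]
      simp [hx.1]
    by_cases ha : G.Adj r ⟨m, hm⟩
    · rw [if_pos ha] at e
      have h5 : s₄.reg 5 = s'.reg 5 + n := by
        simp [hs₄, initBody, den, Cmd.block, e, g0, hmin]
      have hmem : s₄.mem = Function.update (Function.update s'.mem (s'.reg 5) 1)
          (s'.reg 5 + m) 1 := by
        simp [hs₄, initBody, den, Cmd.block, e, g0, g2, hmin]
      have hlow : ∀ a < s'.reg 5, s₄.mem a = s'.mem a := fun a ha => by
        rw [hmem, Function.update_of_ne (by omega), Function.update_of_ne (by omega)]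
      refine ⟨gs.congr (k4 0 (by decide)) (k4 2 (by decide)) (k4 6 (by decide))
        fun a ha => hlow a (by omega), by rw [k4 1 (by decide), g1],
        by rw [k4 23 (by decide), g23], fun a ha => ?_, edgeTree r ⟨m, hm⟩ :: L, ?_, ?_, ?_, ?_⟩
      · rw [hmem, Function.update_of_ne (by omega), Function.update_of_ne (by omega)]
        exact gz a (by omega)
      · refine ⟨_, h5, fun w => ?_, gL.congr hlow⟩
        have hw : s'.mem (s'.reg 5 + w) = 0 := gz _ (by omega)
        rw [hmem]
        simp only [Function.update_apply, hw, edgeTree, r, Fin.ext_iff]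
        grind
      · simp only [List.length_cons]; omega
      · intro v hv hav
        rcases key v hv with rfl | hv'
        · simp
        · exact List.mem_cons_of_mem _ (gc v hv' hav)
      · intro σ hσ
        rcases List.mem_cons.1 hσ with rfl | hσ
        · exact ⟨_, ha, rfl⟩
        · exact gv σ hσ
    · rw [if_neg ha] at e
      have h5 : s₄.reg 5 = s'.reg 5 := by simp [hs₄, initBody, den, Cmd.block, e]
      have hmem : s₄.mem = s'.mem := by simp [hs₄, initBody, den, Cmd.block, e]
      refine ⟨gs.congr (k4 0 (by decide)) (k4 2 (by decide)) (k4 6 (by decide))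
        fun a _ => by rw [hmem], by rw [k4 1 (by decide), g1], by rw [k4 23 (by decide), g23],
        by rw [h5, hmem]; exact gz, L, by rw [h5, hmem]; exact gL, by omega, ?_, gv⟩
      intro v hv hav
      rcases key v hv with rfl | hv'
      · exact absurd hav ha
      · exact gc v hv' hav
  obtain ⟨s₄, ⟨gs, g1, g23, -, L, gL, gl, gc, gv⟩, hs₄⟩ := den_forn (i := 13) I b0 hI₁ step
  have he : init.den s = (sub 4 5 6).den { s₄ with reg := Function.update s₄.reg 13 0 } := by
    rw [← hs₄, hs₃, ← hs₂]; rfl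
  rw [he]
  refine ⟨L, ⟨gs.congr ?_ ?_ ?_ fun _ _ => rfl, ?_, ?_, fun σ hσ => ?_, Or.inl ?_, fun h =>
    Or.inr ?_⟩, by omega, ?_⟩
  · simp [den]
  · simp [den]
  · simp [den]
  · simpa [den] using g1
  · simpa [den] using gL
  · obtain ⟨v, hv, rfl⟩ := gv σ hσ
    exact ⟨_, partialTree_edgeTree hv⟩
  · simpa [den] using g23
  · obtain ⟨v, hv, hE⟩ := exists_extendable_edgeTree hn r h
    exact ⟨_, gc v (Nat.zero_le _) hv, hE⟩
  · simp [den]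

/-- The total potential bounds the number of rounds: it is nonnegative and each round lowers it by
at least 1. -/
theorem loop_spec (hn : 1 ≤ n) (hG : IsSubcubic G) {T : ℕ}
    (hT : ∀ s M, s.reg 0 = n → s.reg 2 = 1 → Bounded M s → ∃ t, Exec body.compile s t (body.den s) ∧
      t ≤ T * unit (M + T) ∧ Bounded (M + T) (body.den s)) (N : ℕ) (s : State)
    (L : List (Fin n → ℕ)) (M : ℕ) (h : SearchInv G k s L) (h4 : s.reg 4 = s.reg 5 - s.reg 6)
    (hN : total G k L ≤ N) (hB : Bounded M s) :
    ∃ t s', Exec (.loop 4 body.compile) s t s' ∧ t ≤ (N * (T + 1) + 1) * unit (M + N * T) ∧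
      SearchInv G k s' [] := by
  induction N generalizing s L M with
  | zero =>
    cases L with
    | nil =>
      have h5 : s.reg 5 = n * n := h.stack
      have h0 : s.reg 4 = 0 := by rw [h4, h5, h.setup.base, Nat.sub_self]
      exact ⟨_, s, .loop_false h0, by simp [h0, unit], h⟩
    | cons σ L =>
      obtain ⟨L', hI, ht, -⟩ := body_spec hG h
      have := total_nonneg (k := k) hG hI.valid
      norm_num at hN
      linarith
  | succ N ih =>
    cases L with
    | nil =>
      have h5 : s.reg 5 = n * n := h.stack
      have h0 : s.reg 4 = 0 := by rw [h4, h5, h.setup.base, Nat.sub_self]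
      refine ⟨_, s, .loop_false h0, ?_, h⟩
      rw [h0, Nat.size_zero]
      exact Nat.mul_pos (by omega) (by unfold unit; omega)
    | cons σ L =>
      obtain ⟨L', hI, ht, h4'⟩ := body_spec hG h
      obtain ⟨q, hq, -, hL⟩ := h.stack
      have h0 : s.reg 4 ≠ 0 := by
        have := hL.le
        have := h.setup.base
        omega
      obtain ⟨t₁, e₁, ht₁, hB₁⟩ := hT s M h.setup.size h.setup.one hB
      obtain ⟨t₂, s', e₂, ht₂, hI'⟩ := ih _ L' _ hI h4' (by push_cast at hN; linarith) hB₁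
      have hM : M + T + N * T = M + (N + 1) * T := by ring
      rw [hM] at ht₂
      refine ⟨_, s', .loop_true h0 e₁ e₂, ?_, hI'⟩
      have u1 := Nat.mul_le_mul_left T (unit_mono (by nlinarith : M + T ≤ M + (N + 1) * T))
      have u2 : 1 + (s.reg 4).size ≤ unit (M + (N + 1) * T) := by
        have := Nat.size_le_size ((hB.1 4).trans (by omega : M ≤ M + (N + 1) * T))
        unfold unit; omega
      calc _ ≤ unit (M + (N + 1) * T) + T * unit (M + (N + 1) * T) +
            (N * (T + 1) + 1) * unit (M + (N + 1) * T) := by omega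
        _ = _ := by ring

/-- The search for instances with at least two vertices. -/
def search : Prog :=
  .seq init.compile (.seq (.loop 4 body.compile) (.instr (.copy 0 23)))

theorem search_spec : ∃ K, 1 ≤ K ∧ ∀ (n k : ℕ) (G : SimpleGraph (Fin n)) (s : State) (M : ℕ), 2 ≤ n →
    IsSubcubic G → s.reg 0 = n → s.reg 1 = k → s.reg 2 = 1 → HasMatrix G s.mem →
    (∀ a, n * n ≤ a → s.mem a = 0) → Bounded M s →
    ∃ (N t : ℕ) (s' : State), Exec search s t s' ∧ 1 ≤ N ∧ (N : ℝ) ≤ 9 * n ^ 2 * 2.7321 ^ k ∧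
      t ≤ 6 * (N * (K * n ^ K)) * unit (M + 2 * (N * (K * n ^ K))) ∧
      s'.reg 0 = if HasInternalSpanningTree G k then 1 else 0 := by
  obtain ⟨K₁, h₁⟩ := exec_compile (c := init) (by decide)
  obtain ⟨K₂, h₂⟩ := exec_compile (c := body) (by decide)
  refine ⟨K₁ + K₂ + 1, by omega, fun n k G s M hn hG h0 h1 h2 hM hz hB => ?_⟩
  have hn1 : 1 ≤ n := by omega
  have l1 : K₁ * n ^ K₁ ≤ (K₁ + K₂ + 1) * n ^ (K₁ + K₂ + 1) := mul_pow_le hn1 (by omega)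
  have l2 : K₂ * n ^ K₂ ≤ (K₁ + K₂ + 1) * n ^ (K₁ + K₂ + 1) := mul_pow_le hn1 (by omega)
  have hT1 : 1 ≤ (K₁ + K₂ + 1) * n ^ (K₁ + K₂ + 1) := Nat.mul_pos (by omega) (by positivity)
  set T := (K₁ + K₂ + 1) * n ^ (K₁ + K₂ + 1)
  obtain ⟨L, hI, hL, h4⟩ := init_spec hn h0 h1 h2 hM hz
  obtain ⟨t₁, e₁, ht₁, hB₁⟩ := h₁ n s M hn1 h0 h2 hB
  have hX : (1 : ℝ) ≤ 2.7321 ^ k := one_le_pow₀ (by norm_num)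
  have hnR : (1 : ℝ) ≤ n := by exact_mod_cast hn1
  have hsum : total G k L ≤ n * (4 * (n + 1) * 2.7321 ^ k) := by
    have h3 : total G k L ≤ L.length * (4 * (n + 1) * 2.7321 ^ k) := by
      have := List.sum_le_card_nsmul (L.map (potential G k)) (4 * (n + 1) * 2.7321 ^ k) (by
        intro x hx
        obtain ⟨σ, -, rfl⟩ := List.mem_map.1 hx
        simpa using potential_le_pow (G := G) (k := k) σ)
      simpa [total] using this
    refine h3.trans (mul_le_mul_of_nonneg_right (by exact_mod_cast hL) (by positivity))
  -- At most `n` starting edges, each with the potential bound of `potential_le_pow`.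
  set N := ⌈(n : ℝ) * (4 * (n + 1) * 2.7321 ^ k)⌉₊
  have hN : total G k L ≤ N := hsum.trans (Nat.le_ceil _)
  have hN1 : 1 ≤ N := Nat.one_le_iff_ne_zero.2 (Nat.ceil_pos.2 (by positivity)).ne'
  have hN2 : (N : ℝ) ≤ 9 * n ^ 2 * 2.7321 ^ k := by
    have h3 := (Nat.ceil_lt_add_one
      (by positivity : 0 ≤ (n : ℝ) * (4 * (n + 1) * 2.7321 ^ k))).le
    refine h3.trans ?_
    have h4 : (n : ℝ) ≤ n ^ 2 := by nlinarith
    have h5 : (1 : ℝ) ≤ n ^ 2 := by nlinarith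
    nlinarith [mul_le_mul_of_nonneg_right h4 (by linarith : (0 : ℝ) ≤ 2.7321 ^ k),
      mul_le_mul_of_nonneg_right h5 (by linarith : (0 : ℝ) ≤ 2.7321 ^ k)]
  obtain ⟨t₂, s', e₂, ht₂, hI'⟩ := loop_spec hn1 hG (T := T) (fun s M h0 h2 hB => by
    obtain ⟨t, e, ht, hB'⟩ := h₂ n s M hn1 h0 h2 hB
    exact ⟨t, e, ht.trans (Nat.mul_le_mul l2 (unit_mono (by omega))), hB'.mono (by omega)⟩)
    N _ L (M + T) hI h4 hN (hB₁.mono (by omega))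
  have h23 : s'.reg 23 = if HasInternalSpanningTree G k then 1 else 0 := by
    split_ifs with h
    · rcases hI'.complete h with h | ⟨σ, hσ, -⟩
      · exact h
      · simp at hσ
    · exact hI'.sound.resolve_right fun h' => h h'.2
  have hNT : T ≤ N * T := Nat.le_mul_of_pos_left _ hN1
  have hNT' : N ≤ N * T := Nat.le_mul_of_pos_right _ hT1
  refine ⟨N, _, _, .seq e₁ (.seq e₂ (.instr _ _)), hN1, hN2, ?_, by simpa [Instr.run] using h23⟩
  have u1 := ht₁.trans (Nat.mul_le_mul (l1.trans hNT)
    (unit_mono (by omega : M + K₁ * n ^ K₁ ≤ M + 2 * (N * T))))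
  have u2 := ht₂.trans (Nat.mul_le_mul (by rw [mul_add]; omega : N * (T + 1) + 1 ≤ 3 * (N * T))
    (unit_mono (by omega : M + T + N * T ≤ M + 2 * (N * T))))
  have u3 : Instr.cost (.copy 0 23) s' ≤ 2 * (N * T) * unit (M + 2 * (N * T)) := by
    have : (s'.reg 23).size ≤ 1 := by rw [h23]; split_ifs <;> simp
    have h3 : 1 ≤ unit (M + 2 * (N * T)) := by unfold unit; omega
    have h5 := Nat.mul_le_mul (by omega : 2 ≤ 2 * (N * T)) h3
    simp only [Instr.cost]
    omega
  calc _ ≤ N * T * unit (M + 2 * (N * T)) + (3 * (N * T) * unit (M + 2 * (N * T)) +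
        2 * (N * T) * unit (M + 2 * (N * T))) := by omega
    _ = _ := by ring

/-- The program that decides the problem. -/
def solve : Prog :=
  .seq (.instr (.const 2 1)) (.seq (.instr (.sub 16 1 0)) (.ite 16 (.instr (.const 0 0))
    (.seq (.instr (.sub 16 0 2)) (.ite 16 search (.instr (.sub 0 2 1))))))

/-- Lets `solve` reject `k > n` at once, so that the search starts with numbers linear in `n`. -/
theorem not_hasInternalSpanningTree (h : n < k) : ¬ HasInternalSpanningTree G k := by
  rintro ⟨T, -, hk⟩
  have := Finset.card_le_univ (internalVertices T)
  rw [Fintype.card_fin] at this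
  omega

/-- A single vertex offers no edge to start from, so this case is answered separately, as `1 - k`.
-/
theorem hasInternalSpanningTree_one_iff {G : SimpleGraph (Fin 1)} :
    HasInternalSpanningTree G k ↔ k = 0 := by
  constructor
  · rintro ⟨T, -, hk⟩
    have : internalVertices T = ∅ := by
      ext v
      rw [mem_internalVertices]
      simp only [Finset.notMem_empty, iff_false]
      rintro ⟨a, b, hab, -⟩
      exact hab (Subsingleton.elim a b)
    rw [this] at hk
    simpa using hk
  · rintro rfl
    exact ⟨G, ⟨le_rfl, IsTree.of_subsingleton⟩, Nat.zero_le _⟩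

theorem hasMatrix_inputState (G : SimpleGraph (Fin n)) (k : ℕ) :
    HasMatrix G (inputState G k).mem := by
  intro i j
  simp only [inputState]
  congr 1
  refine propext ⟨?_, fun h => ⟨i, j, rfl, h⟩⟩
  rintro ⟨i', j', he, h⟩
  have hn : 0 < n := Fin.pos i
  have h1 : i = i' := by
    have := congrArg (· / n) he
    simp only [Nat.mul_add_div hn, Nat.div_eq_of_lt j.isLt, Nat.div_eq_of_lt j'.isLt] at this
    exact Fin.ext (by omega)
  subst h1
  have h2 : j = j' := Fin.ext (by omega)
  exact h2 ▸ h

theorem inputState_mem_eq_zero (G : SimpleGraph (Fin n)) (k : ℕ) {a : ℕ} (ha : n * n ≤ a) :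
    (inputState G k).mem a = 0 := by
  simp only [inputState]
  refine if_neg ?_
  rintro ⟨i, j, rfl, -⟩
  have h1 := i.isLt
  have h2 := j.isLt
  nlinarith

end Main

end MIST

namespace MIST

/-! ### The final time bound -/

section Time

variable {n k : ℕ}

/-- The numbers may be exponential in `n`, but since `k ≤ n` their length is linear in `n`. So the
logarithmic cost adds one factor `n`, and the exponent is `2 + K + 1`. -/
theorem search_time_le {K N : ℕ} (hn : 1 ≤ n) (hk : k ≤ n)
    (hN : (N : ℝ) ≤ 9 * n ^ 2 * 2.7321 ^ k) :
    ((6 * (N * (K * n ^ K)) * Cmd.unit (3 * n + 2 * (N * (K * n ^ K))) : ℕ) : ℝ) ≤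
      54 * K * (57 * K + 22) * 2.7321 ^ k * n ^ (K + 3) := by
  have hN' : N ≤ 9 * n ^ 2 * 4 ^ n := by
    have h1 : (2.7321 : ℝ) ^ k ≤ 4 ^ n :=
      (pow_le_pow_left₀ (by norm_num) (by norm_num) k).trans (pow_le_pow_right₀ (by norm_num) hk)
    have h2 : (N : ℝ) ≤ 9 * n ^ 2 * 4 ^ n :=
      hN.trans (mul_le_mul_of_nonneg_left h1 (by positivity))
    exact_mod_cast h2
  have hsize : (3 * n + 2 * (N * (K * n ^ K))).size ≤ (19 * K + 7) * n := by
    have h1 : 3 * n ≤ 3 * (n ^ (K + 2) * 4 ^ n) := by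
      have h2 : n ≤ n ^ (K + 2) := Nat.le_self_pow (by omega) n
      have h3 : 1 ≤ 4 ^ n := Nat.one_le_pow _ _ (by norm_num)
      exact Nat.mul_le_mul_left 3 (h2.trans (Nat.le_mul_of_pos_right _ h3))
    have h2 : 2 * (N * (K * n ^ K)) ≤ 18 * K * (n ^ (K + 2) * 4 ^ n) :=
      calc 2 * (N * (K * n ^ K)) ≤ 2 * (9 * n ^ 2 * 4 ^ n * (K * n ^ K)) := by gcongr
        _ = _ := by ring
    have h3 : n ^ (K + 2) * 4 ^ n ≤ 2 ^ (n * (K + 4)) :=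
      calc n ^ (K + 2) * 4 ^ n ≤ (2 ^ n) ^ (K + 2) * 4 ^ n := by
            gcongr; exact Nat.lt_two_pow_self.le
        _ = (2 ^ n) ^ (K + 2) * (2 ^ 2) ^ n := by norm_num
        _ = _ := by rw [← pow_mul, ← pow_mul, ← pow_add]; congr 1; ring
    have h4 : 18 * K + 3 < 2 ^ (18 * K + 3) := Nat.lt_two_pow_self
    refine Nat.size_le.2 ?_
    calc 3 * n + 2 * (N * (K * n ^ K)) ≤ (18 * K + 3) * (n ^ (K + 2) * 4 ^ n) := by
          rw [add_mul]; omega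
      _ ≤ (18 * K + 3) * 2 ^ (n * (K + 4)) := by gcongr
      _ < 2 ^ (18 * K + 3) * 2 ^ (n * (K + 4)) := by gcongr
      _ = 2 ^ (18 * K + 3 + n * (K + 4)) := (pow_add _ _ _).symm
      _ ≤ 2 ^ ((19 * K + 7) * n) := Nat.pow_le_pow_right (by norm_num) (by nlinarith)
  have hunit : Cmd.unit (3 * n + 2 * (N * (K * n ^ K))) ≤ (57 * K + 22) * n := by
    unfold Cmd.unit; nlinarith
  calc _ ≤ ((6 * (N * (K * n ^ K)) * ((57 * K + 22) * n) : ℕ) : ℝ) := by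
        exact_mod_cast Nat.mul_le_mul_left _ hunit
    _ = N * (6 * (K * n ^ K) * ((57 * K + 22) * n)) := by push_cast; ring
    _ ≤ 9 * n ^ 2 * 2.7321 ^ k * (6 * (K * n ^ K) * ((57 * K + 22) * n)) := by gcongr
    _ = _ := by ring

theorem bounded_inputState (G : SimpleGraph (Fin n)) (hn : 1 ≤ n) (hk : k ≤ n) :
    Cmd.Bounded n (inputState G k) := by
  refine ⟨fun r => ?_, fun a => ?_⟩ <;> simp only [inputState] <;> split_ifs <;> omega

end Time

theorem exists_answersInTime {K : ℕ} (hK : ∀ (n k : ℕ) (G : SimpleGraph (Fin n)) (s : State) (M : ℕ),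
    2 ≤ n → IsSubcubic G → s.reg 0 = n → s.reg 1 = k → s.reg 2 = 1 → HasMatrix G s.mem →
    (∀ a, n * n ≤ a → s.mem a = 0) → Cmd.Bounded M s →
    ∃ (N t : ℕ) (s' : State), Exec search s t s' ∧ 1 ≤ N ∧ (N : ℝ) ≤ 9 * n ^ 2 * 2.7321 ^ k ∧
      t ≤ 6 * (N * (K * n ^ K)) * Cmd.unit (M + 2 * (N * (K * n ^ K))) ∧
      s'.reg 0 = open Classical in if HasInternalSpanningTree G k then 1 else 0)
    {n k : ℕ} {G : SimpleGraph (Fin n)} (hn : 0 < n) (hG : IsSubcubic G) :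
    ∃ t, AnswersInTime solve G k t ∧
      (t : ℝ) ≤ (54 * K * (57 * K + 22) + 20) * 2.7321 ^ k * n ^ (K + 3) := by
  -- Bernoulli's inequality: it covers the cost of reading a large `k`, which for `k > n` is not
  -- bounded in terms of `n`.
  have hX : 1 + (k : ℝ) * 1.7321 ≤ 2.7321 ^ k := by
    have := one_add_mul_le_pow (by norm_num : (-2 : ℝ) ≤ 1.7321) k
    norm_num at this ⊢
    exact this
  have hn1 : (1 : ℝ) ≤ n := by exact_mod_cast hn
  have hP : (n : ℝ) ≤ n ^ (K + 3) := le_self_pow₀ hn1 (by omega)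
  have hD : 0 ≤ 54 * (K : ℝ) * (57 * K + 22) * 2.7321 ^ k * n ^ (K + 3) := by positivity
  have hC : (54 * (K : ℝ) * (57 * K + 22) + 20) * 2.7321 ^ k * n ^ (K + 3) =
      54 * K * (57 * K + 22) * 2.7321 ^ k * n ^ (K + 3) + 20 * (2.7321 ^ k * n ^ (K + 3)) := by ring
  rw [hC]
  have hk0 : (0 : ℝ) ≤ k := Nat.cast_nonneg k
  have hXP : (2.7321 : ℝ) ^ k ≤ 2.7321 ^ k * n ^ (K + 3) :=
    le_mul_of_one_le_right (by positivity) (hn1.trans hP)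
  have hPX : (n : ℝ) ^ (K + 3) ≤ 2.7321 ^ k * n ^ (K + 3) :=
    le_mul_of_one_le_left (by positivity) (by nlinarith)
  have size_le : ∀ a : ℕ, a.size ≤ a := fun a => Nat.size_le.2 Nat.lt_two_pow_self
  have e1 := Exec.instr (.const 2 1) (inputState G k)
  set s₁ := (Instr.const 2 1).run (inputState G k) with hs₁
  have e2 := Exec.instr (.sub 16 1 0) s₁
  set s₂ := (Instr.sub 16 1 0).run s₁ with hs₂
  have b0 : s₁.reg 0 = n := by simp [hs₁, Instr.run, inputState]
  have b1 : s₁.reg 1 = k := by simp [hs₁, Instr.run, inputState]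
  have b2 : s₁.reg 2 = 1 := by simp [hs₁, Instr.run]
  have c16 : s₂.reg 16 = k - n := by simp [hs₂, Instr.run, b0, b1]
  have c0 : s₂.reg 0 = n := by simp [hs₂, Instr.run, b0]
  have c2 : s₂.reg 2 = 1 := by simp [hs₂, Instr.run, b2]
  have t1 : (Instr.const 2 1).cost (inputState G k) = 2 := by simp [Instr.cost]
  have t2 : (Instr.sub 16 1 0).cost s₁ ≤ 1 + k + n := by
    have := size_le k
    have := size_le n
    simp only [Instr.cost, b0, b1]; omega
  by_cases hkn : n < k
  · refine ⟨_, ⟨_, .seq e1 (.seq e2 (.ite_true (by omega) (.instr _ _))), ?_⟩, ?_⟩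
    · rw [if_neg (not_hasInternalSpanningTree hkn)]
      simp [Instr.run]
    · have t3 : (Instr.const 0 0).cost s₂ = 1 := by simp [Instr.cost]
      have t4 := size_le (s₂.reg 16)
      have t5 : (Instr.const 2 1).cost (inputState G k) + ((Instr.sub 16 1 0).cost s₁ +
        (1 + (s₂.reg 16).size + (Instr.const 0 0).cost s₂)) ≤ 5 + 2 * k := by omega
      have t6 : (((Instr.const 2 1).cost (inputState G k) + ((Instr.sub 16 1 0).cost s₁ +
        (1 + (s₂.reg 16).size + (Instr.const 0 0).cost s₂)) : ℕ) : ℝ) ≤ 5 + 2 * k := by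
        exact_mod_cast t5
      linarith
  · rw [not_lt] at hkn
    have c16' : s₂.reg 16 = 0 := by omega
    have e3 := Exec.instr (.sub 16 0 2) s₂
    set s₃ := (Instr.sub 16 0 2).run s₂ with hs₃
    have d16 : s₃.reg 16 = n - 1 := by simp [hs₃, Instr.run, c0, c2]
    have d0 : s₃.reg 0 = n := by simp [hs₃, Instr.run, c0]
    have d1 : s₃.reg 1 = k := by simp [hs₃, hs₂, Instr.run, b1]
    have d2 : s₃.reg 2 = 1 := by simp [hs₃, Instr.run, c2]
    have dm : s₃.mem = (inputState G k).mem := rfl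
    have t3 : (Instr.sub 16 0 2).cost s₂ ≤ 2 + n := by
      have := size_le n
      simp only [Instr.cost, c0, c2, Nat.size_one]; omega
    have t4 : (s₂.reg 16).size = 0 := by rw [c16', Nat.size_zero]
    have t5 := size_le (s₃.reg 16)
    by_cases hn2 : n = 1
    · subst hn2
      refine ⟨_, ⟨_, .seq e1 (.seq e2 (.ite_false c16' (.seq e3
        (.ite_false (by rw [d16]) (.instr _ _))))), ?_⟩, ?_⟩
      · have : ((Instr.sub 0 2 1).run s₃).reg 0 = 1 - k := by simp [Instr.run, d1, d2]
        rw [this]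
        split_ifs with h <;> rw [hasInternalSpanningTree_one_iff] at h <;> omega
      · have t6 : (Instr.sub 0 2 1).cost s₃ ≤ 3 := by
          have := size_le k
          simp only [Instr.cost, d1, d2, Nat.size_one]; omega
        have t7 : (Instr.const 2 1).cost (inputState G k) + ((Instr.sub 16 1 0).cost s₁ +
          (1 + (s₂.reg 16).size + ((Instr.sub 16 0 2).cost s₂ +
            (1 + (s₃.reg 16).size + (Instr.sub 0 2 1).cost s₃)))) ≤ 20 := by omega
        have t8 : (((Instr.const 2 1).cost (inputState G k) + ((Instr.sub 16 1 0).cost s₁ +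
          (1 + (s₂.reg 16).size + ((Instr.sub 16 0 2).cost s₂ +
            (1 + (s₃.reg 16).size + (Instr.sub 0 2 1).cost s₃)))) : ℕ) : ℝ) ≤ 20 := by
          exact_mod_cast t7
        linarith
    · have hB : Cmd.Bounded (3 * n) s₃ := by
        have h := bounded_inputState G hn hkn
        refine ⟨fun r => ?_, fun a => by rw [dm]; exact (h.2 a).trans (by omega)⟩
        by_cases h16 : r = 16
        · rw [h16, d16]; omega
        · by_cases h2 : r = 2
          · rw [h2, d2]; omega
          · have : s₃.reg r = (inputState G k).reg r := by
              simp [hs₃, hs₂, hs₁, Instr.run, h16, h2]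
            exact this ▸ (h.1 r).trans (by omega)
      obtain ⟨N, t, s', e4, -, hN, ht, h0⟩ := hK n k G s₃ (3 * n) (by omega) hG d0 d1 d2
        (by rw [dm]; exact hasMatrix_inputState G k)
        (fun a ha => by rw [dm]; exact inputState_mem_eq_zero G k ha) hB
      refine ⟨_, ⟨_, .seq e1 (.seq e2 (.ite_false c16' (.seq e3
        (.ite_true (by omega) e4)))), h0⟩, ?_⟩
      have t6 : (Instr.const 2 1).cost (inputState G k) + ((Instr.sub 16 1 0).cost s₁ +
          (1 + (s₂.reg 16).size + ((Instr.sub 16 0 2).cost s₂ +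
            (1 + (s₃.reg 16).size + t)))) ≤ 12 * n + t := by omega
      have t7 : (((Instr.const 2 1).cost (inputState G k) + ((Instr.sub 16 1 0).cost s₁ +
          (1 + (s₂.reg 16).size + ((Instr.sub 16 0 2).cost s₂ +
            (1 + (s₃.reg 16).size + t)))) : ℕ) : ℝ) ≤ 12 * n + t := by
        exact_mod_cast t6
      have t8 := (Nat.cast_le (α := ℝ).2 ht).trans (search_time_le (K := K) hn hkn hN)
      linarith

end MIST

theorem mainTheorem3 :
    ∃ (p : MIST.Prog) (C : ℝ) (c : ℕ),
      ∀ (n k : ℕ) (G : SimpleGraph (Fin n)), 0 < n → MIST.IsSubcubic G →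
        ∃ t : ℕ, MIST.AnswersInTime p G k t ∧ (t : ℝ) ≤ C * (2.7321 : ℝ) ^ k * (n : ℝ) ^ c := by
  obtain ⟨K, -, hK⟩ := MIST.search_spec
  exact ⟨MIST.solve, _, _, fun n k G hn hG => MIST.exists_answersInTime hK hn hG⟩
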